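/- Let $\mathcal M\subset\mathbb R^3$ be a compact connected smooth submanifold without boundary, and let $\mathbf d_{\mathcal M}$ be its geodesic distance. Write points of $\mathbb R^3$ as $x=(x_\alpha,x_3)\in\mathbb R^2\times\mathbb R$. Let $f:\mathbb R^3\times\mathbb R^{3\times3}\to\mathbb R$ be a Carathéodory function with recession function $f^\infty(x,\xi):=\limsup_{t\to+\infty}\frac{f(x,t\xi)}{t}$, and assume: (H1) $f(x_\alpha+\mathbf e_i,x_3,\xi)=f(x_\alpha,x_3,\xi)$ for all $x,\xi$ and $i=1,2$, where $\{\mathbf e_1,\mathbf e_2\}$ is the canonical basis of $\mathbb R^2$; (H2) there are $\alpha,\beta>0$ with $\alpha|\xi|\le f(x,\xi)\le\beta(1+|\xi|)$ for a.e. $x$ and all $\xi$; (H3) there is $L>0$ with $|f(x,\xi)-f(x,\eta)|\le L|\xi-\eta|$ for a.e. $x$ and all $\xi,\eta$; (H4) there are $C>0$ and $0<q<1$ with $|f(x,\xi)-f^\infty(x,\xi)|\le C(1+|\xi|^{1-q})$ for a.e. $x$ and all $\xi$. For an orthonormal basis $\nu=(\nu_1,\nu_2)$ of $\mathbb R^2$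 put $x_\nu:=x_\alpha\cdot\nu_1$, $Q_\nu:=\{\lambda_1\nu_1+\lambda_2\nu_2:\lambda_1,\lambda_2\in(-\frac12,\frac12)\}$, $A_{,1}:=A\times(-\frac12,\frac12)$ for $A\subset\mathbb R^2$, and $Q_{\nu,1}:=(Q_\nu)_{,1}$. For $h>0$ let $\nabla_h u:=\big(\partial_1u\,|\,\partial_2u\,|\,\tfrac1h\partial_3u\big)$. For $a,b\in\mathcal M$ let $u_{a,b,\nu}(x):=a$ if $x_\nu>0$ and $u_{a,b,\nu}(x):=b$ if $x_\nu\le0$, let $$\mathcal G(a,b):=\Big\{\gamma\in C^\infty(\mathbb R;\mathcal M):\ \gamma(t)=a\ \text{for } t\ge\tfrac12,\ \gamma(t)=b\ \text{for } t\le-\tfrac12,\ \int_{\mathbb R}|\dot\gamma|\,dt=\mathbf d_{\mathcal M}(a,b)\Big\},$$ and, with boundary values in the sense of traces, for $t,h>0$ let $$\mathcal A_t(a,b,\nu):=\{\phi\in W^{1,1}((tQ_\nu)_{,1};\mathcal M):\ \phi=u_{a,b,\nu}\ \text{on } \partial(tQ_\nu)\times(-\tfrac12,\tfrac12)\},$$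 $$\mathcal B_h(a,b,\nu):=\{u\in W^{1,1}(Q_{\nu,1};\mathcal M):\ u(x)=\gamma(x_\nu/h)\ \text{on } \partial Q_\nu\times(-\tfrac12,\tfrac12)\ \text{for some } \gamma\in\mathcal G(a,b)\}.$$ Then for every $(a,b,\nu_1)\in\mathcal M\times\mathcal M\times\mathbb S^1$ there is a number $\theta(a,b,\nu_1)\in[0,+\infty)$ such that, for every $\nu_2$ for which $\nu=(\nu_1,\nu_2)$ is an orthonormal basis of $\mathbb R^2$, the following two limits exist and $$\theta(a,b,\nu_1)=\lim_{t\to+\infty}\inf\Big\{\frac1t\int_{(tQ_\nu)_{,1}}f^\infty(y,\nabla\phi)\,dy:\ \phi\in\mathcal A_t(a,b,\nu)\Big\}=\lim_{h\to0^+}\inf\Big\{\int_{Q_{\nu,1}}f^\infty\Big(\frac{x_\alpha}{h},x_3,\nabla_hu\Big)dx:\ u\in\mathcal B_h(a,b,\nu)\Big\}.$$ In particular the limit depends on $\nu$ only through $\nu_1$. -/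

import Mathlib

open Filter Topology MeasureTheory Set
open scoped ENNReal ContDiff RealInnerProductSpace

/-- The plane `ℝ²` of the in-plane variable `x_α`, with its Euclidean structure. -/
abbrev Plane : Type := EuclideanSpace ℝ (Fin 2)

/-- Points `x = (x_α, x₃)` of `ℝ³ = ℝ² × ℝ`. -/
abbrev Pt : Type := Plane × ℝ

/-- The target space `ℝ³`, with the Euclidean norm. -/
abbrev Target : Type := EuclideanSpace ℝ (Fin 3)

/-- The space `ℝ^{3×3}` with the Euclidean (Frobenius) norm; `ξ (i, j)` is the entry in row `i`
and column `j`. -/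
abbrev Mat33 : Type := EuclideanSpace ℝ (Fin 3 × Fin 3)

noncomputable section

/-- The `j`-th column of a `3 × 3` matrix. -/
def matCol (ξ : Mat33) (j : Fin 3) : Target := WithLp.toLp 2 fun i => ξ (i, j)

/-- The canonical basis of `ℝ³ = ℝ² × ℝ`. -/
def basisVec : Fin 3 → Pt :=
  ![(EuclideanSpace.single 0 1, 0), (EuclideanSpace.single 1 1, 0), (0, 1)]

/-- The classical partial derivative `∂φ/∂x_j`. -/
def partialDeriv (φ : Pt → ℝ) (j : Fin 3) (x : Pt) : ℝ := fderiv ℝ φ x (basisVec j)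

/-- Smooth embedded submanifolds of `ℝ³` without boundary (of some dimension `k`), through
flattening charts of the ambient space. -/
def IsSmoothSubmanifold (M : Set Target) : Prop :=
  ∃ k : ℕ, ∀ p ∈ M, ∃ (W : Submodule ℝ Target) (Φ : OpenPartialHomeomorph Target Target),
    Module.finrank ℝ W = k ∧ p ∈ Φ.source ∧
    ContDiffOn ℝ ∞ Φ Φ.source ∧ ContDiffOn ℝ ∞ Φ.symm Φ.target ∧
    ∀ x ∈ Φ.source, (x ∈ M ↔ Φ x ∈ W)

/-- The geodesic distance `d_M(a,b)`: infimum of the lengths of the `C¹` curves `[0,1] → M` from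
`a` to `b` (it is `∞` if there is no such curve). -/
def geodesicDist (M : Set Target) (a b : Target) : ℝ≥0∞ :=
  ⨅ (c : ℝ → Target) (_ : ContDiffOn ℝ 1 c (Icc 0 1) ∧ MapsTo c (Icc 0 1) M ∧
      c 0 = a ∧ c 1 = b),
    ∫⁻ s in Icc (0 : ℝ) 1, ‖derivWithin c (Icc 0 1) s‖ₑ

/-- The family `𝒢(a,b)` of geodesic profiles between `a` and `b`. -/
def geodesicProfiles (M : Set Target) (a b : Target) : Set (ℝ → Target) :=
  {γ | ContDiff ℝ ∞ γ ∧ (∀ t, γ t ∈ M) ∧ (∀ t, 1 / 2 ≤ t → γ t = a) ∧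
    (∀ t, t ≤ -(1 / 2) → γ t = b) ∧ ∫⁻ t, ‖deriv γ t‖ₑ = geodesicDist M a b}

/-- Carathéodory integrands: (Lebesgue) measurable in the first variable, continuous in the second
one. -/
def IsCaratheodory (f : Pt → Mat33 → ℝ) : Prop :=
  (∀ ξ, AEMeasurable (fun x => f x ξ) volume) ∧ ∀ᵐ x : Pt, Continuous (f x)

/-- The recession function `f^∞(x,ξ) = limsup_{t → +∞} f(x,tξ)/t`. -/
def recession (f : Pt → Mat33 → ℝ) (x : Pt) (ξ : Mat33) : ℝ :=
  limsup (fun t : ℝ => f x (t • ξ) / t) atTop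

/-- For an orthonormal basis `(ν₁,ν₂)` of `ℝ²`, the open square `t Q_ν`, i.e. the set of all
`λ₁ ν₁ + λ₂ ν₂` with `λ₁, λ₂ ∈ (-t/2, t/2)`. -/
def square (ν₁ ν₂ : Plane) (t : ℝ) : Set Plane :=
  {x | ⟪x, ν₁⟫ ∈ Ioo (-(t / 2)) (t / 2) ∧ ⟪x, ν₂⟫ ∈ Ioo (-(t / 2)) (t / 2)}

/-- The cylinder `(t Q_ν)_{,1} = t Q_ν × (-1/2, 1/2)`. -/
def cylinder (ν₁ ν₂ : Plane) (t : ℝ) : Set Pt :=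
  square ν₁ ν₂ t ×ˢ Ioo (-(1 / 2) : ℝ) (1 / 2)

/-- `u ∈ W^{1,1}(Ω; M)` with weak gradient `∇u = G` (whose `j`-th column is `∂u/∂x_j`). -/
structure IsSobolevMap (M : Set Target) (Ω : Set Pt) (u : Pt → Target) (G : Pt → Mat33) :
    Prop where
  integrable : IntegrableOn u Ω
  integrable_grad : IntegrableOn G Ω
  mem : ∀ᵐ x ∂(volume.restrict Ω), u x ∈ M
  weak_grad : ∀ φ : Pt → ℝ, ContDiff ℝ ∞ φ → HasCompactSupport φ → tsupport φ ⊆ Ω →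
    ∀ j : Fin 3, ∫ x in Ω, partialDeriv φ j x • u x = -∫ x in Ω, φ x • matCol (G x) j

/-- The flux `∫_Γ n_j F dℋ²` through the lateral boundary `Γ = ∂(t Q_ν) × (-1/2,1/2)`, where `n` is
the outer unit normal: the integral over the two faces orthogonal to `ν₁` (on which `n = ±ν₁`)
and over the two faces orthogonal to `ν₂` (on which `n = ±ν₂`). -/
def lateralFlux (ν₁ ν₂ : Plane) (t : ℝ) (j : Fin 3) (F : Pt → Target) : Target :=
  ∫ q in Ioo (-(t / 2)) (t / 2) ×ˢ Ioo (-(1 / 2) : ℝ) (1 / 2),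
    (![ν₁ 0, ν₁ 1, 0] j •
        (F ((t / 2) • ν₁ + q.1 • ν₂, q.2) - F (-(t / 2) • ν₁ + q.1 • ν₂, q.2)) +
      ![ν₂ 0, ν₂ 1, 0] j •
        (F (q.1 • ν₁ + (t / 2) • ν₂, q.2) - F (q.1 • ν₁ + -(t / 2) • ν₂, q.2)))

/-- `u = g` on `∂(t Q_ν) × (-1/2,1/2)` in the sense of traces, for `u ∈ W^{1,1}` with weak gradient
`G`: the Gauss-Green formula that characterizes the trace on the lateral boundary, tested
with functions that need not vanish on it but vanish near `x₃ = ±1/2` (so that nothing is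
prescribed on the top and bottom faces). -/
def HasLateralTrace (ν₁ ν₂ : Plane) (t : ℝ) (u : Pt → Target) (G : Pt → Mat33)
    (g : Pt → Target) : Prop :=
  ∀ φ : Pt → ℝ, ContDiff ℝ ∞ φ → HasCompactSupport φ →
    tsupport φ ⊆ univ ×ˢ Ioo (-(1 / 2) : ℝ) (1 / 2) →
    ∀ j : Fin 3,
      ∫ x in cylinder ν₁ ν₂ t, (partialDeriv φ j x • u x + φ x • matCol (G x) j) =
        lateralFlux ν₁ ν₂ t j fun x => φ x • g x

/-- The function `u_{a,b,ν}`: `a` where `x_ν > 0`, and `b` where `x_ν ≤ 0`. -/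
def jumpProfile (a b : Target) (ν₁ : Plane) (x : Pt) : Target :=
  open Classical in if 0 < ⟪x.1, ν₁⟫ then a else b

/-- The class `𝒜_t(a,b,ν)`, of pairs (map, weak gradient). -/
def classA (M : Set Target) (a b : Target) (ν₁ ν₂ : Plane) (t : ℝ) :
    Set ((Pt → Target) × (Pt → Mat33)) :=
  {p | IsSobolevMap M (cylinder ν₁ ν₂ t) p.1 p.2 ∧
    HasLateralTrace ν₁ ν₂ t p.1 p.2 (jumpProfile a b ν₁)}

/-- The class `ℬ_h(a,b,ν)`, of pairs (map, weak gradient). -/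
def classB (M : Set Target) (a b : Target) (ν₁ ν₂ : Plane) (h : ℝ) :
    Set ((Pt → Target) × (Pt → Mat33)) :=
  {p | IsSobolevMap M (cylinder ν₁ ν₂ 1) p.1 p.2 ∧
    ∃ γ ∈ geodesicProfiles M a b,
      HasLateralTrace ν₁ ν₂ 1 p.1 p.2 fun x => γ (⟪x.1, ν₁⟫ / h)}

/-- The rescaling `(ξ₁|ξ₂|ξ₃) ↦ (ξ₁|ξ₂|ξ₃/h)`, which turns `∇u` into `∇_h u`. -/
def rescaleGrad (h : ℝ) (ξ : Mat33) : Mat33 :=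
  WithLp.toLp 2 fun ij => if ij.2 = 2 then ξ ij / h else ξ ij

/-- `inf { (1/t) ∫_{(tQ_ν)_{,1}} f^∞(y,∇φ) dy : φ ∈ 𝒜_t(a,b,ν) }`, in `[0,∞]`. -/
def minEnergyA (f : Pt → Mat33 → ℝ) (M : Set Target) (a b : Target) (ν₁ ν₂ : Plane) (t : ℝ) :
    ℝ≥0∞ :=
  ⨅ p ∈ classA M a b ν₁ ν₂ t,
    ENNReal.ofReal (1 / t) *
      ∫⁻ y in cylinder ν₁ ν₂ t, ENNReal.ofReal (recession f y (p.2 y))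

/-- `inf { ∫_{Q_{ν,1}} f^∞(x_α/h, x₃, ∇_h u) dx : u ∈ ℬ_h(a,b,ν) }`, in `[0,∞]`. -/
def minEnergyB (f : Pt → Mat33 → ℝ) (M : Set Target) (a b : Target) (ν₁ ν₂ : Plane) (h : ℝ) :
    ℝ≥0∞ :=
  ⨅ p ∈ classB M a b ν₁ ν₂ h,
    ∫⁻ x in cylinder ν₁ ν₂ 1,
      ENNReal.ofReal (recession f (h⁻¹ • x.1, x.2) (rescaleGrad h (p.2 x)))

end

/-!
Two facts carry the proof: the minimal energies on large squares are approximately subadditive in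
the side of the square, and competitors can be exchanged between the boundary conditions of the two
problems at a cost that does not depend on the square.

*Geodesic profiles exist* (`geodesicProfiles_nonempty`), so that the second problem is not void. A
pointwise ultrafilter limit of almost minimizing arcs is a curve along which the geodesic distance
is proportional to the parameter (`IsSmoothSubmanifold.exists_metric_geodesic`). As the geodesic
distance exceeds the Euclidean one by at most a quadratic term
(`IsSmoothSubmanifold.geodesicDist_le_quadratic`), the parallelogram law bounds the second
differences of this curve by `O(h^{3/2})`, which makes it `C¹`
(`exists_hasDerivWithinAt_of_second_difference`). In a flattening chart it then solves the weak
Euler-Lagrange equation of the energy, and the du Bois-Reymond lemma and a bootstrap show that it is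
smooth up to its ends (`FlatChart.contDiffOn_of_minimizing`). Reparametrized so as to stop smoothly
at its ends, it is a geodesic profile.

*Gluing.* All problems are infima `rectEnergy` over maps on rectangular cylinders whose lateral
trace is prescribed by a Gauss-Green formula. In this formulation gluing along a common face is the
cancellation of two terms (`RectAdm.glue`), so `rectEnergy` is subadditive with respect to the
subdivision of rectangles. It is also invariant under translations by integer vectors, by the
periodicity of the integrand. The competitors that are built explicitly are all *transitions*: maps
`γ ((p - c q) / δ q)` of the two in-plane coordinates `p` and `q`, with a geodesic profile `γ` and
centre `c` and width `δ` that are affine in `q`. By scaling, each line `q = const` contributes at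
most a multiple of the length of `γ`, whatever the width, so that the energy is at most a constant
times the height of the rectangle times `d_M(a,b)` (`rectEnergy_transition_le`); the width may
vanish at an end, where the transition becomes a jump. Beside a transition the map is constant and
costs nothing.

*Comparison.* The recession function is positively homogeneous in the gradient, so the dilation of
the in-plane variables by `1/h` turns the second problem into a minimization on the square of side
`1/h` with boundary values `γ (x_α·ν₁)` (`le_minEnergyB`, `minEnergyB_le`), while the first one is a
minimization on the square of side `t` with a jump as boundary value. In a shell of thickness `1`
around a square, a transition whose width goes from `0` to `1`, or from `1` to `0`, passes from one
kind of boundary value to the other at bounded cost (`squareEnergy_profile_le_jump`,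
`squareEnergy_jump_le_profile`). Divided by the side, the minimal energies of both problems
therefore have the same limit as those for one fixed profile, if the latter have a limit.

*The limit.* A cell of height `t + 4` contains an integer translate of the square of side `t`, whose
distance from the line `x_α·ν₁ = 0` is at most `1`. A transition that moves its centre to this
translate and back costs a bounded amount (`rectEnergy_cell_le`). Stacking cells along the direction
`ν₂` gives approximate subadditivity (`squareEnergy_subadditive`), and a Fekete argument gives the
limit (`exists_tendsto_div_of_subadditive`). Given `ν₁`, the vector `ν₂` is determined up to its
sign, which does not affect the square (`squareEnergy_frame`); hence the limit depends on `ν₁` only.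
-/

/-! ### Arcs and the geodesic distance -/

/-- `C¹` arcs in `M` over `[s, t]`, together with their velocity `c'`. -/
structure IsArc (M : Set Target) (c c' : ℝ → Target) (s t : ℝ) : Prop where
  le : s ≤ t
  hasDeriv : ∀ r ∈ Icc s t, HasDerivWithinAt c (c' r) (Icc s t) r
  cont : ContinuousOn c' (Icc s t)
  mapsTo : MapsTo c (Icc s t) M

namespace IsArc

variable {M : Set Target} {c c' : ℝ → Target} {s t : ℝ}

lemma intervalIntegrable_norm (h : IsArc M c c' s t) :
    IntervalIntegrable (fun r => ‖c' r‖) volume s t :=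
  (h.cont.norm.mono (by rw [uIcc_of_le h.le])).intervalIntegrable

lemma length_nonneg (h : IsArc M c c' s t) : 0 ≤ ∫ r in s..t, ‖c' r‖ :=
  intervalIntegral.integral_nonneg h.le fun _ _ => norm_nonneg _

lemma sub_arc (h : IsArc M c c' s t) {u w : ℝ} (huw : u ≤ w) (hsu : s ≤ u) (hwt : w ≤ t) :
    IsArc M c c' u w :=
  ⟨huw, fun r hr => (h.hasDeriv r (Icc_subset_Icc hsu hwt hr)).mono (Icc_subset_Icc hsu hwt),
    h.cont.mono (Icc_subset_Icc hsu hwt), h.mapsTo.mono_left (Icc_subset_Icc hsu hwt)⟩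

lemma comp (h : IsArc M c c' s t) {φ φ' : ℝ → ℝ} {u w : ℝ} (huw : u ≤ w)
    (hφ : ∀ r, HasDerivAt φ (φ' r) r) (hφ' : Continuous φ')
    (hmaps : MapsTo φ (Icc u w) (Icc s t)) :
    IsArc M (c ∘ φ) (fun r => φ' r • c' (φ r)) u w where
  le := huw
  hasDeriv r hr := by
    exact (h.hasDeriv (φ r) (hmaps hr)).scomp r (hφ r).hasDerivWithinAt hmaps
  cont := hφ'.continuousOn.smul (h.cont.comp
    (fun r _ => (hφ r).continuousAt.continuousWithinAt) hmaps)
  mapsTo := h.mapsTo.comp hmaps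

lemma integral_comp (h : IsArc M c c' s t) {φ φ' : ℝ → ℝ} {u w : ℝ} (huw : u ≤ w)
    (hφ : ∀ r, HasDerivAt φ (φ' r) r) (hφ' : Continuous φ') (hnn : ∀ r, 0 ≤ φ' r)
    (hmaps : MapsTo φ (Icc u w) (Icc s t)) :
    ∫ r in u..w, ‖φ' r • c' (φ r)‖ = ∫ r in φ u..φ w, ‖c' r‖ := by
  rw [← intervalIntegral.integral_comp_mul_deriv' (f := φ) (f' := φ') (g := fun r => ‖c' r‖)
    (fun r _ => hφ r) hφ'.continuousOn
    (h.cont.norm.mono (by rw [uIcc_of_le huw]; exact hmaps.image_subset))]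
  refine intervalIntegral.integral_congr fun r _ => ?_
  simp [norm_smul, abs_of_nonneg (hnn r), mul_comm]

lemma norm_sub_le_length (h : IsArc M c c' s t) : ‖c t - c s‖ ≤ ∫ r in s..t, ‖c' r‖ := by
  have : ∫ r in s..t, c' r = c t - c s :=
    intervalIntegral.integral_eq_sub_of_hasDerivAt_of_le h.le
      (fun r hr => (h.hasDeriv r hr).continuousWithinAt)
      (fun r hr => (h.hasDeriv r (Ioo_subset_Icc_self hr)).hasDerivAt (Icc_mem_nhds hr.1 hr.2))
      (h.cont.mono (by rw [uIcc_of_le h.le])).intervalIntegrable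
  rw [← this]
  exact intervalIntegral.norm_integral_le_integral_norm h.le

lemma geodesicDist_le (h : IsArc M c c' s t) :
    geodesicDist M (c s) (c t) ≤ ENNReal.ofReal (∫ r in s..t, ‖c' r‖) := by
  -- the affine parametrization over `[0, 1]`
  have h1 : ∀ r : ℝ, HasDerivAt (fun r => s + (t - s) * r) (t - s) r := fun r => by
    simpa using ((hasDerivAt_id r).const_mul (t - s)).const_add s
  have hmaps : MapsTo (fun r => s + (t - s) * r) (Icc 0 1) (Icc s t) := fun r hr => by
    have := h.le
    constructor <;> nlinarith [hr.1, hr.2]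
  have hA := h.comp zero_le_one h1 continuous_const hmaps
  have hL := h.integral_comp zero_le_one h1 continuous_const (fun _ => sub_nonneg.2 h.le) hmaps
  have hd : ∀ r ∈ Icc (0 : ℝ) 1, derivWithin (c ∘ fun r => s + (t - s) * r) (Icc 0 1) r =
      (t - s) • c' (s + (t - s) * r) := fun r hr =>
    (hA.hasDeriv r hr).derivWithin (uniqueDiffOn_Icc_zero_one r hr)
  refine (iInf₂_le (c ∘ fun r => s + (t - s) * r) ⟨?_, hA.mapsTo, by simp, by simp⟩).trans ?_
  · rw [setLIntegral_congr_fun measurableSet_Icc (g := fun r => ‖(t - s) • c' (s + (t - s) * r)‖ₑ)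
      (fun r hr => by simp only; rw [hd r hr])]
    have : ∫ r in s..t, ‖c' r‖ = ∫ r in (0:ℝ)..1, ‖(t - s) • c' (s + (t - s) * r)‖ := by
      rw [hL]; simp
    rw [this, intervalIntegral.integral_of_le zero_le_one, ← integral_Icc_eq_integral_Ioc,
      ofReal_integral_eq_lintegral_ofReal]
    · simp [ofReal_norm]
    · exact (hA.cont.norm).integrableOn_Icc
    · exact Eventually.of_forall fun _ => norm_nonneg _
  · refine (contDiffOn_one_iff_derivWithin uniqueDiffOn_Icc_zero_one).2
      ⟨fun r hr => (hA.hasDeriv r hr).differentiableWithinAt, hA.cont.congr hd⟩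

end IsArc

section GeodesicDistance

variable {M : Set Target} {a b x y z : Target}

lemma exists_arc_of_geodesicDist_lt {K : ℝ≥0∞} (h : geodesicDist M a b < K) :
    ∃ c c' : ℝ → Target, IsArc M c c' 0 1 ∧ c 0 = a ∧ c 1 = b ∧
      ENNReal.ofReal (∫ r in (0:ℝ)..1, ‖c' r‖) < K := by
  simp only [geodesicDist, iInf_lt_iff] at h
  obtain ⟨c, ⟨hc, hm, h0, h1⟩, hK⟩ := h
  obtain ⟨hd, hcont⟩ := (contDiffOn_one_iff_derivWithin uniqueDiffOn_Icc_zero_one).1 hc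
  refine ⟨c, derivWithin c (Icc 0 1), ⟨zero_le_one, fun r hr => (hd r hr).hasDerivWithinAt, hcont,
    hm⟩, h0, h1, ?_⟩
  rw [intervalIntegral.integral_of_le zero_le_one, ← integral_Icc_eq_integral_Ioc,
      ofReal_integral_eq_lintegral_ofReal hcont.norm.integrableOn_Icc
      (Eventually.of_forall fun _ => norm_nonneg _)]
  simpa [ofReal_norm] using hK

lemma enorm_sub_le_geodesicDist : ‖x - y‖ₑ ≤ geodesicDist M x y := by
  refine le_of_forall_gt fun K hK => ?_
  obtain ⟨c, c', hc, rfl, rfl, hlt⟩ := exists_arc_of_geodesicDist_lt hK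
  refine lt_of_le_of_lt ?_ hlt
  rw [← ofReal_norm, norm_sub_rev]
  exact ENNReal.ofReal_le_ofReal hc.norm_sub_le_length

lemma geodesicDist_self (hx : x ∈ M) : geodesicDist M x x = 0 := by
  have h : IsArc M (fun _ => x) (fun _ => 0) 0 1 :=
    ⟨zero_le_one, fun r _ => hasDerivWithinAt_const _ _ _, continuousOn_const, fun _ _ => hx⟩
  simpa using h.geodesicDist_le

/-- An arc can be reparametrized, by the smooth transition from `0` to `1`, so that it is defined on
all of `ℝ`, rests outside `[0, 1]` and keeps its length. -/
lemma IsArc.exists_stopped {c c' : ℝ → Target} (h : IsArc M c c' 0 1) :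
    ∃ e e' : ℝ → Target, e = c ∘ Real.smoothTransition ∧ (∀ r, HasDerivAt e (e' r) r) ∧
      Continuous e' ∧ (∀ r, e r ∈ M) ∧
      (∀ r ≤ 0, e r = c 0) ∧ (∀ r ≥ 1, e r = c 1) ∧ (∀ r ≤ 0, e' r = 0) ∧ (∀ r ≥ 1, e' r = 0) ∧
      ∫ r in (0:ℝ)..1, ‖e' r‖ = ∫ r in (0:ℝ)..1, ‖c' r‖ := by
  have hφ : ∀ r, HasDerivAt Real.smoothTransition (deriv Real.smoothTransition r) r := fun r =>
    ((Real.smoothTransition.contDiff (n := 1)).differentiable one_ne_zero r).hasDerivAt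
  have hφ' : Continuous (deriv Real.smoothTransition) :=
    (Real.smoothTransition.contDiff (n := 1)).continuous_deriv le_rfl
  have hmem : ∀ r, Real.smoothTransition r ∈ Icc (0:ℝ) 1 := fun r =>
    ⟨Real.smoothTransition.nonneg r, Real.smoothTransition.le_one r⟩
  have hz0 : ∀ r : ℝ, r ≤ 0 → deriv Real.smoothTransition r = 0 := fun r hr =>
    (uniqueDiffWithinAt_Iic r).eq_deriv _ (hφ r).hasDerivWithinAt
      ((hasDerivWithinAt_const r _ (0:ℝ)).congr_of_mem
        (fun y hy => Real.smoothTransition.zero_of_nonpos (le_trans hy hr)) (by simp))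
  have hz1 : ∀ r : ℝ, 1 ≤ r → deriv Real.smoothTransition r = 0 := fun r hr =>
    (uniqueDiffWithinAt_Ici r).eq_deriv _ (hφ r).hasDerivWithinAt
      ((hasDerivWithinAt_const r _ (1:ℝ)).congr_of_mem
        (fun y hy => Real.smoothTransition.one_of_one_le (le_trans hr hy)) (by simp))
  refine ⟨c ∘ Real.smoothTransition,
    fun r => deriv Real.smoothTransition r • c' (Real.smoothTransition r), rfl, fun r => ?_, ?_,
    fun r => h.mapsTo (hmem r), fun r hr => ?_, fun r hr => ?_, fun r hr => ?_, fun r hr => ?_, ?_⟩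
  · rw [← hasDerivWithinAt_univ]
    exact (h.hasDeriv _ (hmem r)).scomp r (hφ r).hasDerivWithinAt fun r _ => hmem r
  · exact hφ'.smul (h.cont.comp_continuous Real.smoothTransition.continuous hmem)
  · simp [Real.smoothTransition.zero_of_nonpos hr]
  · simp [Real.smoothTransition.one_of_one_le hr]
  · simp [hz0 r hr]
  · simp [hz1 r hr]
  · rw [h.integral_comp zero_le_one hφ hφ' (fun r => Real.smoothTransition.monotone.deriv_nonneg)
      fun r _ => hmem r]
    simp

lemma geodesicDist_triangle : geodesicDist M x z ≤ geodesicDist M x y + geodesicDist M y z := by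
  rcases eq_or_ne (geodesicDist M x y) ⊤ with h1 | h1
  · simp [h1]
  rcases eq_or_ne (geodesicDist M y z) ⊤ with h2 | h2
  · simp [h2]
  refine ENNReal.le_of_forall_pos_le_add fun ε hε _ => ?_
  have hε2 : (ε : ℝ≥0∞) / 2 ≠ 0 := by simp [hε.ne']
  obtain ⟨c₁, c₁', hc₁, h10, h11, hl₁⟩ :=
    exists_arc_of_geodesicDist_lt (ENNReal.lt_add_right h1 hε2)
  obtain ⟨c₂, c₂', hc₂, h20, h21, hl₂⟩ :=
    exists_arc_of_geodesicDist_lt (ENNReal.lt_add_right h2 hε2)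
  obtain ⟨e₁, e₁', -, hd₁, hk₁, hm₁, ha₁, hb₁, hz₁, hy₁, hi₁⟩ := hc₁.exists_stopped
  obtain ⟨e₂, e₂', -, hd₂, hk₂, hm₂, ha₂, hb₂, hz₂, hy₂, hi₂⟩ := hc₂.exists_stopped
  -- as the stopped arcs are constant outside `[0, 1]`, their concatenation is a sum
  have hE : IsArc M (fun r => e₁ r + e₂ (r - 1) - y) (fun r => e₁' r + e₂' (r - 1)) 0 2 := by
    refine ⟨by norm_num, fun r _ => ?_, by fun_prop, fun r _ => ?_⟩
    · have := (hd₂ (r - 1)).scomp r ((hasDerivAt_id r).sub_const 1)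
      simp only [id, one_smul] at this
      exact (((hd₁ r).add this).sub_const y).hasDerivWithinAt
    · rcases le_total r 1 with hr | hr
      · rw [ha₂ (r - 1) (by linarith), h20]; simpa using hm₁ r
      · rw [hb₁ r hr, h11]; simpa using hm₂ _
  have := hE.geodesicDist_le
  simp only [ha₁ 0 le_rfl, h10, ha₂ (0 - 1) (by norm_num), h20, hb₁ 2 (by norm_num), h11,
    hb₂ (2 - 1) (by norm_num), h21, add_sub_cancel_right, add_sub_cancel_left] at this
  refine this.trans ?_
  have hlen : ∫ r in (0:ℝ)..2, ‖e₁' r + e₂' (r - 1)‖ =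
      (∫ r in (0:ℝ)..1, ‖c₁' r‖) + ∫ r in (0:ℝ)..1, ‖c₂' r‖ := by
    rw [← intervalIntegral.integral_add_adjacent_intervals (b := 1)
      (Continuous.intervalIntegrable (by fun_prop) _ _)
      (Continuous.intervalIntegrable (by fun_prop) _ _), ← hi₁, ← hi₂]
    congr 1
    · refine intervalIntegral.integral_congr fun r hr => ?_
      rw [uIcc_of_le zero_le_one] at hr
      simp [hz₂ (r - 1) (by linarith [hr.2])]
    · have : ∫ r in (0:ℝ)..1, ‖e₂' r‖ = ∫ r in (1:ℝ)..2, ‖e₂' (r - 1)‖ := by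
        rw [intervalIntegral.integral_comp_sub_right (fun r => ‖e₂' r‖) 1]; norm_num
      rw [this]
      refine intervalIntegral.integral_congr fun r hr => ?_
      rw [uIcc_of_le one_le_two] at hr
      simp [hy₁ r hr.1]
  rw [hlen, ENNReal.ofReal_add hc₁.length_nonneg hc₂.length_nonneg]
  calc _ ≤ (geodesicDist M x y + ε / 2) + (geodesicDist M y z + ε / 2) :=
        add_le_add hl₁.le hl₂.le
    _ = geodesicDist M x y + geodesicDist M y z + ε := by
        rw [add_add_add_comm, ENNReal.add_halves]

end GeodesicDistance

/-! ### Flattening charts -/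

/-- A flattening chart of `M` around `p`: on the ball of radius `r` around `Φ p`, the submanifold is
the image of a piece of the linear space `W` under the smooth map `Ψ`, inverse to `Φ`. -/
structure FlatChart (M : Set Target) (p : Target) (W : Submodule ℝ Target)
    (Φ Ψ : Target → Target) (U : Set Target) (r : ℝ) : Prop where
  pos : 0 < r
  isOpen : IsOpen U
  mem : p ∈ U
  smooth : ContDiffOn ℝ ∞ Φ U
  smooth_symm : ContDiffOn ℝ ∞ Ψ (Metric.ball (Φ p) r)
  mapsTo : MapsTo Φ U (Metric.ball (Φ p) r)
  mapsTo_symm : MapsTo Ψ (Metric.ball (Φ p) r) U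
  left_inv : ∀ x ∈ U, Ψ (Φ x) = x
  right_inv : ∀ z ∈ Metric.ball (Φ p) r, Φ (Ψ z) = z
  mem_of_mem : ∀ x ∈ U, x ∈ M → Φ x ∈ W
  symm_mem : ∀ z ∈ Metric.ball (Φ p) r, z ∈ W → Ψ z ∈ M

lemma IsSmoothSubmanifold.exists_flatChart {M : Set Target} (hM : IsSmoothSubmanifold M)
    {p : Target} (hp : p ∈ M) :
    ∃ W Φ Ψ U r, FlatChart M p W Φ Ψ U r := by
  obtain ⟨k, hk⟩ := hM
  obtain ⟨W, Φ, -, hpΦ, hs, hs', hW⟩ := hk p hp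
  obtain ⟨r, hr, hball⟩ := Metric.isOpen_iff.1 Φ.open_target _ (Φ.map_source hpΦ)
  refine ⟨W, Φ, Φ.symm, Φ.source ∩ Φ ⁻¹' Metric.ball (Φ p) r, r, hr, ?_, ⟨hpΦ, by simpa using hr⟩,
    hs.mono inter_subset_left, hs'.mono hball, fun x hx => hx.2, fun z hz => ?_,
    fun x hx => Φ.left_inv hx.1, fun z hz => Φ.right_inv (hball hz), fun x hx hxM =>
      (hW x hx.1).1 hxM, fun z hz hzW => ?_⟩
  · exact Φ.isOpen_inter_preimage Metric.isOpen_ball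
  · refine ⟨Φ.map_target (hball hz), ?_⟩
    simpa [Φ.right_inv (hball hz)] using hz
  · rw [hW _ (Φ.map_target (hball hz)), Φ.right_inv (hball hz)]
    exact hzW

namespace FlatChart

variable {M : Set Target} {p : Target} {W : Submodule ℝ Target} {Φ Ψ : Target → Target}
  {U : Set Target} {r : ℝ}

lemma contDiffAt_symm (h : FlatChart M p W Φ Ψ U r) {z : Target} (hz : z ∈ Metric.ball (Φ p) r) :
    ContDiffAt ℝ ∞ Ψ z :=
  h.smooth_symm.contDiffAt (Metric.isOpen_ball.mem_nhds hz)

lemma hasFDerivAt_symm (h : FlatChart M p W Φ Ψ U r) {z : Target}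
    (hz : z ∈ Metric.ball (Φ p) r) : HasFDerivAt Ψ (fderiv ℝ Ψ z) z :=
  ((h.contDiffAt_symm hz).differentiableAt (by simp)).hasFDerivAt

lemma contDiffOn_fderiv_symm (h : FlatChart M p W Φ Ψ U r) :
    ContDiffOn ℝ ∞ (fderiv ℝ Ψ) (Metric.ball (Φ p) r) :=
  h.smooth_symm.fderiv_of_isOpen Metric.isOpen_ball (by simp)

lemma fderiv_symm_injective (h : FlatChart M p W Φ Ψ U r) {z : Target}
    (hz : z ∈ Metric.ball (Φ p) r) : Function.Injective (fderiv ℝ Ψ z) := by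
  have hΨz := h.mapsTo_symm hz
  have h1 : HasFDerivAt Φ (fderiv ℝ Φ (Ψ z)) (Ψ z) :=
    ((h.smooth.contDiffAt (h.isOpen.mem_nhds hΨz)).differentiableAt (by simp)).hasFDerivAt
  have h2 : HasFDerivAt (Φ ∘ Ψ) (ContinuousLinearMap.id ℝ Target) z :=
    (hasFDerivAt_id z).congr_of_eventuallyEq
      (Filter.eventuallyEq_of_mem (Metric.isOpen_ball.mem_nhds hz) h.right_inv)
  have h3 := (h1.comp z (h.hasFDerivAt_symm hz)).unique h2
  intro v w hvw
  have := congrArg (fderiv ℝ Φ (Ψ z)) hvw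
  have e : ∀ v, fderiv ℝ Φ (Ψ z) (fderiv ℝ Ψ z v) = v := fun v => by
    simpa using congrArg (fun T : Target →L[ℝ] Target => T v) h3
  rwa [e, e] at this

end FlatChart

/-- Near each point of `M`, the geodesic distance exceeds the Euclidean one by at most a quadratic
term: the image of a segment under a flattening chart is an almost straight arc. -/
lemma IsSmoothSubmanifold.geodesicDist_le_quadratic {M : Set Target} (hM : IsSmoothSubmanifold M)
    {p : Target} (hp : p ∈ M) :
    ∃ V ∈ 𝓝 p, ∃ C : ℝ, 0 ≤ C ∧ ∀ x ∈ V, ∀ y ∈ V, x ∈ M → y ∈ M →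
      geodesicDist M x y ≤ ENNReal.ofReal (‖x - y‖ + C * ‖x - y‖ ^ 2) := by
  obtain ⟨W, Φ, Ψ, U, r, h⟩ := hM.exists_flatChart hp
  have hp0 : Φ p ∈ Metric.ball (Φ p) r := Metric.mem_ball_self h.pos
  obtain ⟨K, t, ht, hK⟩ := ((h.contDiffOn_fderiv_symm.contDiffAt
    (Metric.isOpen_ball.mem_nhds hp0)).of_le (m := 1) (by norm_cast)).exists_lipschitzOnWith
  obtain ⟨L, s, hs, hL⟩ := ((h.smooth.contDiffAt (h.isOpen.mem_nhds h.mem)).of_le (m := 1)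
    (by norm_cast)).exists_lipschitzOnWith
  obtain ⟨ρ, hρ, hρt⟩ := Metric.mem_nhds_iff.1 (inter_mem ht (Metric.ball_mem_nhds (Φ p) h.pos))
  have hΦc : ContinuousAt Φ p := (h.smooth.contDiffAt (h.isOpen.mem_nhds h.mem)).continuousAt
  refine ⟨U ∩ s ∩ Φ ⁻¹' Metric.ball (Φ p) ρ, inter_mem (inter_mem (h.isOpen.mem_nhds h.mem) hs)
    (hΦc (Metric.ball_mem_nhds _ hρ)), K * L ^ 2, by positivity, ?_⟩
  rintro x ⟨⟨hxU, hxs⟩, hxρ⟩ y ⟨⟨hyU, hys⟩, hyρ⟩ hxM hyM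
  set v := Φ y - Φ x with hv
  have hseg : ∀ τ ∈ Icc (0:ℝ) 1, Φ x + τ • v ∈ Metric.ball (Φ p) ρ := fun τ hτ =>
    (convex_ball (Φ p) ρ).add_smul_sub_mem hxρ hyρ hτ
  have hsegW : ∀ τ : ℝ, Φ x + τ • v ∈ W := fun τ =>
    W.add_mem (h.mem_of_mem x hxU hxM) (W.smul_mem _ (W.sub_mem (h.mem_of_mem y hyU hyM)
      (h.mem_of_mem x hxU hxM)))
  have hline : ∀ τ : ℝ, HasDerivAt (fun τ : ℝ => Φ x + τ • v) v τ := fun τ => by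
    simpa using ((hasDerivAt_id τ).smul_const v).const_add (Φ x)
  have hlip : ∀ τ ∈ Icc (0:ℝ) 1, ∀ σ ∈ Icc (0:ℝ) 1,
      ‖fderiv ℝ Ψ (Φ x + τ • v) v - fderiv ℝ Ψ (Φ x + σ • v) v‖ ≤ K * ‖v‖ ^ 2 := by
    intro τ hτ σ hσ
    rw [← sub_apply]
    refine (ContinuousLinearMap.le_opNorm _ _).trans ?_
    have h1 := hK.norm_sub_le (hρt (hseg τ hτ)).1 (hρt (hseg σ hσ)).1
    have h2 : ‖Φ x + τ • v - (Φ x + σ • v)‖ ≤ ‖v‖ := by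
      rw [add_sub_add_left_eq_sub, ← sub_smul, norm_smul]
      refine mul_le_of_le_one_left (norm_nonneg _) ?_
      rw [Real.norm_eq_abs, abs_le]; constructor <;> linarith [hτ.1, hτ.2, hσ.1, hσ.2]
    calc _ ≤ (K * ‖v‖) * ‖v‖ := by gcongr; exact h1.trans (by gcongr)
      _ = _ := by ring
  have hcont : ContinuousOn (fun τ : ℝ => fderiv ℝ Ψ (Φ x + τ • v) v) (Icc 0 1) :=
    (h.contDiffOn_fderiv_symm.continuousOn.comp (by fun_prop)
      fun τ hτ => (hρt (hseg τ hτ)).2).clm_apply continuousOn_const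
  have hA : IsArc M (fun τ => Ψ (Φ x + τ • v)) (fun τ => fderiv ℝ Ψ (Φ x + τ • v) v) 0 1 :=
    ⟨zero_le_one, fun τ hτ => ((h.hasFDerivAt_symm (hρt (hseg τ hτ)).2).comp_hasDerivAt τ
      (hline τ)).hasDerivWithinAt, hcont, fun τ hτ =>
        h.symm_mem _ (hρt (hseg τ hτ)).2 (hsegW τ)⟩
  have hint : IntervalIntegrable (fun τ : ℝ => fderiv ℝ Ψ (Φ x + τ • v) v) volume 0 1 :=
    (hcont.mono (by simp)).intervalIntegrable
  have hxy : ∫ τ in (0:ℝ)..1, fderiv ℝ Ψ (Φ x + τ • v) v = y - x := by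
    rw [intervalIntegral.integral_eq_sub_of_hasDerivAt_of_le zero_le_one
      (fun r hr => (hA.hasDeriv r hr).continuousWithinAt)
      (fun r hr => (hA.hasDeriv r (Ioo_subset_Icc_self hr)).hasDerivAt (Icc_mem_nhds hr.1 hr.2))
      hint]
    simp [hv, h.left_inv x hxU, h.left_inv y hyU]
  -- the velocity is almost constant, and its mean is `y - x`
  have hbound : ∀ τ ∈ Icc (0:ℝ) 1, ‖fderiv ℝ Ψ (Φ x + τ • v) v‖ ≤ ‖x - y‖ + K * ‖v‖ ^ 2 := by
    intro τ hτ
    have : fderiv ℝ Ψ (Φ x + τ • v) v - (y - x) =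
        ∫ σ in (0:ℝ)..1, (fderiv ℝ Ψ (Φ x + τ • v) v - fderiv ℝ Ψ (Φ x + σ • v) v) := by
      rw [intervalIntegral.integral_sub (by simp) hint, hxy]; simp
    have h2 : ‖fderiv ℝ Ψ (Φ x + τ • v) v - (y - x)‖ ≤ K * ‖v‖ ^ 2 := by
      rw [this]
      refine (intervalIntegral.norm_integral_le_of_norm_le_const (C := K * ‖v‖ ^ 2)
        fun σ hσ => ?_).trans (by simp)
      rw [uIoc_of_le zero_le_one] at hσ
      exact hlip τ hτ σ ⟨hσ.1.le, hσ.2⟩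
    calc _ = ‖(y - x) + (fderiv ℝ Ψ (Φ x + τ • v) v - (y - x))‖ := by congr 1; abel
      _ ≤ _ := (norm_add_le _ _).trans (by rw [norm_sub_rev y x]; gcongr)
  have hvle : ‖v‖ ≤ L * ‖x - y‖ := by
    rw [norm_sub_rev x y]; exact hL.norm_sub_le hys hxs
  have hfin := hA.geodesicDist_le
  simp only [zero_smul, add_zero, one_smul, hv, add_sub_cancel, h.left_inv x hxU,
    h.left_inv y hyU] at hfin
  refine hfin.trans (ENNReal.ofReal_le_ofReal ?_)
  calc ∫ τ in (0:ℝ)..1, ‖fderiv ℝ Ψ (Φ x + τ • (Φ y - Φ x)) (Φ y - Φ x)‖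
      ≤ ∫ τ in (0:ℝ)..1, (‖x - y‖ + K * ‖v‖ ^ 2) :=
        intervalIntegral.integral_mono_on zero_le_one hint.norm (by simp) hbound
    _ = ‖x - y‖ + K * ‖v‖ ^ 2 := by simp
    _ ≤ ‖x - y‖ + K * (L * ‖x - y‖) ^ 2 := by gcongr
    _ = _ := by ring

lemma IsSmoothSubmanifold.tendsto_geodesicDist {M : Set Target} (hM : IsSmoothSubmanifold M)
    {p : Target} (hp : p ∈ M) :
    Tendsto (fun x => geodesicDist M p x) (𝓝[M] p) (𝓝 0) ∧
      Tendsto (fun x => geodesicDist M x p) (𝓝[M] p) (𝓝 0) := by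
  obtain ⟨V, hV, C, hC, h⟩ := hM.geodesicDist_le_quadratic hp
  have hpV := mem_of_mem_nhds hV
  have hlim : Tendsto (fun x => ENNReal.ofReal (‖x - p‖ + C * ‖x - p‖ ^ 2)) (𝓝[M] p) (𝓝 0) := by
    have : Continuous fun x : Target => ENNReal.ofReal (‖x - p‖ + C * ‖x - p‖ ^ 2) :=
      ENNReal.continuous_ofReal.comp (by fun_prop)
    simpa using (this.tendsto p).mono_left nhdsWithin_le_nhds
  constructor
  · refine tendsto_of_tendsto_of_tendsto_of_le_of_le' tendsto_const_nhds hlim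
      (Eventually.of_forall fun _ => zero_le) ?_
    filter_upwards [self_mem_nhdsWithin, mem_nhdsWithin_of_mem_nhds hV] with x hxM hxV
    rw [norm_sub_rev]
    exact h p hpV x hxV hp hxM
  · refine tendsto_of_tendsto_of_tendsto_of_le_of_le' tendsto_const_nhds hlim
      (Eventually.of_forall fun _ => zero_le) ?_
    filter_upwards [self_mem_nhdsWithin, mem_nhdsWithin_of_mem_nhds hV] with x hxM hxV
    exact h x hxV p hpV hxM hp

lemma IsSmoothSubmanifold.geodesicDist_lt_top {M : Set Target} (hM : IsSmoothSubmanifold M)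
    (hc : IsConnected M) {a b : Target} (ha : a ∈ M) (hb : b ∈ M) : geodesicDist M a b < ⊤ := by
  refine hc.isPreconnected.induction₂' (fun x y => geodesicDist M x y < ⊤) (fun p hp => ?_)
    (fun x y z _ _ _ h1 h2 => geodesicDist_triangle.trans_lt (ENNReal.add_lt_top.2 ⟨h1, h2⟩)) ha hb
  exact ((hM.tendsto_geodesicDist hp).1.eventually_lt_const ENNReal.zero_lt_top).and
    ((hM.tendsto_geodesicDist hp).2.eventually_lt_const ENNReal.zero_lt_top)

/-! ### Metric geodesics -/

/-- Points of an almost minimizing arc, taken at prescribed fractions of its length. -/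
lemma exists_almost_geodesic {M : Set Target} {a b : Target} {K : ℝ}
    (h : geodesicDist M a b < ENNReal.ofReal K) :
    ∃ p : ℝ → Target, p 0 = a ∧ p 1 = b ∧ (∀ s ∈ Icc (0:ℝ) 1, p s ∈ M) ∧
      ∀ s ∈ Icc (0:ℝ) 1, ∀ t ∈ Icc (0:ℝ) 1, s ≤ t →
        geodesicDist M (p s) (p t) ≤ ENNReal.ofReal (K * (t - s)) := by
  obtain ⟨c, c', hc, rfl, rfl, hlt⟩ := exists_arc_of_geodesicDist_lt h
  set ℓ := ∫ r in (0:ℝ)..1, ‖c' r‖ with hℓ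
  have hℓ0 : 0 ≤ ℓ := hc.length_nonneg
  have hℓK : ℓ ≤ K := by
    by_contra! hcon
    exact absurd hlt (not_lt.2 (ENNReal.ofReal_le_ofReal hcon.le))
  have hint : ∀ u ∈ Icc (0:ℝ) 1, ∀ w ∈ Icc (0:ℝ) 1,
      IntervalIntegrable (fun r => ‖c' r‖) volume u w := fun u hu w hw =>
    (hc.cont.norm.mono (uIcc_subset_Icc hu hw)).intervalIntegrable
  have h0 : (0:ℝ) ∈ Icc (0:ℝ) 1 := by simp
  have hcontA : ContinuousOn (fun t => ∫ r in (0:ℝ)..t, ‖c' r‖) (Icc 0 1) := by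
    have := intervalIntegral.continuousOn_primitive_interval (μ := volume) (a := (0:ℝ)) (b := 1)
      (f := fun r => ‖c' r‖) (by rw [uIcc_of_le zero_le_one]; exact hc.cont.norm.integrableOn_Icc)
    rwa [uIcc_of_le zero_le_one] at this
  have hex : ∀ s : ℝ, ∃ τ, s ∈ Icc (0:ℝ) 1 → τ ∈ Icc (0:ℝ) 1 ∧ ∫ r in (0:ℝ)..τ, ‖c' r‖ = s * ℓ := by
    intro s
    by_cases hs : s ∈ Icc (0:ℝ) 1
    · have hmem : s * ℓ ∈ Icc (∫ r in (0:ℝ)..0, ‖c' r‖) (∫ r in (0:ℝ)..1, ‖c' r‖) := by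
        rw [← hℓ, intervalIntegral.integral_same]
        exact ⟨mul_nonneg hs.1 hℓ0, mul_le_of_le_one_left hℓ0 hs.2⟩
      obtain ⟨τ, hτ, hτe⟩ := intermediate_value_Icc zero_le_one hcontA hmem
      exact ⟨τ, fun _ => ⟨hτ, hτe⟩⟩
    · exact ⟨0, fun h => absurd h hs⟩
  choose τ hτ using hex
  have hdiff : ∀ u ∈ Icc (0:ℝ) 1, ∀ w ∈ Icc (0:ℝ) 1, ∫ r in u..w, ‖c' r‖ =
      (∫ r in (0:ℝ)..w, ‖c' r‖) - ∫ r in (0:ℝ)..u, ‖c' r‖ := fun u hu w hw =>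
    (intervalIntegral.integral_interval_sub_left (hint _ h0 _ hw) (hint _ h0 _ hu)).symm
  have hmono : ∀ s ∈ Icc (0:ℝ) 1, ∀ t ∈ Icc (0:ℝ) 1, s < t → τ s ≤ τ t ∨ ℓ = 0 := by
    intro s hs t ht hst
    by_contra! hcon
    obtain ⟨hlt, hne⟩ := hcon
    have h1 := (hc.sub_arc hlt.le (hτ t ht).1.1 (hτ s hs).1.2).length_nonneg
    rw [hdiff _ (hτ t ht).1 _ (hτ s hs).1, (hτ t ht).2, (hτ s hs).2] at h1
    have : 0 < ℓ := lt_of_le_of_ne hℓ0 (Ne.symm hne)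
    nlinarith
  -- an arc of length zero is constant; otherwise `τ` is monotone
  rcases eq_or_ne ℓ 0 with hz | hz
  · have hab : c 0 = c 1 := by
      have := hc.norm_sub_le_length
      rw [← hℓ, hz, norm_le_zero_iff, sub_eq_zero] at this
      exact this.symm
    refine ⟨fun _ => c 0, rfl, hab, fun _ _ => hc.mapsTo h0, fun s _ t _ _ => ?_⟩
    rw [geodesicDist_self (hc.mapsTo h0)]; exact zero_le
  · have hends : τ 0 ∈ Icc (0:ℝ) 1 ∧ τ 1 ∈ Icc (0:ℝ) 1 := ⟨(hτ 0 h0).1, (hτ 1 (by simp)).1⟩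
    refine ⟨fun s => c (τ s), ?_, ?_, fun s hs => hc.mapsTo (hτ s hs).1, fun s hs t ht hst => ?_⟩
    · have := (hc.sub_arc hends.1.1 le_rfl hends.1.2).norm_sub_le_length
      rw [(hτ 0 h0).2, zero_mul, norm_le_zero_iff, sub_eq_zero] at this
      exact this
    · have := (hc.sub_arc hends.2.2 hends.2.1 le_rfl).norm_sub_le_length
      rw [hdiff _ hends.2 _ (by simp), (hτ 1 (by simp)).2, ← hℓ, one_mul, sub_self,
        norm_le_zero_iff, sub_eq_zero] at this
      exact this.symm
    · rcases hst.eq_or_lt with rfl | hlt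
      · simp [geodesicDist_self (hc.mapsTo (hτ s hs).1)]
      · have hle := (hmono s hs t ht hlt).resolve_right hz
        refine (hc.sub_arc hle (hτ s hs).1.1 (hτ t ht).1.2).geodesicDist_le.trans
          (ENNReal.ofReal_le_ofReal ?_)
        rw [hdiff _ (hτ s hs).1 _ (hτ t ht).1, (hτ t ht).2, (hτ s hs).2]
        nlinarith

/-- A curve in `M` along which the geodesic distance is proportional to the parameter. It is a
pointwise limit, along an ultrafilter, of almost minimizing curves. -/
lemma IsSmoothSubmanifold.exists_metric_geodesic {M : Set Target} (hM : IsSmoothSubmanifold M)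
    (hMc : IsCompact M) {a b : Target} (hfin : geodesicDist M a b < ⊤) :
    ∃ σ : ℝ → Target, σ 0 = a ∧ σ 1 = b ∧ (∀ s ∈ Icc (0:ℝ) 1, σ s ∈ M) ∧
      ∀ s ∈ Icc (0:ℝ) 1, ∀ t ∈ Icc (0:ℝ) 1, s ≤ t →
        geodesicDist M (σ s) (σ t) = ENNReal.ofReal ((geodesicDist M a b).toReal * (t - s)) := by
  set D := (geodesicDist M a b).toReal with hD
  have hD0 : 0 ≤ D := ENNReal.toReal_nonneg
  have hDe : geodesicDist M a b = ENNReal.ofReal D := (ENNReal.ofReal_toReal hfin.ne).symm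
  have hlt : ∀ n : ℕ, geodesicDist M a b < ENNReal.ofReal (D + 1 / (n + 1)) := fun n => by
    have : (0:ℝ) < 1 / (n + 1) := by positivity
    rw [hDe, ENNReal.ofReal_lt_ofReal_iff (by positivity)]
    linarith
  choose p hp0 hp1 hpM hp using fun n => exists_almost_geodesic (hlt n)
  have hex : ∀ s : ℝ, ∃ x, s ∈ Icc (0:ℝ) 1 → x ∈ M ∧
      Tendsto (fun n => p n s) (hyperfilter ℕ : Filter ℕ) (𝓝 x) := by
    intro s
    by_cases hs : s ∈ Icc (0:ℝ) 1
    · obtain ⟨x, hx, hlim⟩ := hMc.ultrafilter_le_nhds' ((hyperfilter ℕ).map fun n => p n s)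
        (Ultrafilter.mem_map.2 (univ_mem' fun n => hpM n s hs))
      exact ⟨x, fun _ => ⟨hx, hlim⟩⟩
    · exact ⟨a, fun h => absurd h hs⟩
  choose σ hσ using hex
  have h0 : (0:ℝ) ∈ Icc (0:ℝ) 1 := by simp
  have h1 : (1:ℝ) ∈ Icc (0:ℝ) 1 := by simp
  have hσ0 : σ 0 = a := tendsto_nhds_unique (hσ 0 h0).2 (by simp [hp0])
  have hσ1 : σ 1 = b := tendsto_nhds_unique (hσ 1 h1).2 (by simp [hp1])
  have hupper : ∀ s ∈ Icc (0:ℝ) 1, ∀ t ∈ Icc (0:ℝ) 1, s ≤ t →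
      geodesicDist M (σ s) (σ t) ≤ ENNReal.ofReal (D * (t - s)) := by
    intro s hs t ht hst
    have hw : ∀ u ∈ Icc (0:ℝ) 1, Tendsto (fun n => p n u) (hyperfilter ℕ : Filter ℕ)
        (𝓝[M] σ u) := fun u hu => tendsto_nhdsWithin_iff.2
      ⟨(hσ u hu).2, Eventually.of_forall fun n => hpM n u hu⟩
    have l1 := (hM.tendsto_geodesicDist (hσ s hs).1).1.comp (hw s hs)
    have l2 := (hM.tendsto_geodesicDist (hσ t ht).1).2.comp (hw t ht)
    have l3 : Tendsto (fun n : ℕ => ENNReal.ofReal ((D + 1 / ((n:ℝ) + 1)) * (t - s)))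
        (hyperfilter ℕ : Filter ℕ) (𝓝 (ENNReal.ofReal (D * (t - s)))) := by
      refine ENNReal.tendsto_ofReal ?_
      have : Tendsto (fun n : ℕ => (D + 1 / ((n:ℝ) + 1)) * (t - s)) atTop
          (𝓝 ((D + 0) * (t - s))) :=
        (tendsto_const_nhds.add tendsto_one_div_add_atTop_nhds_zero_nat).mul_const _
      rw [add_zero] at this
      exact this.mono_left Nat.hyperfilter_le_atTop
    have l := (l1.add l3).add l2
    rw [zero_add, add_zero] at l
    refine ge_of_tendsto' l fun n => ?_
    calc geodesicDist M (σ s) (σ t)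
        ≤ geodesicDist M (σ s) (p n t) + geodesicDist M (p n t) (σ t) := geodesicDist_triangle
      _ ≤ (geodesicDist M (σ s) (p n s) + geodesicDist M (p n s) (p n t)) +
          geodesicDist M (p n t) (σ t) := by gcongr; exact geodesicDist_triangle
      _ ≤ _ := by gcongr; exacts [le_rfl, hp n s hs t ht hst, le_rfl]
  refine ⟨σ, hσ0, hσ1, fun s hs => (hσ s hs).1, fun s hs t ht hst =>
    le_antisymm (hupper s hs t ht hst) ?_⟩
  -- the three pieces of the curve have total length at least `D`
  have h3 : ENNReal.ofReal D ≤ ENNReal.ofReal (D * s) + geodesicDist M (σ s) (σ t) +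
      ENNReal.ofReal (D * (1 - t)) := by
    calc ENNReal.ofReal D = geodesicDist M (σ 0) (σ 1) := by rw [hσ0, hσ1, hDe]
      _ ≤ geodesicDist M (σ 0) (σ t) + geodesicDist M (σ t) (σ 1) := geodesicDist_triangle
      _ ≤ (geodesicDist M (σ 0) (σ s) + geodesicDist M (σ s) (σ t)) +
          geodesicDist M (σ t) (σ 1) := by gcongr; exact geodesicDist_triangle
      _ ≤ _ := by
        have e1 := hupper 0 h0 s hs hs.1
        have e2 := hupper t ht 1 h1 ht.2
        rw [sub_zero] at e1
        gcongr
  have hne : geodesicDist M (σ s) (σ t) ≠ ⊤ :=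
    ne_top_of_le_ne_top ENNReal.ofReal_ne_top (hupper s hs t ht hst)
  rw [← ENNReal.ofReal_toReal hne, ← ENNReal.ofReal_add (mul_nonneg hD0 hs.1)
    ENNReal.toReal_nonneg, ← ENNReal.ofReal_add (add_nonneg (mul_nonneg hD0 hs.1)
    ENNReal.toReal_nonneg) (mul_nonneg hD0 (by linarith [ht.2])), ENNReal.ofReal_le_ofReal_iff
    (add_nonneg (add_nonneg (mul_nonneg hD0 hs.1)
    ENNReal.toReal_nonneg) (mul_nonneg hD0 (by linarith [ht.2])))] at h3
  rw [← ENNReal.ofReal_toReal hne]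
  exact ENNReal.ofReal_le_ofReal (by nlinarith)

/-! ### Curves with small second differences -/

/-- A Lipschitz curve whose second differences are `O(h^{3/2})` is `C¹`: its dyadic difference
quotients converge uniformly. Only forward quotients are used, hence the restriction to the first
half of the interval. -/
lemma exists_hasDerivWithinAt_of_second_difference {E : Type*} [NormedAddCommGroup E]
    [NormedSpace ℝ E] [CompleteSpace E] {σ : ℝ → E} {s₀ s₁ D B : ℝ} (h01 : s₀ < s₁) (hD : 0 ≤ D)
    (hB : 0 ≤ B)
    (hLip : ∀ s ∈ Icc s₀ s₁, ∀ t ∈ Icc s₀ s₁, ‖σ s - σ t‖ ≤ D * |s - t|)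
    (h2 : ∀ t h, 0 < h → s₀ ≤ t - h → t + h ≤ s₁ →
      ‖σ (t - h) + σ (t + h) - (2:ℝ) • σ t‖ ^ 2 ≤ B * h ^ 3) :
    ∃ v : ℝ → E, Continuous v ∧ ∀ t ∈ Icc s₀ ((s₀ + s₁) / 2),
      HasDerivWithinAt σ (v t) (Icc s₀ ((s₀ + s₁) / 2)) t := by
  set m := (s₀ + s₁) / 2 with hm
  have h0m : s₀ ≤ m := by linarith
  set g : ℝ → E := fun t => σ (projIcc s₀ s₁ h01.le t) with hg
  have hgσ : ∀ t ∈ Icc s₀ s₁, g t = σ t := fun t ht => by simp [hg, projIcc_of_mem _ ht]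
  have hgLip : ∀ s t, ‖g s - g t‖ ≤ D * |s - t| := fun s t => by
    refine (hLip _ (projIcc s₀ s₁ h01.le s).2 _ (projIcc s₀ s₁ h01.le t).2).trans ?_
    exact mul_le_mul_of_nonneg_left (abs_projIcc_sub_projIcc h01.le) hD
  have hgc : Continuous g := by
    refine (LipschitzWith.of_dist_le_mul (K := ⟨D, hD⟩) fun s t => ?_).continuous
    rw [dist_eq_norm, Real.dist_eq]
    exact hgLip s t
  set ℓ := m - s₀ with hℓ
  have hℓ0 : 0 < ℓ := by rw [hℓ, hm]; linarith
  set η : ℕ → ℝ := fun n => ℓ * (1 / 2) ^ n with hη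
  have hη0 : ∀ n, 0 < η n := fun n => by positivity
  have hηℓ : ∀ n, η n ≤ ℓ := fun n =>
    mul_le_of_le_one_right hℓ0.le (pow_le_one₀ (by norm_num) (by norm_num))
  set Q : ℕ → ℝ → E := fun n t => (η n)⁻¹ • (g (t + η n) - g t) with hQ
  have hQc : ∀ n, Continuous (Q n) := fun n => by fun_prop
  have hQD : ∀ n t, ‖Q n t‖ ≤ D := fun n t => by
    rw [hQ, norm_smul, norm_inv, Real.norm_eq_abs, abs_of_pos (hη0 n), inv_mul_le_iff₀ (hη0 n)]
    refine (hgLip _ _).trans (le_of_eq ?_)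
    rw [add_sub_cancel_left, abs_of_pos (hη0 n), mul_comm]
  set r := √(1 / 2 : ℝ) with hr
  have hr1 : r < 1 := by rw [hr, Real.sqrt_lt' one_pos]; norm_num
  have hr2 : r ^ 2 = 1 / 2 := Real.sq_sqrt (by norm_num)
  set C := √(B * ℓ / 8) with hC
  have hC2 : C ^ 2 = B * ℓ / 8 := Real.sq_sqrt (by positivity)
  -- consecutive dyadic quotients differ by a second difference, hence by `O(η n ^ (1 / 2))`
  have hstep : ∀ t ∈ Icc s₀ m, ∀ n, dist (Q n t) (Q (n + 1) t) ≤ C * r ^ n := by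
    intro t ht n
    have hhalf : η (n + 1) = η n / 2 := by simp only [hη, pow_succ]; ring
    have hpos := hη0 n
    have hle := hηℓ n
    have e1 : g t = σ (t + η n / 2 - η n / 2) := by
      rw [hgσ t ⟨ht.1, by linarith [ht.2]⟩]; congr 1; ring
    have e2 : g (t + η n) = σ (t + η n / 2 + η n / 2) := by
      rw [hgσ _ ⟨by linarith [ht.1], by linarith [ht.2]⟩]; congr 1; ring
    have e3 : g (t + η (n + 1)) = σ (t + η n / 2) := by
      rw [hhalf, hgσ _ ⟨by linarith [ht.1], by linarith [ht.2]⟩]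
    have e4 : Q n t - Q (n + 1) t = (η n)⁻¹ • (σ (t + η n / 2 - η n / 2) +
        σ (t + η n / 2 + η n / 2) - (2:ℝ) • σ (t + η n / 2)) := by
      simp only [hQ]
      rw [e3, e2, e1, hhalf, inv_div, div_eq_inv_mul (2:ℝ), mul_smul, ← smul_sub]
      congr 1
      rw [smul_sub, two_smul ℝ (σ (t + η n / 2 - η n / 2))]
      abel
    have h3 := h2 (t + η n / 2) (η n / 2) (by positivity) (by linarith [ht.1])
      (by linarith [ht.2])
    rw [dist_eq_norm, e4, norm_smul, norm_inv, Real.norm_eq_abs, abs_of_pos hpos]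
    refine le_of_sq_le_sq ?_ (by positivity)
    calc _ = (η n)⁻¹ ^ 2 * _ := mul_pow _ _ 2
      _ ≤ (η n)⁻¹ ^ 2 * (B * (η n / 2) ^ 3) := by gcongr
      _ = B / 8 * η n := by field_simp; norm_num
      _ = (C * r ^ n) ^ 2 := by
        rw [mul_pow, hC2, ← pow_mul, mul_comm n 2, pow_mul, hr2, hη]; ring
  have hlim : ∀ t, ∃ w, t ∈ Icc s₀ m → Tendsto (fun n => Q n t) atTop (𝓝 w) := by
    intro t
    by_cases ht : t ∈ Icc s₀ m
    · obtain ⟨w, hw⟩ :=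
        cauchySeq_tendsto_of_complete (cauchySeq_of_le_geometric r C hr1 (hstep t ht))
      exact ⟨w, fun _ => hw⟩
    · exact ⟨0, fun h => absurd h ht⟩
  choose w hw using hlim
  have hunif : TendstoUniformlyOn Q w atTop (Icc s₀ m) := by
    rw [Metric.tendstoUniformlyOn_iff]
    intro ε hε
    have hz : Tendsto (fun n => C * r ^ n / (1 - r)) atTop (𝓝 0) := by
      have := ((tendsto_pow_atTop_nhds_zero_of_lt_one (Real.sqrt_nonneg _) hr1).const_mul
        C).div_const (1 - r)
      rwa [mul_zero, zero_div] at this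
    filter_upwards [hz.eventually_lt_const hε] with n hn t ht
    rw [dist_comm]
    exact (dist_le_of_le_geometric_of_tendsto r C hr1 (hstep t ht) (hw t ht) n).trans_lt hn
  have hwc : ContinuousOn w (Icc s₀ m) :=
    hunif.continuousOn (Frequently.of_forall fun n => (hQc n).continuousOn)
  set v : ℝ → E := fun t => w (projIcc s₀ m h0m t) with hv
  have hvc : Continuous v := hwc.comp_continuous
    (continuous_subtype_val.comp continuous_projIcc) fun t => (projIcc s₀ m h0m t).2
  have hvw : ∀ t ∈ Icc s₀ m, v t = w t := fun t ht => by simp [hv, projIcc_of_mem _ ht]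
  refine ⟨v, hvc, ?_⟩
  have hη_lim : Tendsto η atTop (𝓝[≠] 0) := by
    refine tendsto_nhdsWithin_iff.2 ⟨?_, Eventually.of_forall fun n => (hη0 n).ne'⟩
    have := (tendsto_pow_atTop_nhds_zero_of_lt_one (by norm_num : (0:ℝ) ≤ 1 / 2)
      (by norm_num)).const_mul ℓ
    rwa [mul_zero] at this
  have hmean : ∀ t, Tendsto (fun n => (η n)⁻¹ • ∫ x in t..t + η n, g x) atTop (𝓝 (g t)) := by
    intro t
    have hd : HasDerivAt (fun u => ∫ x in t..u, g x) (g t) t :=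
      intervalIntegral.integral_hasDerivAt_right (hgc.intervalIntegrable _ _)
        hgc.aestronglyMeasurable.stronglyMeasurableAtFilter hgc.continuousAt
    simpa [Function.comp_def] using hd.tendsto_slope_zero.comp hη_lim
  -- `σ` is a primitive of `v`: integrate the difference quotients and pass to the limit
  have hprim : ∀ t ∈ Icc s₀ m, σ t = σ s₀ + ∫ x in s₀..t, v x := by
    intro t ht
    have hint : ∀ a b, IntervalIntegrable g volume a b := fun a b => hgc.intervalIntegrable a b
    have l1 : Tendsto (fun n => ∫ x in s₀..t, Q n x) atTop (𝓝 (g t - g s₀)) := by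
      refine ((hmean t).sub (hmean s₀)).congr fun n => ?_
      simp only [hQ]
      have hshift : Continuous fun x => g (x + η n) := by fun_prop
      rw [intervalIntegral.integral_smul, intervalIntegral.integral_sub
        (hshift.intervalIntegrable _ _) (hint _ _),
        intervalIntegral.integral_comp_add_right (f := g), ← smul_sub]
      congr 1
      rw [← intervalIntegral.integral_add_adjacent_intervals (hint (s₀ + η n) t) (hint t _),
        ← intervalIntegral.integral_add_adjacent_intervals (hint s₀ (s₀ + η n)) (hint _ t)]
      abel
    have l2 : Tendsto (fun n => ∫ x in s₀..t, Q n x) atTop (𝓝 (∫ x in s₀..t, v x)) := by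
      refine intervalIntegral.tendsto_integral_filter_of_dominated_convergence (fun _ => D)
        (Eventually.of_forall fun n => (hQc n).aestronglyMeasurable)
        (Eventually.of_forall fun n => Eventually.of_forall fun x _ => hQD n x) (by simp)
        (Eventually.of_forall fun x hx => ?_)
      rw [uIoc_of_le ht.1] at hx
      have hx' : x ∈ Icc s₀ m := ⟨hx.1.le, hx.2.trans ht.2⟩
      rw [hvw x hx']; exact hw x hx'
    have := tendsto_nhds_unique l1 l2
    rw [← this, hgσ t ⟨ht.1, by linarith [ht.2]⟩, hgσ s₀ ⟨le_rfl, h01.le⟩]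
    abel
  intro t ht
  have hd : HasDerivAt (fun u => σ s₀ + ∫ x in s₀..u, v x) (v t) t :=
    (intervalIntegral.integral_hasDerivAt_right (hvc.intervalIntegrable _ _)
      hvc.aestronglyMeasurable.stronglyMeasurableAtFilter hvc.continuousAt).const_add _
  exact hd.hasDerivWithinAt.congr_of_mem hprim ht

/-- The parallelogram law turns an almost sharp triangle inequality at a midpoint into a bound on
the second difference. -/
lemma norm_second_difference_sq_le {E : Type*} [NormedAddCommGroup E] [InnerProductSpace ℝ E]
    {x y z : E} {D C h : ℝ} (hD : 0 ≤ D) (hC : 0 ≤ C) (hh : 0 < h) (h1 : ‖x - y‖ ≤ D * h)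
    (h2 : ‖z - y‖ ≤ D * h) (h3 : D * (2 * h) ≤ ‖x - z‖ + C * ‖x - z‖ ^ 2) :
    ‖x + z - (2:ℝ) • y‖ ^ 2 ≤ 16 * C * D ^ 3 * h ^ 3 := by
  have hp := parallelogram_law_with_norm ℝ (x - y) (z - y)
  have e1 : x - y + (z - y) = x + z - (2:ℝ) • y := by rw [two_smul]; abel
  have e2 : x - y - (z - y) = x - z := by abel
  rw [e1, e2] at hp
  have hxz : ‖x - z‖ ≤ 2 * (D * h) := by
    rw [← e2]; exact (norm_sub_le _ _).trans (by linarith)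
  have hxz0 := norm_nonneg (x - z)
  have a1 : ‖x - y‖ ^ 2 ≤ (D * h) ^ 2 := by gcongr
  have a2 : ‖z - y‖ ^ 2 ≤ (D * h) ^ 2 := by gcongr
  have a3 : ‖x - z‖ ^ 2 ≤ (2 * (D * h)) ^ 2 := by gcongr
  have hDh : 0 ≤ D * h := by positivity
  have a4 : 2 * (D * h) - C * (2 * (D * h)) ^ 2 ≤ ‖x - z‖ := by
    nlinarith [mul_le_mul_of_nonneg_left a3 hC]
  have hCX : 0 ≤ C * (D * h) ^ 2 := by positivity
  have a5 : 4 * (D * h) ^ 2 - 16 * C * (D * h) ^ 3 ≤ ‖x - z‖ ^ 2 := by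
    rcases le_total 0 (2 * (D * h) - C * (2 * (D * h)) ^ 2) with h0 | h0
    · have : (2 * (D * h) - C * (2 * (D * h)) ^ 2) ^ 2 ≤ ‖x - z‖ ^ 2 := by gcongr
      nlinarith [sq_nonneg (C * (2 * (D * h)) ^ 2)]
    · nlinarith [mul_nonneg hDh (neg_nonneg.2 h0), mul_nonneg hDh hCX, sq_nonneg ‖x - z‖]
  nlinarith

/-! ### The du Bois-Reymond lemma and the metric tensor in a chart -/

/-- The du Bois-Reymond lemma: a weak derivative that is continuous is a classical one. -/
lemma hasDerivWithinAt_of_forall_integral_eq_zero {E : Type*} [NormedAddCommGroup E]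
    [InnerProductSpace ℝ E] [CompleteSpace E] {Y Z : ℝ → E} {u w : ℝ} (huw : u < w)
    (hY : ContinuousOn Y (Icc u w)) (hZ : ContinuousOn Z (Icc u w))
    (h : ∀ η η' : ℝ → E, (∀ t, HasDerivAt η (η' t) t) → Continuous η' → η u = 0 → η w = 0 →
      ∫ t in u..w, (⟪Y t, η' t⟫ + ⟪Z t, η t⟫) = 0) :
    ∀ t ∈ Icc u w, HasDerivWithinAt Y (Z t) (Icc u w) t := by
  have hproj : ∀ {f : ℝ → E}, ContinuousOn f (Icc u w) →
      Continuous fun t => f (projIcc u w huw.le t) := fun hf =>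
    hf.comp_continuous (continuous_subtype_val.comp continuous_projIcc)
      fun t => (projIcc u w huw.le t).2
  set y : ℝ → E := fun t => Y (projIcc u w huw.le t) with hy
  set z : ℝ → E := fun t => Z (projIcc u w huw.le t) with hz
  have hyc : Continuous y := hproj hY
  have hzc : Continuous z := hproj hZ
  have hyY : ∀ t ∈ Icc u w, y t = Y t := fun t ht => by simp [hy, projIcc_of_mem _ ht]
  have hzZ : ∀ t ∈ Icc u w, z t = Z t := fun t ht => by simp [hz, projIcc_of_mem _ ht]
  have hprim : ∀ {f : ℝ → E}, Continuous f → ∀ t, HasDerivAt (fun s => ∫ x in u..s, f x) (f t) t :=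
    fun hf t => intervalIntegral.integral_hasDerivAt_right (hf.intervalIntegrable _ _)
        hf.aestronglyMeasurable.stronglyMeasurableAtFilter hf.continuousAt
  set ζ : ℝ → E := fun t => ∫ x in u..t, z x with hζ
  have hζd : ∀ t, HasDerivAt ζ (z t) t := hprim hzc
  have hζc : Continuous ζ := continuous_iff_continuousAt.2 fun t => (hζd t).continuousAt
  set q : ℝ → E := fun t => y t - ζ t with hq
  have hqc : Continuous q := hyc.sub hζc
  set m : E := (w - u)⁻¹ • ∫ t in u..w, q t with hm
  have hne : w - u ≠ 0 := by linarith
  set η : ℝ → E := fun t => ∫ x in u..t, (q x - m) with hη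
  have hηd : ∀ t, HasDerivAt η (q t - m) t := hprim (hqc.sub continuous_const)
  have hηc : Continuous η := continuous_iff_continuousAt.2 fun t => (hηd t).continuousAt
  have hηw : η w = 0 := by
    simp only [hη]
    rw [intervalIntegral.integral_sub (hqc.intervalIntegrable _ _) (by simp)]
    simp [hm, smul_smul, inv_mul_cancel₀ hne]
  have hηu : η u = 0 := by simp [hη]
  have h1 := h η (fun t => q t - m) hηd (hqc.sub continuous_const) hηu hηw
  have h2 : ∫ t in u..w, (⟪ζ t, q t - m⟫ + ⟪z t, η t⟫) = 0 := by
    rw [intervalIntegral.integral_eq_sub_of_hasDerivAt (f := fun t => ⟪ζ t, η t⟫)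
      (fun t _ => (hζd t).inner ℝ (hηd t))
      (Continuous.intervalIntegrable (by fun_prop) _ _), hηw, hηu]
    simp
  have h3 : ∫ t in u..w, ⟪q t, q t - m⟫ = 0 := by
    have : ∫ t in u..w, ⟪q t, q t - m⟫ = (∫ t in u..w, (⟪Y t, q t - m⟫ + ⟪Z t, η t⟫)) -
        ∫ t in u..w, (⟪ζ t, q t - m⟫ + ⟪z t, η t⟫) := by
      have e : ∫ t in u..w, (⟪Y t, q t - m⟫ + ⟪Z t, η t⟫) =
          ∫ t in u..w, (⟪y t, q t - m⟫ + ⟪z t, η t⟫) := by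
        refine intervalIntegral.integral_congr fun t ht => ?_
        rw [uIcc_of_le huw.le] at ht
        simp only [hyY t ht, hzZ t ht]
      rw [e, ← intervalIntegral.integral_sub (Continuous.intervalIntegrable (by fun_prop) _ _)
        (Continuous.intervalIntegrable (by fun_prop) _ _)]
      refine intervalIntegral.integral_congr fun t _ => ?_
      simp only [hq, inner_sub_left]
      ring
    rw [this, h1, h2, sub_zero]
  have h4 : ∫ t in u..w, ⟪m, q t - m⟫ = 0 := by
    rw [intervalIntegral.integral_eq_sub_of_hasDerivAt (f := fun t => ⟪m, η t⟫)
      (fun t _ => by simpa using (hasDerivAt_const t m).inner ℝ (hηd t))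
      (Continuous.intervalIntegrable (by fun_prop) _ _), hηw, hηu]
    simp
  have h5 : ∫ t in u..w, ‖q t - m‖ ^ 2 = 0 := by
    have : ∫ t in u..w, ‖q t - m‖ ^ 2 =
        (∫ t in u..w, ⟪q t, q t - m⟫) - ∫ t in u..w, ⟪m, q t - m⟫ := by
      rw [← intervalIntegral.integral_sub (Continuous.intervalIntegrable (by fun_prop) _ _)
        (Continuous.intervalIntegrable (by fun_prop) _ _)]
      refine intervalIntegral.integral_congr fun t _ => ?_
      rw [← inner_sub_left, real_inner_self_eq_norm_sq]
    rw [this, h3, h4, sub_zero]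
  have h6 : ∀ t ∈ Icc u w, q t = m := by
    intro t ht
    by_contra hcon
    have : 0 < ∫ t in u..w, ‖q t - m‖ ^ 2 := by
      refine intervalIntegral.integral_pos huw (Continuous.continuousOn (by fun_prop))
        (fun _ _ => by positivity) ⟨t, ht, ?_⟩
      have := norm_pos_iff.2 (sub_ne_zero.2 hcon)
      positivity
    exact this.ne' h5
  intro t ht
  have hd : HasDerivWithinAt (fun t => m + ζ t) (Z t) (Icc u w) t := by
    rw [← hzZ t ht]; exact ((hζd t).const_add m).hasDerivWithinAt
  refine hd.congr_of_mem (fun s hs => ?_) ht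
  rw [← h6 s hs, ← hyY s hs]
  simp [hq]

/-- Taking adjoints, as a continuous `ℝ`-linear map. -/
noncomputable def adjointL : (Target →L[ℝ] Target) →L[ℝ] (Target →L[ℝ] Target) :=
  LinearMap.mkContinuous
    { toFun := fun T => ContinuousLinearMap.adjoint T
      map_add' := fun S T => map_add _ S T
      map_smul' := fun c T => by simp } 1 fun T => by simp

lemma adjointL_inner (T : Target →L[ℝ] Target) (x y : Target) :
    ⟪adjointL T x, y⟫ = ⟪x, T y⟫ :=
  ContinuousLinearMap.adjoint_inner_left T y x

namespace FlatChart

variable {M : Set Target} {p : Target} {W : Submodule ℝ Target} {Φ Ψ : Target → Target}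
  {U : Set Target} {r : ℝ}

/-- The metric tensor of `M` in a flattening chart, extended by the identity on `Wᗮ`. -/
noncomputable def metricOp (W : Submodule ℝ Target) (Ψ : Target → Target) (z : Target) :
    Target →L[ℝ] Target :=
  W.starProjection ∘L adjointL (fderiv ℝ Ψ z) ∘L fderiv ℝ Ψ z ∘L W.starProjection +
    (ContinuousLinearMap.id ℝ Target - W.starProjection)

lemma isUnit_metricOp (h : FlatChart M p W Φ Ψ U r) {z : Target}
    (hz : z ∈ Metric.ball (Φ p) r) : IsUnit (metricOp W Ψ z) := by
  have hinj : Function.Injective (metricOp W Ψ z) := by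
    rw [injective_iff_map_eq_zero]
    intro x hx
    have h1 : ⟪metricOp W Ψ z x, x⟫ = ‖fderiv ℝ Ψ z (W.starProjection x)‖ ^ 2 +
        ‖x - W.starProjection x‖ ^ 2 := by
      have e1 : ⟪x - W.starProjection x, x⟫ = ‖x - W.starProjection x‖ ^ 2 := by
        have : ⟪x - W.starProjection x, W.starProjection x⟫ = 0 :=
          Submodule.inner_left_of_mem_orthogonal (W.starProjection_apply_mem x)
            (W.sub_starProjection_mem_orthogonal x)
        rw [← real_inner_self_eq_norm_sq, inner_sub_right (x - W.starProjection x) x, this,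
          sub_zero]
      simp only [metricOp, add_apply, ContinuousLinearMap.comp_apply, sub_apply,
        ContinuousLinearMap.id_apply, inner_add_left]
      rw [e1, Submodule.inner_starProjection_left_eq_right, adjointL_inner,
        real_inner_self_eq_norm_sq]
    rw [hx, inner_zero_left] at h1
    have h2 : ‖fderiv ℝ Ψ z (W.starProjection x)‖ ^ 2 = 0 := by
      nlinarith [sq_nonneg ‖fderiv ℝ Ψ z (W.starProjection x)‖,
        sq_nonneg ‖x - W.starProjection x‖]
    have h3 : ‖x - W.starProjection x‖ ^ 2 = 0 := by
      nlinarith [sq_nonneg ‖fderiv ℝ Ψ z (W.starProjection x)‖,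
        sq_nonneg ‖x - W.starProjection x‖]
    have h4 : W.starProjection x = 0 := by
      have := h.fderiv_symm_injective hz
      rw [injective_iff_map_eq_zero] at this
      exact this _ (by simpa using h2)
    have h5 : x - W.starProjection x = 0 := by simpa using h3
    rwa [h4, sub_zero] at h5
  rw [ContinuousLinearMap.isUnit_iff_bijective]
  exact ⟨hinj, LinearMap.surjective_of_injective (f := (metricOp W Ψ z).toLinearMap) hinj⟩

lemma contDiffOn_metricOp (h : FlatChart M p W Φ Ψ U r) :
    ContDiffOn ℝ ∞ (metricOp W Ψ) (Metric.ball (Φ p) r) := by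
  have hT := h.contDiffOn_fderiv_symm
  exact (contDiffOn_const.clm_comp ((adjointL.contDiff.comp_contDiffOn hT).clm_comp
    (hT.clm_comp contDiffOn_const))).add contDiffOn_const

lemma contDiffOn_inverse_metricOp (h : FlatChart M p W Φ Ψ U r) :
    ContDiffOn ℝ ∞ (fun z => Ring.inverse (metricOp W Ψ z)) (Metric.ball (Φ p) r) := by
  intro z hz
  obtain ⟨e, he⟩ := h.isUnit_metricOp hz
  have := contDiffAt_ringInverse (n := ∞) ℝ e
  rw [he] at this
  exact this.comp_contDiffWithinAt z (h.contDiffOn_metricOp z hz)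

end FlatChart

/-! ### The first variation of the energy -/

namespace FlatChart

variable {M : Set Target} {p : Target} {W : Submodule ℝ Target} {Φ Ψ : Target → Target}
  {U : Set Target} {r : ℝ}

/-- The first variation formula of the energy: a minimizer `Ψ ∘ x` of constant speed at most `D` is
a critical point with respect to variations of the chart coordinate `x` in `W` with fixed ends. -/
lemma first_variation (h : FlatChart M p W Φ Ψ U r) {x x' : ℝ → Target} {u w D : ℝ}
    (huw : u < w) (hxd : ∀ t ∈ Icc u w, HasDerivWithinAt x (x' t) (Icc u w) t)
    (hx'c : ContinuousOn x' (Icc u w)) (hball : ∀ t ∈ Icc u w, x t ∈ Metric.ball (Φ p) r)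
    (hW : ∀ t ∈ Icc u w, x t ∈ W)
    (hspeed : ∀ t ∈ Icc u w, ‖fderiv ℝ Ψ (x t) (x' t)‖ ≤ D)
    (hmin : ENNReal.ofReal (D * (w - u)) ≤ geodesicDist M (Ψ (x u)) (Ψ (x w)))
    {η η' : ℝ → Target} (hη : ∀ t, HasDerivAt η (η' t) t) (hη' : Continuous η')
    (hηW : ∀ t, η t ∈ W) (hηu : η u = 0) (hηw : η w = 0) :
    ∫ t in u..w, ⟪fderiv ℝ Ψ (x t) (x' t),
      fderiv ℝ (fderiv ℝ Ψ) (x t) (η t) (x' t) + fderiv ℝ Ψ (x t) (η' t)⟫ = 0 := by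
  have hxc : ContinuousOn x (Icc u w) := fun t ht => (hxd t ht).continuousWithinAt
  have hηc : Continuous η := continuous_iff_continuousAt.2 fun t => (hη t).continuousAt
  have hD0 : 0 ≤ D := (norm_nonneg _).trans (hspeed u ⟨le_rfl, huw.le⟩)
  -- the variations stay in the chart for small parameters
  obtain ⟨ε₀, hε₀, hε⟩ : ∃ ε₀ : ℝ, 0 < ε₀ ∧ ∀ ε ∈ Icc (-ε₀) ε₀, ∀ t ∈ Icc u w,
      x t + ε • η t ∈ Metric.ball (Φ p) r := by
    obtain ⟨δ, hδ, hδs⟩ := (isCompact_Icc.image_of_continuousOn hxc).exists_thickening_subset_open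
      Metric.isOpen_ball (image_subset_iff.2 hball)
    obtain ⟨K, hK⟩ := isCompact_Icc.exists_bound_of_continuousOn (hηc.continuousOn (s := Icc u w))
    have hK0 : 0 ≤ K := (norm_nonneg _).trans (hK u ⟨le_rfl, huw.le⟩)
    refine ⟨δ / (2 * (K + 1)), by positivity, fun ε hε t ht => hδs ?_⟩
    rw [Metric.mem_thickening_iff]
    refine ⟨x t, mem_image_of_mem x ht, ?_⟩
    rw [dist_eq_norm, add_sub_cancel_left, norm_smul, Real.norm_eq_abs]
    calc |ε| * ‖η t‖ ≤ δ / (2 * (K + 1)) * K := by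
          gcongr; exacts [abs_le.2 hε, hK t ht]
      _ < δ := by rw [div_mul_eq_mul_div, div_lt_iff₀ (by positivity)]; nlinarith
  set V : ℝ → ℝ → Target := fun ε t => fderiv ℝ Ψ (x t + ε • η t) (x' t + ε • η' t) with hV
  set V' : ℝ → ℝ → Target := fun ε t =>
    fderiv ℝ (fderiv ℝ Ψ) (x t + ε • η t) (η t) (x' t + ε • η' t) +
      fderiv ℝ Ψ (x t + ε • η t) (η' t) with hV'
  have hT := h.contDiffOn_fderiv_symm
  have hT' : ContDiffOn ℝ ∞ (fderiv ℝ (fderiv ℝ Ψ)) (Metric.ball (Φ p) r) :=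
    hT.fderiv_of_isOpen Metric.isOpen_ball (by simp)
  have hline : ContinuousOn (fun z : ℝ × ℝ => x z.2 + z.1 • η z.2) (Icc (-ε₀) ε₀ ×ˢ Icc u w) :=
    (hxc.comp continuousOn_snd fun z hz => hz.2).add (by fun_prop)
  have hline' : ContinuousOn (fun z : ℝ × ℝ => x' z.2 + z.1 • η' z.2) (Icc (-ε₀) ε₀ ×ˢ Icc u w) :=
    (hx'c.comp continuousOn_snd fun z hz => hz.2).add (by fun_prop)
  have hmaps : MapsTo (fun z : ℝ × ℝ => x z.2 + z.1 • η z.2) (Icc (-ε₀) ε₀ ×ˢ Icc u w)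
      (Metric.ball (Φ p) r) := fun z hz => hε z.1 hz.1 z.2 hz.2
  have hVc : ContinuousOn (Function.uncurry V) (Icc (-ε₀) ε₀ ×ˢ Icc u w) :=
    (hT.continuousOn.comp hline hmaps).clm_apply hline'
  have hV'c : ContinuousOn (Function.uncurry V') (Icc (-ε₀) ε₀ ×ˢ Icc u w) :=
    (((hT'.continuousOn.comp hline hmaps).clm_apply
      (f := fun z : ℝ × ℝ => fderiv ℝ (fderiv ℝ Ψ) (x z.2 + z.1 • η z.2))
      (g := fun z : ℝ × ℝ => η z.2) (by fun_prop)).clm_apply hline').add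
      ((hT.continuousOn.comp hline hmaps).clm_apply
        (g := fun z : ℝ × ℝ => η' z.2) (by fun_prop))
  have hVd : ∀ ε ∈ Icc (-ε₀) ε₀, ∀ t ∈ Icc u w, HasDerivAt (fun ε => V ε t) (V' ε t) ε := by
    intro ε hεm t ht
    have hz := hε ε hεm t ht
    have d1 : HasDerivAt (fun ε : ℝ => x t + ε • η t) (η t) ε := by
      simpa using ((hasDerivAt_id ε).smul_const (η t)).const_add (x t)
    have d2 : HasDerivAt (fun ε : ℝ => x' t + ε • η' t) (η' t) ε := by
      simpa using ((hasDerivAt_id ε).smul_const (η' t)).const_add (x' t)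
    have d3 : HasFDerivAt (fderiv ℝ Ψ) (fderiv ℝ (fderiv ℝ Ψ) (x t + ε • η t)) (x t + ε • η t) :=
      ((hT.contDiffAt (Metric.isOpen_ball.mem_nhds hz)).differentiableAt (by simp)).hasFDerivAt
    have d4 : HasDerivAt (fun ε : ℝ => fderiv ℝ Ψ (x t + ε • η t))
        (fderiv ℝ (fderiv ℝ Ψ) (x t + ε • η t) (η t)) ε := d3.comp_hasDerivAt ε d1
    exact d4.clm_apply d2
  have hVt : ∀ ε ∈ Icc (-ε₀) ε₀, ContinuousOn (V ε) (Icc u w) := fun ε hεm =>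
    hVc.comp (f := fun t => (ε, t)) (by fun_prop) fun t ht => ⟨hεm, ht⟩
  have hV't : ∀ ε ∈ Icc (-ε₀) ε₀, ContinuousOn (V' ε) (Icc u w) := fun ε hεm =>
    hV'c.comp (f := fun t => (ε, t)) (by fun_prop) fun t ht => ⟨hεm, ht⟩
  have hII : ∀ {f : ℝ → ℝ}, ContinuousOn f (Icc u w) → IntervalIntegrable f volume u w := fun hf =>
    (hf.mono (by rw [uIcc_of_le huw.le])).intervalIntegrable
  set F : ℝ → ℝ := fun ε => ∫ t in u..w, ‖V ε t‖ ^ 2 with hF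
  have h0mem : (0:ℝ) ∈ Icc (-ε₀) ε₀ := ⟨by linarith, hε₀.le⟩
  have hlen : ∀ ε ∈ Icc (-ε₀) ε₀, D ^ 2 * (w - u) ≤ F ε := by
    intro ε hεm
    have hA : IsArc M (fun t => Ψ (x t + ε • η t)) (V ε) u w := by
      refine ⟨huw.le, fun t ht => ?_, hVt ε hεm, fun t ht => h.symm_mem _ (hε ε hεm t ht)
        (W.add_mem (hW t ht) (W.smul_mem _ (hηW t)))⟩
      exact (h.hasFDerivAt_symm (hε ε hεm t ht)).comp_hasDerivWithinAt t
        ((hxd t ht).add ((hη t).hasDerivWithinAt.const_smul ε))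
    have h1 := hA.geodesicDist_le
    simp only [hηu, hηw, smul_zero, add_zero] at h1
    have h2 : D * (w - u) ≤ ∫ t in u..w, ‖V ε t‖ := by
      have := hmin.trans h1
      rwa [ENNReal.ofReal_le_ofReal_iff hA.length_nonneg] at this
    -- `2 D ‖V‖ ≤ ‖V‖² + D²` replaces the Cauchy-Schwarz inequality
    have h3 : ∫ t in u..w, (2 * D * ‖V ε t‖ - D ^ 2) ≤ F ε := by
      refine intervalIntegral.integral_mono_on huw.le ?_ ?_ fun t _ => ?_
      · exact hII (((hVt ε hεm).norm.const_smul (2 * D)).sub continuousOn_const)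
      · exact hII ((hVt ε hεm).norm.pow 2)
      · nlinarith [sq_nonneg (‖V ε t‖ - D)]
    rw [intervalIntegral.integral_sub (f := fun t => 2 * D * ‖V ε t‖) (g := fun _ => D ^ 2)
      (hII ((hVt ε hεm).norm.const_smul (2 * D))) (by simp),
      intervalIntegral.integral_const_mul, intervalIntegral.integral_const, smul_eq_mul] at h3
    nlinarith
  have hF0 : F 0 ≤ D ^ 2 * (w - u) := by
    calc F 0 ≤ ∫ _ in u..w, D ^ 2 := by
          refine intervalIntegral.integral_mono_on huw.le (hII ((hVt 0 h0mem).norm.pow 2))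
            (by simp) fun t ht => ?_
          have := hspeed t ht
          simp only [hV, zero_smul, add_zero]
          gcongr
      _ = _ := by rw [intervalIntegral.integral_const, smul_eq_mul]; ring
  have hmin0 : IsLocalMin F 0 := by
    filter_upwards [Icc_mem_nhds (neg_lt_zero.2 hε₀) hε₀] with ε hεm
    exact hF0.trans (hlen ε hεm)
  obtain ⟨B, hB⟩ := (isCompact_Icc.prod isCompact_Icc).exists_bound_of_continuousOn
    (s := Icc (-ε₀) ε₀ ×ˢ Icc u w) (f := fun z => 2 * ⟪V z.1 z.2, V' z.1 z.2⟫)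
    (((hVc.inner hV'c).const_smul (2:ℝ)))
  have hFd : HasDerivAt F (∫ t in u..w, 2 * ⟪V 0 t, V' 0 t⟫) 0 := by
    refine (intervalIntegral.hasDerivAt_integral_of_dominated_loc_of_deriv_le
      (F' := fun ε t => 2 * ⟪V ε t, V' ε t⟫) (bound := fun _ => B)
      (s := Icc (-ε₀) ε₀) (Icc_mem_nhds (neg_lt_zero.2 hε₀) hε₀) ?_ ?_ ?_ ?_ (by simp) ?_).2
    · filter_upwards [Icc_mem_nhds (neg_lt_zero.2 hε₀) hε₀] with ε hεm
      exact (hII ((hVt ε hεm).norm.pow 2)).aestronglyMeasurable_restrict_uIoc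
    · exact hII ((hVt 0 h0mem).norm.pow 2)
    · exact (hII (((hVt 0 h0mem).inner (hV't 0 h0mem)).const_smul
        (2:ℝ))).aestronglyMeasurable_restrict_uIoc
    · refine Eventually.of_forall fun t ht ε hεm => ?_
      rw [uIoc_of_le huw.le] at ht
      exact hB (ε, t) ⟨hεm, ht.1.le, ht.2⟩
    · refine Eventually.of_forall fun t ht ε hεm => ?_
      rw [uIoc_of_le huw.le] at ht
      exact (hVd ε hεm t ⟨ht.1.le, ht.2⟩).norm_sq
  have := hmin0.hasDerivAt_eq_zero hFd
  rw [intervalIntegral.integral_const_mul] at this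
  simpa [hV, hV'] using this

end FlatChart

/-! ### Regularity of minimizers -/

namespace FlatChart

variable {M : Set Target} {p : Target} {W : Submodule ℝ Target} {Φ Ψ : Target → Target}
  {U : Set Target} {r : ℝ}

/-- A `C¹` minimizer of constant speed is smooth, up to the ends: the Euler-Lagrange equation
determines the derivative of `Y = (DΨ)ᵀ DΨ x'` by `x` and `x'`, and `x'` by `Y` and `x`, so that
the regularity of `x` increases step by step. -/
lemma contDiffOn_of_minimizing (h : FlatChart M p W Φ Ψ U r) {σ v : ℝ → Target} {u w D : ℝ}
    (huw : u < w) (hσd : ∀ t ∈ Icc u w, HasDerivWithinAt σ (v t) (Icc u w) t)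
    (hv : Continuous v) (hU : ∀ t ∈ Icc u w, σ t ∈ U) (hσM : ∀ t ∈ Icc u w, σ t ∈ M)
    (hspeed : ∀ t ∈ Icc u w, ‖v t‖ ≤ D)
    (hmin : ENNReal.ofReal (D * (w - u)) ≤ geodesicDist M (σ u) (σ w)) :
    ContDiffOn ℝ ∞ σ (Icc u w) := by
  have huniq : UniqueDiffOn ℝ (Icc u w) := uniqueDiffOn_Icc huw
  have hσc : ContinuousOn σ (Icc u w) := fun t ht => (hσd t ht).continuousWithinAt
  set x : ℝ → Target := fun t => Φ (σ t) with hx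
  set x' : ℝ → Target := fun t => fderiv ℝ Φ (σ t) (v t) with hx'
  have hball : ∀ t ∈ Icc u w, x t ∈ Metric.ball (Φ p) r := fun t ht => h.mapsTo (hU t ht)
  have hW : ∀ t ∈ Icc u w, x t ∈ W := fun t ht => h.mem_of_mem _ (hU t ht) (hσM t ht)
  have hxd : ∀ t ∈ Icc u w, HasDerivWithinAt x (x' t) (Icc u w) t := fun t ht =>
    (((h.smooth.contDiffAt (h.isOpen.mem_nhds (hU t ht))).differentiableAt
      (by simp)).hasFDerivAt).comp_hasDerivWithinAt t (hσd t ht)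
  have hxc : ContinuousOn x (Icc u w) := fun t ht => (hxd t ht).continuousWithinAt
  have hx'c : ContinuousOn x' (Icc u w) :=
    ((h.smooth.continuousOn_fderiv_of_isOpen h.isOpen (by simp)).comp hσc hU).clm_apply
      hv.continuousOn
  have hx'W : ∀ t ∈ Icc u w, W.starProjection (x' t) = x' t := by
    intro t ht
    refine (huniq t ht).eq_deriv _ ?_ (hxd t ht)
    exact ((W.starProjection.hasFDerivAt).comp_hasDerivWithinAt t (hxd t ht)).congr_of_mem
      (fun s hs => (W.starProjection_eq_self_iff.2 (hW s hs)).symm) ht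
  have hσx : ∀ t ∈ Icc u w, σ t = Ψ (x t) := fun t ht => (h.left_inv _ (hU t ht)).symm
  have hvx : ∀ t ∈ Icc u w, v t = fderiv ℝ Ψ (x t) (x' t) := by
    intro t ht
    refine (huniq t ht).eq_deriv _ (hσd t ht) ?_
    exact ((h.hasFDerivAt_symm (hball t ht)).comp_hasDerivWithinAt t (hxd t ht)).congr_of_mem
      hσx ht
  have hT := h.contDiffOn_fderiv_symm
  have hT' : ContDiffOn ℝ ∞ (fderiv ℝ (fderiv ℝ Ψ)) (Metric.ball (Φ p) r) :=
    hT.fderiv_of_isOpen Metric.isOpen_ball (by simp)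
  obtain ⟨Y, hY⟩ : ∃ Y : ℝ → Target, Y = fun t =>
    W.starProjection (adjointL (fderiv ℝ Ψ (x t)) (fderiv ℝ Ψ (x t) (x' t))) := ⟨_, rfl⟩
  obtain ⟨Z, hZ⟩ : ∃ Z : ℝ → Target, Z = fun t => W.starProjection
    (adjointL (ContinuousLinearMap.apply ℝ Target (x' t) ∘L fderiv ℝ (fderiv ℝ Ψ) (x t))
      (fderiv ℝ Ψ (x t) (x' t))) := ⟨_, rfl⟩
  have hTx : ∀ n : ℕ, ContDiffOn ℝ n x (Icc u w) →
      ContDiffOn ℝ n (fun t => fderiv ℝ Ψ (x t)) (Icc u w) := fun n h1 =>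
    (hT.of_le (mod_cast le_top)).comp h1 hball
  have hTx' : ∀ n : ℕ, ContDiffOn ℝ n x (Icc u w) →
      ContDiffOn ℝ n (fun t => fderiv ℝ (fderiv ℝ Ψ) (x t)) (Icc u w) := fun n h1 =>
    (hT'.of_le (mod_cast le_top)).comp h1 hball
  have hVreg : ∀ n : ℕ, ContDiffOn ℝ n x (Icc u w) → ContDiffOn ℝ n x' (Icc u w) →
      ContDiffOn ℝ n (fun t => fderiv ℝ Ψ (x t) (x' t)) (Icc u w) := fun n h1 h2 =>
    (hTx n h1).clm_apply h2
  have hadj : ∀ {n : ℕ} {T : ℝ → Target →L[ℝ] Target} {y : ℝ → Target},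
      ContDiffOn ℝ n T (Icc u w) → ContDiffOn ℝ n y (Icc u w) →
      ContDiffOn ℝ n (fun t => W.starProjection (adjointL (T t) (y t))) (Icc u w) := by
    intro n T y h1 h2
    have h3 : ContDiffOn ℝ n (fun t => adjointL (T t)) (Icc u w) :=
      adjointL.contDiff.comp_contDiffOn h1
    exact W.starProjection.contDiff.comp_contDiffOn (h3.clm_apply h2)
  have hYreg : ∀ n : ℕ, ContDiffOn ℝ n x (Icc u w) → ContDiffOn ℝ n x' (Icc u w) →
      ContDiffOn ℝ n Y (Icc u w) := fun n h1 h2 => by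
    rw [hY]; exact hadj (hTx n h1) (hVreg n h1 h2)
  have hZreg : ∀ n : ℕ, ContDiffOn ℝ n x (Icc u w) → ContDiffOn ℝ n x' (Icc u w) →
      ContDiffOn ℝ n Z (Icc u w) := fun n h1 h2 => by
    have h4 : ContDiff ℝ n (fun y : Target => ContinuousLinearMap.apply ℝ Target y) := by fun_prop
    have h3 : ContDiffOn ℝ n (fun t => ContinuousLinearMap.apply ℝ Target (x' t)) (Icc u w) :=
      h4.comp_contDiffOn h2
    rw [hZ]; exact hadj (h3.clm_comp (hTx' n h1)) (hVreg n h1 h2)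
  have h0 : ContDiffOn ℝ (0 : ℕ) x (Icc u w) := by
    rw [Nat.cast_zero, contDiffOn_zero]; exact hxc
  have h0' : ContDiffOn ℝ (0 : ℕ) x' (Icc u w) := by
    rw [Nat.cast_zero, contDiffOn_zero]; exact hx'c
  have hYc : ContinuousOn Y (Icc u w) := (hYreg 0 h0 h0').continuousOn
  have hZc : ContinuousOn Z (Icc u w) := (hZreg 0 h0 h0').continuousOn
  have hYd : ∀ t ∈ Icc u w, HasDerivWithinAt Y (Z t) (Icc u w) t := by
    refine hasDerivWithinAt_of_forall_integral_eq_zero (Y := Y) (Z := Z) huw hYc hZc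
      fun η η' hη hη' hηu hηw => ?_
    have hfv := h.first_variation (D := D) huw hxd hx'c hball hW
      (fun t ht => by rw [← hvx t ht]; exact hspeed t ht)
      (by rwa [← hσx u ⟨le_rfl, huw.le⟩, ← hσx w ⟨huw.le, le_rfl⟩])
      (η := fun t => W.starProjection (η t)) (η' := fun t => W.starProjection (η' t))
      (fun t => (W.starProjection.hasFDerivAt).comp_hasDerivAt t (hη t))
      (by fun_prop) (fun t => W.starProjection_apply_mem _) (by simp [hηu]) (by simp [hηw])
    refine Eq.trans ?_ hfv
    refine intervalIntegral.integral_congr fun t _ => ?_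
    simp only [hY, hZ]
    rw [Submodule.inner_starProjection_left_eq_right, Submodule.inner_starProjection_left_eq_right,
      adjointL_inner, adjointL_inner, ContinuousLinearMap.comp_apply,
      ContinuousLinearMap.apply_apply, inner_add_right, add_comm]
  -- the metric tensor is invertible, so that `x'` is a smooth function of `x` and `Y`
  have hsolve : ∀ t ∈ Icc u w, x' t = Ring.inverse (metricOp W Ψ (x t)) (Y t) := by
    intro t ht
    have e : metricOp W Ψ (x t) (x' t) = Y t := by
      simp [metricOp, hY, hx'W t ht]
    rw [← e, ← mul_apply_eq_comp, Ring.inverse_mul_cancel _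
      (h.isUnit_metricOp (hball t ht)), one_apply_eq_self]
  have hsucc : ∀ {n : ℕ} {f f' : ℝ → Target},
      (∀ t ∈ Icc u w, HasDerivWithinAt f (f' t) (Icc u w) t) → ContDiffOn ℝ n f' (Icc u w) →
      ContDiffOn ℝ (n + 1 : ℕ) f (Icc u w) := by
    intro n f f' hf hf'
    rw [Nat.cast_add, Nat.cast_one, contDiffOn_succ_iff_derivWithin huniq]
    exact ⟨fun t ht => (hf t ht).differentiableWithinAt, by simp,
      hf'.congr fun t ht => (hf t ht).derivWithin (huniq t ht)⟩
  have hall : ∀ n : ℕ, ContDiffOn ℝ n x (Icc u w) ∧ ContDiffOn ℝ n x' (Icc u w) := by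
    intro n
    induction n with
    | zero => exact ⟨h0, h0'⟩
    | succ n ih =>
      have h1 := hsucc hxd ih.2
      have h2 := hsucc hYd (hZreg n ih.1 ih.2)
      exact ⟨h1, (((h.contDiffOn_inverse_metricOp.of_le (mod_cast le_top)).comp h1
        hball).clm_apply h2).congr hsolve⟩
  have hxs : ContDiffOn ℝ ∞ x (Icc u w) := contDiffOn_infty.2 fun n => (hall n).1
  exact (h.smooth_symm.comp hxs hball).congr hσx

end FlatChart

/-! ### Existence of geodesic profiles -/

/-- A curve along which the Euclidean distance is proportional to the parameter up to a quadratic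
error is `C¹` on each half of its interval. -/
lemma exists_hasDerivWithinAt_halves {E : Type*} [NormedAddCommGroup E] [InnerProductSpace ℝ E]
    [CompleteSpace E] {σ : ℝ → E} {s₀ s₁ D C : ℝ} (h01 : s₀ < s₁) (hD : 0 ≤ D) (hC : 0 ≤ C)
    (hLip : ∀ s ∈ Icc s₀ s₁, ∀ t ∈ Icc s₀ s₁, ‖σ s - σ t‖ ≤ D * |s - t|)
    (hlow : ∀ s ∈ Icc s₀ s₁, ∀ t ∈ Icc s₀ s₁, s ≤ t →
      D * (t - s) ≤ ‖σ s - σ t‖ + C * ‖σ s - σ t‖ ^ 2) :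
    (∃ v : ℝ → E, Continuous v ∧ ∀ t ∈ Icc s₀ ((s₀ + s₁) / 2),
      HasDerivWithinAt σ (v t) (Icc s₀ ((s₀ + s₁) / 2)) t) ∧
    (∃ v : ℝ → E, Continuous v ∧ ∀ t ∈ Icc ((s₀ + s₁) / 2) s₁,
      HasDerivWithinAt σ (v t) (Icc ((s₀ + s₁) / 2) s₁) t) := by
  have h2 : ∀ t h, 0 < h → s₀ ≤ t - h → t + h ≤ s₁ →
      ‖σ (t - h) + σ (t + h) - (2:ℝ) • σ t‖ ^ 2 ≤ (16 * C * D ^ 3) * h ^ 3 := by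
    intro t h hh hl hr
    have m1 : t - h ∈ Icc s₀ s₁ := ⟨hl, by linarith⟩
    have m2 : t ∈ Icc s₀ s₁ := ⟨by linarith, by linarith⟩
    have m3 : t + h ∈ Icc s₀ s₁ := ⟨by linarith, hr⟩
    refine norm_second_difference_sq_le hD hC hh ?_ ?_ ?_
    · simpa [abs_of_pos hh] using hLip _ m1 _ m2
    · simpa [abs_of_pos hh] using hLip _ m3 _ m2
    · have := hlow _ m1 _ m3 (by linarith)
      rwa [show t + h - (t - h) = 2 * h by ring] at this
  refine ⟨exists_hasDerivWithinAt_of_second_difference h01 hD (by positivity) hLip h2, ?_⟩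
  obtain ⟨v, hv, hd⟩ := exists_hasDerivWithinAt_of_second_difference (σ := fun t => σ (-t))
    (s₀ := -s₁) (s₁ := -s₀) (B := 16 * C * D ^ 3) (by linarith) hD (by positivity)
    (fun s hs t ht => by
      have := hLip (-s) ⟨by linarith [hs.2], by linarith [hs.1]⟩ (-t)
        ⟨by linarith [ht.2], by linarith [ht.1]⟩
      rwa [show -s - -t = -(s - t) by ring, abs_neg] at this)
    (fun t h hh hl hr => by
      have := h2 (-t) h hh (by linarith) (by linarith)
      rwa [show -t - h = -(t + h) by ring, show -t + h = -(t - h) by ring,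
        add_comm (σ (-(t + h)))] at this)
  refine ⟨fun t => -v (-t), by fun_prop, fun t ht => ?_⟩
  have hmaps : MapsTo (fun t : ℝ => -t) (Icc ((s₀ + s₁) / 2) s₁) (Icc (-s₁) ((-s₁ + -s₀) / 2)) :=
    fun s hs => ⟨by linarith [hs.2], by linarith [hs.1]⟩
  have := (hd (-t) (hmaps ht)).scomp t (hasDerivAt_neg t).hasDerivWithinAt hmaps
  simpa [Function.comp_def] using this

lemma HasDerivWithinAt.norm_le_of_lip {E : Type*} [NormedAddCommGroup E] [NormedSpace ℝ E]
    {σ : ℝ → E} {v : E} {u w t D : ℝ} (h : HasDerivWithinAt σ v (Icc u w) t) (huw : u < w)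
    (ht : t ∈ Icc u w) (hLip : ∀ s ∈ Icc u w, ‖σ s - σ t‖ ≤ D * |s - t|) : ‖v‖ ≤ D := by
  have hne : (𝓝[Icc u w \ {t}] t).NeBot :=
    accPt_principal_iff_nhdsWithin.1 (uniqueDiffOn_Icc huw t ht).accPt
  refine le_of_tendsto (hasDerivWithinAt_iff_tendsto_slope.1 h).norm ?_
  filter_upwards [self_mem_nhdsWithin] with s hs
  have hst : s - t ≠ 0 := sub_ne_zero.2 hs.2
  rw [slope_def_module, norm_smul, norm_inv, Real.norm_eq_abs,
    inv_mul_le_iff₀ (abs_pos.2 hst), mul_comm]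
  exact hLip s hs.1

/-- Two points of a compact connected submanifold are joined by a geodesic profile. -/
theorem geodesicProfiles_nonempty {M : Set Target} (hM : IsSmoothSubmanifold M)
    (hMc : IsCompact M) (hMconn : IsConnected M) {a b : Target} (ha : a ∈ M) (hb : b ∈ M) :
    (geodesicProfiles M a b).Nonempty := by
  obtain ⟨σ, hσ0, hσ1, hσM, hσd⟩ :=
    hM.exists_metric_geodesic hMc (hM.geodesicDist_lt_top hMconn ha hb)
  have hfin := hM.geodesicDist_lt_top hMconn ha hb
  set D := (geodesicDist M a b).toReal with hD
  have hD0 : 0 ≤ D := ENNReal.toReal_nonneg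
  have hLip' : ∀ s ∈ Icc (0:ℝ) 1, ∀ t ∈ Icc (0:ℝ) 1, s ≤ t → ‖σ s - σ t‖ ≤ D * (t - s) := by
    intro s hs t ht hst
    have := (enorm_sub_le_geodesicDist (M := M) (x := σ s) (y := σ t)).trans_eq (hσd s hs t ht hst)
    rwa [← ofReal_norm, ENNReal.ofReal_le_ofReal_iff
      (mul_nonneg hD0 (sub_nonneg.2 hst))] at this
  have hLip : ∀ s ∈ Icc (0:ℝ) 1, ∀ t ∈ Icc (0:ℝ) 1, ‖σ s - σ t‖ ≤ D * |s - t| := by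
    intro s hs t ht
    rcases le_total s t with hst | hst
    · rw [abs_sub_comm, abs_of_nonneg (sub_nonneg.2 hst)]; exact hLip' s hs t ht hst
    · rw [norm_sub_rev, abs_of_nonneg (sub_nonneg.2 hst)]; exact hLip' t ht s hs hst
  have hσc : ContinuousOn σ (Icc 0 1) := by
    refine (LipschitzOnWith.of_dist_le_mul (K := ⟨D, hD0⟩) fun s hs t ht => ?_).continuousOn
    rw [dist_eq_norm, Real.dist_eq]
    exact hLip s hs t ht
  -- smoothness near each parameter, up to the ends
  have hlocal : ∀ t₀ ∈ Icc (0:ℝ) 1, ContDiffWithinAt ℝ ∞ σ (Icc 0 1) t₀ := by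
    intro t₀ ht₀
    obtain ⟨V, hV, C, hC, hquad⟩ := hM.geodesicDist_le_quadratic (hσM t₀ ht₀)
    obtain ⟨W, Φ, Ψ, U, r, hch⟩ := hM.exists_flatChart (hσM t₀ ht₀)
    obtain ⟨δ, hδ, hδs⟩ := Metric.mem_nhdsWithin_iff.1 (hσc t₀ ht₀
      (inter_mem hV (hch.isOpen.mem_nhds hch.mem)))
    have hnear : ∀ t ∈ Icc (0:ℝ) 1, |t - t₀| < δ → σ t ∈ V ∧ σ t ∈ U := fun t ht htδ =>
      hδs ⟨by rwa [Metric.mem_ball, Real.dist_eq], ht⟩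
    have hlow : ∀ s ∈ Icc (0:ℝ) 1, |s - t₀| < δ → ∀ t ∈ Icc (0:ℝ) 1, |t - t₀| < δ → s ≤ t →
        D * (t - s) ≤ ‖σ s - σ t‖ + C * ‖σ s - σ t‖ ^ 2 := by
      intro s hs hsδ t ht htδ hst
      have := hquad _ (hnear s hs hsδ).1 _ (hnear t ht htδ).1 (hσM s hs) (hσM t ht)
      rwa [hσd s hs t ht hst, ENNReal.ofReal_le_ofReal_iff (by positivity)] at this
    have hsmooth : ∀ u w : ℝ, u < w → 0 ≤ u → w ≤ 1 → (∀ t ∈ Icc u w, |t - t₀| < δ) →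
        (∃ v : ℝ → Target, Continuous v ∧ ∀ t ∈ Icc u w, HasDerivWithinAt σ (v t) (Icc u w) t) →
        ContDiffOn ℝ ∞ σ (Icc u w) := by
      rintro u w huw hu hw hδt ⟨v, hv, hvd⟩
      have hsub : Icc u w ⊆ Icc 0 1 := Icc_subset_Icc hu hw
      refine hch.contDiffOn_of_minimizing (D := D) huw hvd hv
        (fun t ht => (hnear t (hsub ht) (hδt t ht)).2) (fun t ht => hσM t (hsub ht))
        (fun t ht => ?_) (hσd u (hsub ⟨le_rfl, huw.le⟩) w (hsub ⟨huw.le, le_rfl⟩) huw.le).ge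
      exact (hvd t ht).norm_le_of_lip huw ht fun s hs => hLip s (hsub hs) t (hsub ht)
    obtain ⟨κ, hκ, hκδ, hκ1⟩ : ∃ κ > 0, 2 * κ < δ ∧ κ ≤ 1 / 4 :=
      ⟨min (δ / 4) (1 / 4), by positivity, by linarith [min_le_left (δ / 4) (1 / 4)],
        min_le_right _ _⟩
    have hD' : ∀ s₀ s₁ : ℝ, 0 ≤ s₀ → s₁ ≤ 1 → s₀ < s₁ → t₀ - 2 * κ ≤ s₀ → s₁ ≤ t₀ + 2 * κ →
        (∀ t ∈ Icc s₀ s₁, |t - t₀| < δ) ∧ _ := fun s₀ s₁ h0 h1 h01 hl hr =>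
      have hb : ∀ t ∈ Icc s₀ s₁, |t - t₀| < δ := fun t ht =>
        abs_lt.2 ⟨by linarith [ht.1], by linarith [ht.2]⟩
      have hsub : Icc s₀ s₁ ⊆ Icc 0 1 := Icc_subset_Icc h0 h1
      ⟨hb, exists_hasDerivWithinAt_halves h01 hD0 hC
        (fun s hs t ht => hLip s (hsub hs) t (hsub ht))
        (fun s hs t ht hst => hlow s (hsub hs) (hb s hs) t (hsub ht) (hb t ht) hst)⟩
    -- `σ` is `C¹` on the first half of an interval starting just before `t₀`, or on the second half
    -- of one ending just after `t₀`; the choice keeps these intervals inside `[0, 1]`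
    rcases le_total t₀ (1 / 2) with ht | ht
    · have hm0 : t₀ - κ ≤ max 0 (t₀ - κ) := le_max_right _ _
      have hm1 : max 0 (t₀ - κ) ≤ t₀ := max_le ht₀.1 (by linarith)
      obtain ⟨hb, hl, -⟩ := hD' (max 0 (t₀ - κ)) (t₀ + 2 * κ) (le_max_left _ _) (by linarith)
        (by linarith) (by linarith) le_rfl
      have hs := hsmooth _ _ (by linarith) (le_max_left _ _) (by linarith)
        (fun t ht => hb t ⟨ht.1, by linarith [ht.2]⟩) hl
      refine (hs t₀ ⟨hm1, by linarith⟩).mono_of_mem_nhdsWithin ?_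
      filter_upwards [self_mem_nhdsWithin, mem_nhdsWithin_of_mem_nhds
        (Ioo_mem_nhds (show t₀ - κ < t₀ by linarith) (show t₀ < t₀ + κ / 2 by linarith))]
        with s hs1 hs2
      exact ⟨max_le hs1.1 hs2.1.le, by linarith [hs2.2]⟩
    · have hm0 : min 1 (t₀ + κ) ≤ t₀ + κ := min_le_right _ _
      have hm1 : t₀ ≤ min 1 (t₀ + κ) := le_min ht₀.2 (by linarith)
      obtain ⟨hb, -, hl⟩ := hD' (t₀ - 2 * κ) (min 1 (t₀ + κ)) (by linarith) (min_le_left _ _)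
        (by linarith) le_rfl (by linarith)
      have hs := hsmooth _ _ (by linarith) (by linarith) (min_le_left _ _)
        (fun t ht => hb t ⟨by linarith [ht.1], ht.2⟩) hl
      refine (hs t₀ ⟨by linarith, hm1⟩).mono_of_mem_nhdsWithin ?_
      filter_upwards [self_mem_nhdsWithin, mem_nhdsWithin_of_mem_nhds
        (Ioo_mem_nhds (show t₀ - κ / 2 < t₀ by linarith) (show t₀ < t₀ + κ by linarith))]
        with s hs1 hs2
      exact ⟨by linarith [hs2.1], le_min hs1.2 hs2.2.le⟩
  have hσs : ContDiffOn ℝ ∞ σ (Icc 0 1) := hlocal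
  obtain ⟨hdiff, hcont⟩ := (contDiffOn_one_iff_derivWithin uniqueDiffOn_Icc_zero_one).1
    (hσs.of_le (m := 1) (by norm_cast))
  have hA : IsArc M σ (derivWithin σ (Icc 0 1)) 0 1 :=
    ⟨zero_le_one, fun r hr => (hdiff r hr).hasDerivWithinAt, hcont, hσM⟩
  have hlen : ENNReal.ofReal (∫ r in (0:ℝ)..1, ‖derivWithin σ (Icc 0 1) r‖) =
      geodesicDist M a b := by
    refine le_antisymm ?_ (by simpa [hσ0, hσ1] using hA.geodesicDist_le)
    rw [← ENNReal.ofReal_toReal hfin.ne]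
    refine ENNReal.ofReal_le_ofReal ?_
    calc _ ≤ ∫ _ in (0:ℝ)..1, D := by
          refine intervalIntegral.integral_mono_on zero_le_one hA.intervalIntegrable_norm (by simp)
            fun t ht => ?_
          exact (hA.hasDeriv t ht).norm_le_of_lip zero_lt_one ht fun s hs => hLip s hs t ht
      _ = D := by simp
  obtain ⟨e, e', he, hed, hec, heM, he0, he1, hz0, hz1, hlen'⟩ := hA.exists_stopped
  have hes : ContDiff ℝ ∞ e := by
    rw [← contDiffOn_univ, he]
    exact hσs.comp Real.smoothTransition.contDiff.contDiffOn fun r _ =>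
      ⟨Real.smoothTransition.nonneg r, Real.smoothTransition.le_one r⟩
  -- profiles run from `b` to `a`, hence the reversal
  refine ⟨fun t => e (1 / 2 - t), hes.comp (by fun_prop), fun t => heM _, fun t ht => ?_,
    fun t ht => ?_, ?_⟩
  · exact (he0 _ (by linarith)).trans hσ0
  · exact (he1 _ (by linarith)).trans hσ1
  · have hd : ∀ t, deriv (fun t => e (1 / 2 - t)) t = -e' (1 / 2 - t) := fun t => by
      have := (hed (1 / 2 - t)).scomp t ((hasDerivAt_id t).const_sub (1 / 2))
      simpa [Function.comp_def] using this.deriv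
    simp only [hd, enorm_neg]
    rw [lintegral_sub_left_eq_self (fun t => ‖e' t‖ₑ), ← hlen, ← hlen',
      intervalIntegral.integral_of_le zero_le_one,
      ofReal_integral_eq_lintegral_ofReal (hec.norm.integrableOn_Ioc)
        (Eventually.of_forall fun _ => norm_nonneg _), ← setLIntegral_univ,
      ← lintegral_indicator measurableSet_Ioc, setLIntegral_univ]
    refine lintegral_congr fun t => ?_
    by_cases ht : t ∈ Ioc (0:ℝ) 1
    · simp [ht]
    · rw [indicator_of_notMem ht]
      rcases le_or_gt t 0 with h | h
      · simp [hz0 t h]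
      · simp [hz1 t (by by_contra hcon; exact ht ⟨h, by linarith⟩)]

/-! ### Rectangular cylinders, faces and fluxes -/

noncomputable section

variable {ν₁ ν₂ : Plane}

/-- The orthonormal basis `(ν₁, ν₂)` of the plane. -/
def frameBasis (h : Orthonormal ℝ ![ν₁, ν₂]) : OrthonormalBasis (Fin 2) ℝ Plane :=
  (basisOfOrthonormalOfCardEqFinrank h (by simp)).toOrthonormalBasis (by simpa using h)

lemma frameBasis_apply (h : Orthonormal ℝ ![ν₁, ν₂]) (i : Fin 2) :
    frameBasis h i = ![ν₁, ν₂] i := by simp [frameBasis]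

lemma inner_frame (h : Orthonormal ℝ ![ν₁, ν₂]) :
    ⟪ν₁, ν₁⟫ = 1 ∧ ⟪ν₂, ν₂⟫ = 1 ∧ ⟪ν₁, ν₂⟫ = 0 ∧ ⟪ν₂, ν₁⟫ = 0 := by
  have h1 := h.1 0
  have h2 := h.1 1
  have h3 : ⟪ν₁, ν₂⟫ = 0 := by simpa using h.2 (show (0 : Fin 2) ≠ 1 by decide)
  simp only [Matrix.cons_val_zero, Matrix.cons_val_one] at h1 h2
  refine ⟨by rw [real_inner_self_eq_norm_sq, h1, one_pow],
    by rw [real_inner_self_eq_norm_sq, h2, one_pow], h3, by rw [real_inner_comm, h3]⟩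

lemma frame_expansion (h : Orthonormal ℝ ![ν₁, ν₂]) (x : Plane) :
    ⟪x, ν₁⟫ • ν₁ + ⟪x, ν₂⟫ • ν₂ = x := by
  have := (frameBasis h).sum_repr x
  rw [Fin.sum_univ_two] at this
  simpa [OrthonormalBasis.repr_apply_apply, frameBasis_apply, real_inner_comm] using this

/-- The coordinates `(x_α·ν₁, (x_α·ν₂, x₃))` of a point. -/
def frameCoord (h : Orthonormal ℝ ![ν₁, ν₂]) : Pt ≃ᵐ ℝ × (ℝ × ℝ) :=
  Homeomorph.toMeasurableEquiv
    { toFun := fun x => (⟪x.1, ν₁⟫, (⟪x.1, ν₂⟫, x.2))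
      invFun := fun y => (y.1 • ν₁ + y.2.1 • ν₂, y.2.2)
      left_inv := fun x => by simp [frame_expansion h]
      right_inv := fun y => by
        obtain ⟨h11, h22, h12, h21⟩ := inner_frame h
        simp only [inner_add_left, real_inner_smul_left, h11, h22, h12, h21]
        simp
      continuous_toFun := by fun_prop
      continuous_invFun := by fun_prop }

lemma frameCoord_apply (h : Orthonormal ℝ ![ν₁, ν₂]) (x : Pt) :
    frameCoord h x = (⟪x.1, ν₁⟫, (⟪x.1, ν₂⟫, x.2)) := rfl

lemma frameCoord_symm_apply (h : Orthonormal ℝ ![ν₁, ν₂]) (y : ℝ × (ℝ × ℝ)) :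
    (frameCoord h).symm y = (y.1 • ν₁ + y.2.1 • ν₂, y.2.2) := rfl

lemma measurePreserving_frameCoord (h : Orthonormal ℝ ![ν₁, ν₂]) :
    MeasurePreserving (frameCoord h) := by
  have h1 : MeasurePreserving (fun x : Plane => (⟪x, ν₁⟫, ⟪x, ν₂⟫)) := by
    have := (volume_preserving_finTwoArrow ℝ).comp
      ((PiLp.volume_preserving_ofLp (Fin 2)).comp (frameBasis h).measurePreserving_repr)
    have e : (fun x : Plane => (⟪x, ν₁⟫, ⟪x, ν₂⟫)) =
        MeasurableEquiv.finTwoArrow ∘ WithLp.ofLp ∘ (frameBasis h).repr := by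
      funext x
      simp [OrthonormalBasis.repr_apply_apply, frameBasis_apply, real_inner_comm]
    rw [e]; exact this
  exact (volume_preserving_prodAssoc (α₁ := ℝ) (β₁ := ℝ) (γ₁ := ℝ)).comp
    (h1.prod (MeasurePreserving.id (volume : Measure ℝ)))

/-- The open interval `(-1/2, 1/2)` of the transversal variable. -/
def thickness : Set ℝ := Ioo (-(1 / 2) : ℝ) (1 / 2)

lemma measurableSet_thickness : MeasurableSet thickness := measurableSet_Ioo

/-- The cylinder over the rectangle of the points with `x_α·ν₁ ∈ (p₀, p₁)`, `x_α·ν₂ ∈ (q₀, q₁)`. -/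
def rect (ν₁ ν₂ : Plane) (p₀ p₁ q₀ q₁ : ℝ) : Set Pt :=
  {x : Plane | ⟪x, ν₁⟫ ∈ Ioo p₀ p₁ ∧ ⟪x, ν₂⟫ ∈ Ioo q₀ q₁} ×ˢ thickness

lemma mem_rect {p₀ p₁ q₀ q₁ : ℝ} {x : Pt} : x ∈ rect ν₁ ν₂ p₀ p₁ q₀ q₁ ↔
    (⟪x.1, ν₁⟫ ∈ Ioo p₀ p₁ ∧ ⟪x.1, ν₂⟫ ∈ Ioo q₀ q₁) ∧ x.2 ∈ thickness := Iff.rfl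

lemma isOpen_rect (p₀ p₁ q₀ q₁ : ℝ) : IsOpen (rect ν₁ ν₂ p₀ p₁ q₀ q₁) := by
  refine IsOpen.prod (IsOpen.inter ?_ ?_) isOpen_Ioo
  · exact isOpen_Ioo.preimage (by fun_prop : Continuous fun x : Plane => ⟪x, ν₁⟫)
  · exact isOpen_Ioo.preimage (by fun_prop : Continuous fun x : Plane => ⟪x, ν₂⟫)

lemma measurableSet_rect (p₀ p₁ q₀ q₁ : ℝ) : MeasurableSet (rect ν₁ ν₂ p₀ p₁ q₀ q₁) :=
  (isOpen_rect p₀ p₁ q₀ q₁).measurableSet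

lemma rect_eq_preimage (h : Orthonormal ℝ ![ν₁, ν₂]) (p₀ p₁ q₀ q₁ : ℝ) :
    rect ν₁ ν₂ p₀ p₁ q₀ q₁ = frameCoord h ⁻¹' (Ioo p₀ p₁ ×ˢ (Ioo q₀ q₁ ×ˢ thickness)) := by
  ext x
  simp [mem_rect, frameCoord_apply, and_assoc]

lemma rect_swap (p₀ p₁ q₀ q₁ : ℝ) : rect ν₁ ν₂ p₀ p₁ q₀ q₁ = rect ν₂ ν₁ q₀ q₁ p₀ p₁ := by
  ext x; simp only [mem_rect]; tauto

lemma rect_neg (p₀ p₁ q₀ q₁ : ℝ) :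
    rect ν₁ (-ν₂) p₀ p₁ (-q₁) (-q₀) = rect ν₁ ν₂ p₀ p₁ q₀ q₁ := by
  ext x; simp only [mem_rect, inner_neg_right, mem_Ioo, neg_lt_neg_iff]; tauto

lemma Orthonormal.frame_swap (h : Orthonormal ℝ ![ν₁, ν₂]) : Orthonormal ℝ ![ν₂, ν₁] := by
  have := h.comp (Equiv.swap (0 : Fin 2) 1) (Equiv.injective _)
  convert this using 1
  funext i; fin_cases i <;> simp

lemma volume_rect_lt_top (h : Orthonormal ℝ ![ν₁, ν₂]) (p₀ p₁ q₀ q₁ : ℝ) :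
    volume (rect ν₁ ν₂ p₀ p₁ q₀ q₁) < ⊤ := by
  rw [rect_eq_preimage h, (measurePreserving_frameCoord h).measure_preimage_equiv]
  simp only [Measure.volume_eq_prod, Measure.prod_prod, thickness, Real.volume_Ioo]
  exact ENNReal.mul_lt_top ENNReal.ofReal_lt_top
    (ENNReal.mul_lt_top ENNReal.ofReal_lt_top ENNReal.ofReal_lt_top)

lemma volume_level_eq_zero (h : Orthonormal ℝ ![ν₁, ν₂]) (q : ℝ) :
    volume {x : Pt | ⟪x.1, ν₂⟫ = q} = 0 := by
  have : {x : Pt | ⟪x.1, ν₂⟫ = q} = frameCoord h ⁻¹' (univ ×ˢ ({q} ×ˢ univ)) := by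
    ext x; simp [frameCoord_apply]
  rw [this, (measurePreserving_frameCoord h).measure_preimage_equiv]
  simp [Measure.volume_eq_prod, Measure.prod_prod]

/-- The integral of `F` over the part of the line `x_α·w = s` with `x_α·w' ∈ (r₀, r₁)`, times the
thickness. -/
def faceIntegral (w w' : Plane) (s r₀ r₁ : ℝ) (F : Pt → Target) : Target :=
  ∫ y in Ioo r₀ r₁ ×ˢ thickness, F (s • w + y.1 • w', y.2)

/-- The component `j` of `(w, 0) ∈ ℝ² × ℝ`. -/
def comp3 (w : Plane) (j : Fin 3) : ℝ := ![w 0, w 1, 0] j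

/-- The flux `∫ n_j F` through the lateral boundary of a rectangular cylinder, where `n` is the
outer unit normal. -/
def rectFlux (ν₁ ν₂ : Plane) (p₀ p₁ q₀ q₁ : ℝ) (j : Fin 3) (F : Pt → Target) : Target :=
  comp3 ν₁ j • (faceIntegral ν₁ ν₂ p₁ q₀ q₁ F - faceIntegral ν₁ ν₂ p₀ q₀ q₁ F) +
    comp3 ν₂ j • (faceIntegral ν₂ ν₁ q₁ p₀ p₁ F - faceIntegral ν₂ ν₁ q₀ p₀ p₁ F)

lemma rectFlux_swap (p₀ p₁ q₀ q₁ : ℝ) (j : Fin 3) (F : Pt → Target) :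
    rectFlux ν₁ ν₂ p₀ p₁ q₀ q₁ j F = rectFlux ν₂ ν₁ q₀ q₁ p₀ p₁ j F := add_comm _ _

lemma faceIntegral_neg_left (s r₀ r₁ : ℝ) (F : Pt → Target) :
    faceIntegral (-ν₂) ν₁ (-s) r₀ r₁ F = faceIntegral ν₂ ν₁ s r₀ r₁ F := by
  simp [faceIntegral]

lemma faceIntegral_neg_right (s r₀ r₁ : ℝ) (F : Pt → Target) :
    faceIntegral ν₁ (-ν₂) s (-r₁) (-r₀) F = faceIntegral ν₁ ν₂ s r₀ r₁ F := by
  have hmp : MeasurePreserving (Prod.map (fun r : ℝ => -r) (id : ℝ → ℝ)) :=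
    (Measure.measurePreserving_neg (volume : Measure ℝ)).prod (MeasurePreserving.id volume)
  have hemb : MeasurableEmbedding (Prod.map (fun r : ℝ => -r) (id : ℝ → ℝ)) :=
    ((MeasurableEquiv.neg ℝ).prodCongr (MeasurableEquiv.refl ℝ)).measurableEmbedding
  have := hmp.setIntegral_preimage_emb hemb (fun y => F (s • ν₁ + y.1 • -ν₂, y.2))
    (Ioo (-r₁) (-r₀) ×ˢ thickness)
  rw [faceIntegral, faceIntegral, ← this]
  have hs : Prod.map (fun r : ℝ => -r) (id : ℝ → ℝ) ⁻¹' Ioo (-r₁) (-r₀) ×ˢ thickness =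
      Ioo r₀ r₁ ×ˢ thickness := by
    ext y; simp only [mem_preimage, mem_prod, Prod.map_fst, Prod.map_snd, mem_Ioo, id,
      neg_lt_neg_iff]; tauto
  rw [hs]
  simp

lemma comp3_neg (w : Plane) (j : Fin 3) : comp3 (-w) j = -comp3 w j := by
  fin_cases j <;> simp [comp3]

lemma rectFlux_neg (p₀ p₁ q₀ q₁ : ℝ) (j : Fin 3) (F : Pt → Target) :
    rectFlux ν₁ (-ν₂) p₀ p₁ (-q₁) (-q₀) j F = rectFlux ν₁ ν₂ p₀ p₁ q₀ q₁ j F := by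
  simp only [rectFlux, faceIntegral_neg_left, faceIntegral_neg_right, comp3_neg]
  congr 1
  rw [neg_smul, ← smul_neg, neg_sub]

/-- Two functions agree on the four lateral faces of a rectangular cylinder; on those orthogonal to
`ν₂` this is required for almost every `p` only. -/
def EqOnFaces (ν₁ ν₂ : Plane) (p₀ p₁ q₀ q₁ : ℝ) (g g' : Pt → Target) : Prop :=
  (∀ q ∈ Ioo q₀ q₁, ∀ z, ∀ p ∈ ({p₀, p₁} : Set ℝ),
    g (p • ν₁ + q • ν₂, z) = g' (p • ν₁ + q • ν₂, z)) ∧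
  (∀ᵐ p, p ∈ Ioo p₀ p₁ → ∀ z, ∀ q ∈ ({q₀, q₁} : Set ℝ),
    g (p • ν₁ + q • ν₂, z) = g' (p • ν₁ + q • ν₂, z))

lemma faceIntegral_congr {w w' : Plane} {s r₀ r₁ : ℝ} {F F' : Pt → Target}
    (h : ∀ᵐ r, r ∈ Ioo r₀ r₁ → ∀ z, F (s • w + r • w', z) = F' (s • w + r • w', z)) :
    faceIntegral w w' s r₀ r₁ F = faceIntegral w w' s r₀ r₁ F' := by
  refine setIntegral_congr_ae (measurableSet_Ioo.prod measurableSet_Ioo) ?_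
  have h' : ∀ᵐ y : ℝ × ℝ, y.1 ∈ Ioo r₀ r₁ → ∀ z, F (s • w + y.1 • w', z) =
      F' (s • w + y.1 • w', z) := Measure.quasiMeasurePreserving_fst.ae h
  filter_upwards [h'] with y hy hmem
  exact hy hmem.1 y.2

lemma EqOnFaces.rectFlux_eq {p₀ p₁ q₀ q₁ : ℝ} {g g' : Pt → Target}
    (h : EqOnFaces ν₁ ν₂ p₀ p₁ q₀ q₁ g g') (φ : Pt → ℝ) (j : Fin 3) :
    rectFlux ν₁ ν₂ p₀ p₁ q₀ q₁ j (fun x => φ x • g x) =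
      rectFlux ν₁ ν₂ p₀ p₁ q₀ q₁ j (fun x => φ x • g' x) := by
  have e1 : ∀ p ∈ ({p₀, p₁} : Set ℝ), faceIntegral ν₁ ν₂ p q₀ q₁ (fun x => φ x • g x) =
      faceIntegral ν₁ ν₂ p q₀ q₁ (fun x => φ x • g' x) := fun p hp =>
    faceIntegral_congr (Eventually.of_forall fun r hr z => by rw [h.1 r hr z p hp])
  have e2 : ∀ q ∈ ({q₀, q₁} : Set ℝ), faceIntegral ν₂ ν₁ q p₀ p₁ (fun x => φ x • g x) =
      faceIntegral ν₂ ν₁ q p₀ p₁ (fun x => φ x • g' x) := fun q hq =>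
    faceIntegral_congr (h.2.mono fun r hr hmem z => by
      rw [add_comm, hr hmem z q hq])
  simp only [rectFlux]
  rw [e1 p₀ (by simp), e1 p₁ (by simp), e2 q₀ (by simp), e2 q₁ (by simp)]

/-- Bounded Borel functions. -/
def IsBddBorel (g : Pt → Target) : Prop := Measurable g ∧ ∃ C, ∀ x, ‖g x‖ ≤ C

/-- The test functions of the Gauss-Green formula with lateral trace: free on the lateral boundary,
and zero near the top and bottom faces. -/
structure IsTest (φ : Pt → ℝ) : Prop where
  smooth : ContDiff ℝ ∞ φ
  compact : HasCompactSupport φ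
  supp : tsupport φ ⊆ univ ×ˢ thickness

lemma IsTest.isBddBorel_smul {φ : Pt → ℝ} (hφ : IsTest φ) {g : Pt → Target} (hg : IsBddBorel g) :
    IsBddBorel fun x => φ x • g x := by
  obtain ⟨C, hC⟩ := hg.2
  obtain ⟨K, hK⟩ := hφ.compact.exists_bound_of_continuous hφ.smooth.continuous
  refine ⟨hφ.smooth.continuous.measurable.smul hg.1, K * C, fun x => ?_⟩
  rw [norm_smul]
  exact mul_le_mul (hK x) (hC x) (norm_nonneg _) ((norm_nonneg _).trans (hK x))

lemma IsBddBorel.integrableOn_face {F : Pt → Target} (hF : IsBddBorel F) (w w' : Plane)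
    (s r₀ r₁ : ℝ) :
    IntegrableOn (fun y : ℝ × ℝ => F (s • w + y.1 • w', y.2)) (Ioo r₀ r₁ ×ˢ thickness) := by
  obtain ⟨C, hC⟩ := hF.2
  refine Measure.integrableOn_of_bounded (M := C) ?_ ?_ (Eventually.of_forall fun y => hC _)
  · simp only [Measure.volume_eq_prod, Measure.prod_prod, thickness, Real.volume_Ioo]
    exact (ENNReal.mul_lt_top ENNReal.ofReal_lt_top ENNReal.ofReal_lt_top).ne
  · exact (hF.1.comp (by fun_prop)).aestronglyMeasurable

lemma faceIntegral_split {F : Pt → Target} (hF : IsBddBorel F) (w w' : Plane)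
    (s : ℝ) {r₀ r₁ r₂ : ℝ} (h01 : r₀ ≤ r₁) (h12 : r₁ ≤ r₂) :
    faceIntegral w w' s r₀ r₂ F = faceIntegral w w' s r₀ r₁ F + faceIntegral w w' s r₁ r₂ F := by
  have hae : ∀ u v : ℝ, (Ioo u v ×ˢ thickness : Set (ℝ × ℝ)) =ᵐ[volume] Ioc u v ×ˢ thickness :=
    fun u v => Measure.set_prod_ae_eq Ioo_ae_eq_Ioc .rfl
  simp only [faceIntegral]
  rw [setIntegral_congr_set (hae r₀ r₂), setIntegral_congr_set (hae r₀ r₁),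
    setIntegral_congr_set (hae r₁ r₂), ← Ioc_union_Ioc_eq_Ioc h01 h12, union_prod,
    setIntegral_union _ (measurableSet_Ioc.prod measurableSet_thickness)]
  · exact (hF.integrableOn_face w w' s r₀ r₁).congr_set_ae (hae _ _).symm
  · exact (hF.integrableOn_face w w' s r₁ r₂).congr_set_ae (hae _ _).symm
  · rw [Set.disjoint_prod]; left; exact Ioc_disjoint_Ioc_of_le le_rfl

end

/-! ### Minimal energies on rectangular cylinders -/

noncomputable section

variable {ν₁ ν₂ : Plane} {M : Set Target} {F : Pt → Mat33 → ℝ} {p₀ p₁ p₂ q₀ q₁ q₂ : ℝ}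
  {g g' : Pt → Target} {u : Pt → Target} {G : Pt → Mat33}

/-- `matCol` as a continuous linear map. -/
def matColL (j : Fin 3) : Mat33 →L[ℝ] Target :=
  LinearMap.toContinuousLinearMap
    { toFun := fun ξ => matCol ξ j
      map_add' := fun ξ η => by ext i; simp [matCol]
      map_smul' := fun c ξ => by ext i; simp [matCol] }

/-- The maps `u ∈ W^{1,1}(R; M)`, with weak gradient `G`, on a rectangular cylinder `R`, whose trace
on the lateral boundary is `g`. -/
structure RectAdm (M : Set Target) (ν₁ ν₂ : Plane) (p₀ p₁ q₀ q₁ : ℝ) (g : Pt → Target)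
    (u : Pt → Target) (G : Pt → Mat33) : Prop where
  integrable : IntegrableOn u (rect ν₁ ν₂ p₀ p₁ q₀ q₁)
  integrable_grad : IntegrableOn G (rect ν₁ ν₂ p₀ p₁ q₀ q₁)
  mem : ∀ᵐ x ∂(volume.restrict (rect ν₁ ν₂ p₀ p₁ q₀ q₁)), u x ∈ M
  trace : ∀ φ, IsTest φ → ∀ j : Fin 3,
    ∫ x in rect ν₁ ν₂ p₀ p₁ q₀ q₁, (partialDeriv φ j x • u x + φ x • matCol (G x) j) =
      rectFlux ν₁ ν₂ p₀ p₁ q₀ q₁ j fun x => φ x • g x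

/-- The infimum of the energies `∫_R F(y, ∇u) dy` of the maps `u ∈ W^{1,1}(R; M)` with lateral
trace `g`. -/
def rectEnergy (F : Pt → Mat33 → ℝ) (M : Set Target) (ν₁ ν₂ : Plane) (p₀ p₁ q₀ q₁ : ℝ)
    (g : Pt → Target) : ℝ≥0∞ :=
  ⨅ (p : (Pt → Target) × (Pt → Mat33)) (_ : RectAdm M ν₁ ν₂ p₀ p₁ q₀ q₁ g p.1 p.2),
    ∫⁻ y in rect ν₁ ν₂ p₀ p₁ q₀ q₁, ENNReal.ofReal (F y (p.2 y))

lemma rectEnergy_le (h : RectAdm M ν₁ ν₂ p₀ p₁ q₀ q₁ g u G) :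
    rectEnergy F M ν₁ ν₂ p₀ p₁ q₀ q₁ g ≤
      ∫⁻ y in rect ν₁ ν₂ p₀ p₁ q₀ q₁, ENNReal.ofReal (F y (G y)) :=
  iInf₂_le (u, G) h

lemma rectAdm_swap_iff : RectAdm M ν₁ ν₂ p₀ p₁ q₀ q₁ g u G ↔ RectAdm M ν₂ ν₁ q₀ q₁ p₀ p₁ g u G := by
  constructor
  all_goals
    rintro ⟨h1, h2, h3, h4⟩
    rw [rect_swap] at h1 h2 h3 h4
    refine ⟨h1, h2, h3, fun φ hφ j => ?_⟩
    rw [h4 φ hφ j, rectFlux_swap]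

lemma rectEnergy_swap : rectEnergy F M ν₁ ν₂ p₀ p₁ q₀ q₁ g =
    rectEnergy F M ν₂ ν₁ q₀ q₁ p₀ p₁ g := by
  simp only [rectEnergy, rectAdm_swap_iff (ν₁ := ν₁), rect_swap (ν₁ := ν₁)]

lemma rectAdm_neg_iff : RectAdm M ν₁ (-ν₂) p₀ p₁ (-q₁) (-q₀) g u G ↔
    RectAdm M ν₁ ν₂ p₀ p₁ q₀ q₁ g u G := by
  constructor
  · rintro ⟨h1, h2, h3, h4⟩
    rw [rect_neg] at h1 h2 h3 h4
    exact ⟨h1, h2, h3, fun φ hφ j => by rw [h4 φ hφ j, rectFlux_neg]⟩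
  · rintro ⟨h1, h2, h3, h4⟩
    constructor <;> rw [rect_neg]
    exacts [h1, h2, h3, fun φ hφ j => by rw [h4 φ hφ j, rectFlux_neg]]

lemma rectEnergy_neg : rectEnergy F M ν₁ (-ν₂) p₀ p₁ (-q₁) (-q₀) g =
    rectEnergy F M ν₁ ν₂ p₀ p₁ q₀ q₁ g := by
  simp only [rectEnergy, rectAdm_neg_iff, rect_neg]

lemma RectAdm.congr (h : RectAdm M ν₁ ν₂ p₀ p₁ q₀ q₁ g u G)
    (hg : EqOnFaces ν₁ ν₂ p₀ p₁ q₀ q₁ g g') : RectAdm M ν₁ ν₂ p₀ p₁ q₀ q₁ g' u G :=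
  ⟨h.integrable, h.integrable_grad, h.mem, fun φ hφ j => by
    rw [h.trace φ hφ j, hg.rectFlux_eq φ j]⟩

lemma EqOnFaces.symm (h : EqOnFaces ν₁ ν₂ p₀ p₁ q₀ q₁ g g') :
    EqOnFaces ν₁ ν₂ p₀ p₁ q₀ q₁ g' g :=
  ⟨fun q hq z p hp => (h.1 q hq z p hp).symm,
    h.2.mono fun _ hp hm z q hq => (hp hm z q hq).symm⟩

lemma rectEnergy_congr (hg : EqOnFaces ν₁ ν₂ p₀ p₁ q₀ q₁ g g') :
    rectEnergy F M ν₁ ν₂ p₀ p₁ q₀ q₁ g = rectEnergy F M ν₁ ν₂ p₀ p₁ q₀ q₁ g' :=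
  le_antisymm (le_iInf₂ fun _ h => rectEnergy_le (h.congr hg.symm))
    (le_iInf₂ fun _ h => rectEnergy_le (h.congr hg))

lemma IsTest.integrableOn {φ : Pt → ℝ} (hφ : IsTest φ) {S : Set Pt} (hu : IntegrableOn u S)
    (hG : IntegrableOn G S) (j : Fin 3) :
    IntegrableOn (fun x => partialDeriv φ j x • u x) S ∧
      IntegrableOn (fun x => φ x • matCol (G x) j) S := by
  have hd : Continuous (partialDeriv φ j) :=
    (hφ.smooth.continuous_fderiv (by simp)).clm_apply continuous_const
  have hdc : HasCompactSupport (partialDeriv φ j) := hφ.compact.fderiv_apply ℝ _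
  obtain ⟨K, hK⟩ := hdc.exists_bound_of_continuous hd
  obtain ⟨L, hL⟩ := hφ.compact.exists_bound_of_continuous hφ.smooth.continuous
  exact ⟨hu.bdd_smul K hd.aestronglyMeasurable (Eventually.of_forall hK),
    Integrable.bdd_smul ((matColL j).integrable_comp hG) L
      hφ.smooth.continuous.aestronglyMeasurable (Eventually.of_forall hL)⟩

lemma rect_ae_eq_union (h : Orthonormal ℝ ![ν₁, ν₂]) (h01 : q₀ ≤ q₁) (h12 : q₁ ≤ q₂) :
    rect ν₁ ν₂ p₀ p₁ q₀ q₂ =ᵐ[volume]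
      (rect ν₁ ν₂ p₀ p₁ q₀ q₁ ∪ rect ν₁ ν₂ p₀ p₁ q₁ q₂ : Set Pt) := by
  have hz : ∀ᵐ x : Pt, ⟪x.1, ν₂⟫ ≠ q₁ := by
    rw [ae_iff]; simpa using volume_level_eq_zero h q₁
  filter_upwards [hz] with x hx
  refine propext ?_
  change x ∈ rect _ _ _ _ _ _ ↔ x ∈ rect _ _ _ _ _ _ ∪ rect _ _ _ _ _ _
  simp only [mem_union, mem_rect, mem_Ioo]
  constructor
  · rintro ⟨⟨h1, h2⟩, h3⟩
    rcases lt_or_gt_of_ne hx with hlt | hgt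
    · exact Or.inl ⟨⟨h1, h2.1, hlt⟩, h3⟩
    · exact Or.inr ⟨⟨h1, hgt, h2.2⟩, h3⟩
  · rintro (⟨⟨h1, h2⟩, h3⟩ | ⟨⟨h1, h2⟩, h3⟩)
    · exact ⟨⟨h1, h2.1, by linarith⟩, h3⟩
    · exact ⟨⟨h1, by linarith, h2.2⟩, h3⟩

lemma disjoint_rect : Disjoint (rect ν₁ ν₂ p₀ p₁ q₀ q₁) (rect ν₁ ν₂ p₀ p₁ q₁ q₂) := by
  rw [Set.disjoint_left]
  intro x h1 h2
  exact absurd h1.1.2.2 (not_lt.2 h2.1.2.1.le)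

open Classical in
/-- Maps with the same trace on a common face can be glued: in the Gauss-Green formulas the
contributions of this face cancel. -/
lemma RectAdm.glue (h : Orthonormal ℝ ![ν₁, ν₂]) (h01 : q₀ ≤ q₁) (h12 : q₁ ≤ q₂)
    (hg : IsBddBorel g) {u₁ u₂ : Pt → Target} {G₁ G₂ : Pt → Mat33}
    (a₁ : RectAdm M ν₁ ν₂ p₀ p₁ q₀ q₁ g u₁ G₁) (a₂ : RectAdm M ν₁ ν₂ p₀ p₁ q₁ q₂ g u₂ G₂) :
    RectAdm M ν₁ ν₂ p₀ p₁ q₀ q₂ g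
      ((rect ν₁ ν₂ p₀ p₁ q₀ q₁).piecewise u₁ u₂) ((rect ν₁ ν₂ p₀ p₁ q₀ q₁).piecewise G₁ G₂) := by
  have hm1 := measurableSet_rect (ν₁ := ν₁) (ν₂ := ν₂) p₀ p₁ q₀ q₁
  have hm2 := measurableSet_rect (ν₁ := ν₁) (ν₂ := ν₂) p₀ p₁ q₁ q₂
  have hR := rect_ae_eq_union (p₀ := p₀) (p₁ := p₁) h h01 h12
  have hdis := disjoint_rect (ν₁ := ν₁) (ν₂ := ν₂) (p₀ := p₀) (p₁ := p₁) (q₀ := q₀) (q₁ := q₁)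
    (q₂ := q₂)
  set R₁ := rect ν₁ ν₂ p₀ p₁ q₀ q₁
  set R₂ := rect ν₁ ν₂ p₀ p₁ q₁ q₂
  set u := R₁.piecewise u₁ u₂
  set G := R₁.piecewise G₁ G₂
  have eu1 : EqOn u u₁ R₁ := piecewise_eqOn _ _ _
  have eG1 : EqOn G G₁ R₁ := piecewise_eqOn _ _ _
  have eu2 : EqOn u u₂ R₂ := (piecewise_eqOn_compl _ _ _).mono hdis.symm.subset_compl_right
  have eG2 : EqOn G G₂ R₂ := (piecewise_eqOn_compl _ _ _).mono hdis.symm.subset_compl_right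
  have iu1 : IntegrableOn u R₁ := a₁.integrable.congr_fun eu1.symm hm1
  have iu2 : IntegrableOn u R₂ := a₂.integrable.congr_fun eu2.symm hm2
  have iG1 : IntegrableOn G R₁ := a₁.integrable_grad.congr_fun eG1.symm hm1
  have iG2 : IntegrableOn G R₂ := a₂.integrable_grad.congr_fun eG2.symm hm2
  refine ⟨(iu1.union iu2).congr_set_ae hR, (iG1.union iG2).congr_set_ae hR, ?_, fun φ hφ j => ?_⟩
  · rw [Measure.restrict_congr_set hR, ae_restrict_union_iff]
    constructor
    · filter_upwards [a₁.mem, ae_restrict_mem hm1] with x hx hxR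
      rwa [eu1 hxR]
    · filter_upwards [a₂.mem, ae_restrict_mem hm2] with x hx hxR
      rwa [eu2 hxR]
  · have i1 := hφ.integrableOn iu1 iG1 j
    have i2 := hφ.integrableOn iu2 iG2 j
    have hsum : ∫ x in R₁ ∪ R₂, (partialDeriv φ j x • u x + φ x • matCol (G x) j) =
        (∫ x in R₁, (partialDeriv φ j x • u x + φ x • matCol (G x) j)) +
          ∫ x in R₂, (partialDeriv φ j x • u x + φ x • matCol (G x) j) :=
      setIntegral_union hdis hm2 (i1.1.add i1.2) (i2.1.add i2.2)
    rw [setIntegral_congr_set hR, hsum]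
    have e1 : ∫ x in R₁, (partialDeriv φ j x • u x + φ x • matCol (G x) j) =
        ∫ x in R₁, (partialDeriv φ j x • u₁ x + φ x • matCol (G₁ x) j) :=
      setIntegral_congr_fun hm1 fun x hx => by simp only [eu1 hx, eG1 hx]
    have e2 : ∫ x in R₂, (partialDeriv φ j x • u x + φ x • matCol (G x) j) =
        ∫ x in R₂, (partialDeriv φ j x • u₂ x + φ x • matCol (G₂ x) j) :=
      setIntegral_congr_fun hm2 fun x hx => by simp only [eu2 hx, eG2 hx]
    rw [e1, e2, a₁.trace φ hφ j, a₂.trace φ hφ j]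
    have hb := hφ.isBddBorel_smul hg
    simp only [rectFlux]
    rw [faceIntegral_split hb ν₁ ν₂ p₁ h01 h12, faceIntegral_split hb ν₁ ν₂ p₀ h01 h12]
    module

lemma rectEnergy_split_right (h : Orthonormal ℝ ![ν₁, ν₂]) (hg : IsBddBorel g) (h01 : q₀ ≤ q₁)
    (h12 : q₁ ≤ q₂) :
    rectEnergy F M ν₁ ν₂ p₀ p₁ q₀ q₂ g ≤
      rectEnergy F M ν₁ ν₂ p₀ p₁ q₀ q₁ g + rectEnergy F M ν₁ ν₂ p₀ p₁ q₁ q₂ g := by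
  classical
  have hm1 := measurableSet_rect (ν₁ := ν₁) (ν₂ := ν₂) p₀ p₁ q₀ q₁
  have hm2 := measurableSet_rect (ν₁ := ν₁) (ν₂ := ν₂) p₀ p₁ q₁ q₂
  rw [rectEnergy, rectEnergy, rectEnergy]
  simp only [ENNReal.iInf_add, ENNReal.add_iInf]
  refine le_iInf₂ fun y hy => le_iInf₂ fun x hx => ?_
  refine (rectEnergy_le (hx.glue h h01 h12 hg hy)).trans_eq ?_
  rw [setLIntegral_congr (rect_ae_eq_union h h01 h12), lintegral_union hm2 disjoint_rect]
  congr 1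
  · exact setLIntegral_congr_fun hm1 fun z hz => by simp only [piecewise_eq_of_mem _ _ _ hz]
  · refine setLIntegral_congr_fun hm2 fun z hz => ?_
    simp only [piecewise_eq_of_notMem _ _ _ (disjoint_rect.notMem_of_mem_right hz)]

lemma rectEnergy_split_left (h : Orthonormal ℝ ![ν₁, ν₂]) (hg : IsBddBorel g) (h01 : p₀ ≤ p₁)
    (h12 : p₁ ≤ p₂) :
    rectEnergy F M ν₁ ν₂ p₀ p₂ q₀ q₁ g ≤
      rectEnergy F M ν₁ ν₂ p₀ p₁ q₀ q₁ g + rectEnergy F M ν₁ ν₂ p₁ p₂ q₀ q₁ g := by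
  simp only [rectEnergy_swap (ν₁ := ν₁)]
  exact rectEnergy_split_right h.frame_swap hg h01 h12

lemma faceIntegral_shift (h : Orthonormal ℝ ![ν₁, ν₂]) (z : Plane) (s r₀ r₁ : ℝ)
    (Q : Pt → Target) :
    faceIntegral ν₁ ν₂ (s + ⟪z, ν₁⟫) (r₀ + ⟪z, ν₂⟫) (r₁ + ⟪z, ν₂⟫) Q =
      faceIntegral ν₁ ν₂ s r₀ r₁ fun x => Q (x.1 + z, x.2) := by
  have hmp : MeasurePreserving (Prod.map (fun r : ℝ => r + ⟪z, ν₂⟫) (id : ℝ → ℝ)) :=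
    (measurePreserving_add_right (volume : Measure ℝ) _).prod (MeasurePreserving.id volume)
  have hemb : MeasurableEmbedding (Prod.map (fun r : ℝ => r + ⟪z, ν₂⟫) (id : ℝ → ℝ)) :=
    ((MeasurableEquiv.addRight ⟪z, ν₂⟫).prodCongr (MeasurableEquiv.refl ℝ)).measurableEmbedding
  have := hmp.setIntegral_preimage_emb hemb
    (fun y => Q ((s + ⟪z, ν₁⟫) • ν₁ + y.1 • ν₂, y.2))
    (Ioo (r₀ + ⟪z, ν₂⟫) (r₁ + ⟪z, ν₂⟫) ×ˢ thickness)
  rw [faceIntegral, faceIntegral, ← this]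
  have hs : Prod.map (fun r : ℝ => r + ⟪z, ν₂⟫) (id : ℝ → ℝ) ⁻¹'
      Ioo (r₀ + ⟪z, ν₂⟫) (r₁ + ⟪z, ν₂⟫) ×ˢ thickness = Ioo r₀ r₁ ×ˢ thickness := by
    ext y; simp
  rw [hs]
  congr 1
  funext y
  simp only [Prod.map_fst, Prod.map_snd, id]
  congr 2
  conv_rhs => rw [← frame_expansion h z]
  module

/-- Invariance under translations that preserve the integrand. -/
lemma rectEnergy_shift_le (h : Orthonormal ℝ ![ν₁, ν₂]) {z : Plane}
    (hF : ∀ x ξ, F (x.1 + z, x.2) ξ = F x ξ) :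
    rectEnergy F M ν₁ ν₂ (p₀ + ⟪z, ν₁⟫) (p₁ + ⟪z, ν₁⟫) (q₀ + ⟪z, ν₂⟫) (q₁ + ⟪z, ν₂⟫)
      (fun x => g (x.1 - z, x.2)) ≤ rectEnergy F M ν₁ ν₂ p₀ p₁ q₀ q₁ g := by
  have hmp : MeasurePreserving (fun x : Pt => x + (z, 0)) :=
    (measurePreserving_add_right (volume : Measure Plane) z).prod
      (measurePreserving_add_right (volume : Measure ℝ) 0)
  have hemb : MeasurableEmbedding (fun x : Pt => x + (z, 0)) :=
    (MeasurableEquiv.addRight ((z, 0) : Pt)).measurableEmbedding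
  set R := rect ν₁ ν₂ p₀ p₁ q₀ q₁ with hR
  set R' := rect ν₁ ν₂ (p₀ + ⟪z, ν₁⟫) (p₁ + ⟪z, ν₁⟫) (q₀ + ⟪z, ν₂⟫) (q₁ + ⟪z, ν₂⟫) with hR'
  have hpre : (fun x : Pt => x + (z, 0)) ⁻¹' R' = R := by
    ext x; simp [hR, hR', mem_rect, inner_add_left]
  refine le_iInf₂ fun p hp => ?_
  obtain ⟨u, G⟩ := p
  have hint : ∀ {E : Type} [NormedAddCommGroup E] {v : Pt → E}, IntegrableOn v R →
      IntegrableOn (fun x => v (x - (z, 0))) R' := fun hv => by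
    rw [← hmp.integrableOn_comp_preimage hemb, hpre]
    simpa [Function.comp_def] using hv
  have hadm : RectAdm M ν₁ ν₂ (p₀ + ⟪z, ν₁⟫) (p₁ + ⟪z, ν₁⟫) (q₀ + ⟪z, ν₂⟫) (q₁ + ⟪z, ν₂⟫)
      (fun x => g (x.1 - z, x.2)) (fun x => u (x - (z, 0))) (fun x => G (x - (z, 0))) := by
    refine ⟨hint hp.integrable, hint hp.integrable_grad, ?_, fun φ hφ j => ?_⟩
    · have hmp' := hmp.restrict_preimage_emb hemb R'
      rw [hpre] at hmp'
      rw [← hR', ← hmp'.map_eq, hemb.ae_map_iff]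
      simpa using hp.mem
    · have hφ' : IsTest fun x => φ (x + (z, 0)) := by
        refine ⟨hφ.smooth.comp (by fun_prop), ?_, ?_⟩
        · exact hφ.compact.comp_homeomorph (Homeomorph.addRight ((z, 0) : Pt))
        · intro x hx
          have := hφ.supp (tsupport_comp_subset_preimage φ
            (by fun_prop : Continuous fun x : Pt => x + (z, 0)) hx)
          simpa using this
      have ht := hp.trace _ hφ' j
      rw [← hR', ← hmp.setIntegral_preimage_emb hemb, hpre]
      have hd : ∀ x, partialDeriv (fun x => φ (x + (z, 0))) j x = partialDeriv φ j (x + (z, 0)) :=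
        fun x => by simp only [partialDeriv]; rw [fderiv_comp_add_right]
      simp only [add_sub_cancel_right]
      simp only [hd] at ht
      rw [ht]
      simp only [rectFlux]
      rw [faceIntegral_shift h, faceIntegral_shift h, faceIntegral_shift h.frame_swap,
        faceIntegral_shift h.frame_swap]
      simp [Prod.add_def]
  refine (rectEnergy_le hadm).trans_eq ?_
  rw [← hR', ← hmp.setLIntegral_comp_preimage_emb hemb, hpre]
  refine setLIntegral_congr_fun (measurableSet_rect _ _ _ _) fun x _ => ?_
  simp only [add_sub_cancel_right]
  rw [show x + (z, (0:ℝ)) = (x.1 + z, x.2) by simp [Prod.add_def], hF]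

end

/-! ### The Gauss-Green formula for planar functions -/

noncomputable section

variable {ν₁ ν₂ : Plane} {M : Set Target} {F : Pt → Mat33 → ℝ} {p₀ p₁ q₀ q₁ : ℝ}
  {v vp vq : ℝ → ℝ → Target}

/-- A function of the coordinates `x_α·ν₁` and `x_α·ν₂` as a function of `x`. -/
def planar (ν₁ ν₂ : Plane) {E : Type*} (v : ℝ → ℝ → E) (x : Pt) : E := v ⟪x.1, ν₁⟫ ⟪x.1, ν₂⟫

lemma planar_frame (h : Orthonormal ℝ ![ν₁, ν₂]) {E : Type*} (v : ℝ → ℝ → E) (p q z : ℝ) :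
    planar ν₁ ν₂ v (p • ν₁ + q • ν₂, z) = v p q := by
  obtain ⟨h11, h22, h12, h21⟩ := inner_frame h
  simp only [planar, inner_add_left, real_inner_smul_left, h11, h22, h12, h21]
  simp

/-- On almost every line parallel to the first axis, `v` is continuous up to the end points and
differentiable between them, with derivative `vp`. -/
def HasLineDerivAE (p₀ p₁ q₀ q₁ : ℝ) (v vp : ℝ → ℝ → Target) : Prop :=
  ∀ᵐ q, q ∈ Ioo q₀ q₁ → ContinuousOn (fun p => v p q) (Icc p₀ p₁) ∧
    ∀ p ∈ Ioo p₀ p₁, HasDerivAt (fun p => v p q) (vp p q) p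

lemma volume_thickness : volume thickness = 1 := by
  simp [thickness]; norm_num

lemma isFiniteMeasure_thickness : IsFiniteMeasure (volume.restrict thickness) :=
  ⟨by simp [volume_thickness]⟩

lemma integrableOn_planar (h : Orthonormal ℝ ![ν₁, ν₂]) {E : Type*} [NormedAddCommGroup E]
    {w : ℝ → ℝ → E}
    (hw : IntegrableOn (fun y : ℝ × ℝ => w y.1 y.2) (Ioo p₀ p₁ ×ˢ Ioo q₀ q₁)) :
    IntegrableOn (planar ν₁ ν₂ w) (rect ν₁ ν₂ p₀ p₁ q₀ q₁) := by
  have := isFiniteMeasure_thickness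
  have h1 : IntegrableOn (fun y : (ℝ × ℝ) × ℝ => w y.1.1 y.1.2)
      ((Ioo p₀ p₁ ×ˢ Ioo q₀ q₁) ×ˢ thickness) := by
    have := Integrable.comp_fst hw (volume.restrict thickness)
    rwa [Measure.prod_restrict] at this
  have hmp : MeasurePreserving (MeasurableEquiv.prodAssoc (α := ℝ) (β := ℝ) (γ := ℝ)).symm :=
    (volume_preserving_prodAssoc (α₁ := ℝ) (β₁ := ℝ) (γ₁ := ℝ)).symm
  rw [← (hmp.comp (measurePreserving_frameCoord h)).integrableOn_comp_preimage
    ((MeasurableEquiv.prodAssoc (α := ℝ) (β := ℝ) (γ := ℝ)).symm.measurableEmbedding.comp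
      (frameCoord h).measurableEmbedding)] at h1
  have hs : (⇑(MeasurableEquiv.prodAssoc (α := ℝ) (β := ℝ) (γ := ℝ)).symm ∘ ⇑(frameCoord h)) ⁻¹'
      ((Ioo p₀ p₁ ×ˢ Ioo q₀ q₁) ×ˢ thickness) = rect ν₁ ν₂ p₀ p₁ q₀ q₁ := by
    ext x; simp [mem_rect, frameCoord_apply, MeasurableEquiv.prodAssoc]
  rw [hs] at h1
  exact h1

lemma lintegral_planar (h : Orthonormal ℝ ![ν₁, ν₂]) {w : ℝ → ℝ → ℝ≥0∞}
    (hw : Measurable fun y : ℝ × ℝ => w y.1 y.2) :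
    ∫⁻ x in rect ν₁ ν₂ p₀ p₁ q₀ q₁, planar ν₁ ν₂ w x =
      ∫⁻ y in Ioo p₀ p₁ ×ˢ Ioo q₀ q₁, w y.1 y.2 := by
  have := isFiniteMeasure_thickness
  have hmp : MeasurePreserving (MeasurableEquiv.prodAssoc (α := ℝ) (β := ℝ) (γ := ℝ)).symm :=
    (volume_preserving_prodAssoc (α₁ := ℝ) (β₁ := ℝ) (γ₁ := ℝ)).symm
  have h1 := (hmp.comp (measurePreserving_frameCoord h)).setLIntegral_comp_preimage_emb
    ((MeasurableEquiv.prodAssoc (α := ℝ) (β := ℝ) (γ := ℝ)).symm.measurableEmbedding.comp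
      (frameCoord h).measurableEmbedding) (fun y => w y.1.1 y.1.2)
      ((Ioo p₀ p₁ ×ˢ Ioo q₀ q₁) ×ˢ thickness)
  have hs : (⇑(MeasurableEquiv.prodAssoc (α := ℝ) (β := ℝ) (γ := ℝ)).symm ∘ ⇑(frameCoord h)) ⁻¹'
      ((Ioo p₀ p₁ ×ˢ Ioo q₀ q₁) ×ˢ thickness) = rect ν₁ ν₂ p₀ p₁ q₀ q₁ := by
    ext x; simp [mem_rect, frameCoord_apply, MeasurableEquiv.prodAssoc]
  rw [hs] at h1
  refine h1.trans ?_
  rw [Measure.volume_eq_prod (ℝ × ℝ) ℝ, ← Measure.prod_restrict,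
    lintegral_prod (fun y : (ℝ × ℝ) × ℝ => w y.1.1 y.1.2) ((hw.comp measurable_fst).aemeasurable)]
  simp [volume_thickness]

lemma planar_isBddBorel {C : ℝ} (hv : Measurable fun y : ℝ × ℝ => v y.1 y.2)
    (hb : ∀ p q, ‖v p q‖ ≤ C) : IsBddBorel (planar ν₁ ν₂ v) :=
  ⟨hv.comp (by fun_prop : Measurable fun x : Pt => (⟪x.1, ν₁⟫, ⟪x.1, ν₂⟫)), C, fun x => hb _ _⟩

lemma IsBddBorel.integrableOn_rect {g : Pt → Target} (hg : IsBddBorel g)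
    (h : Orthonormal ℝ ![ν₁, ν₂]) : IntegrableOn g (rect ν₁ ν₂ p₀ p₁ q₀ q₁) := by
  obtain ⟨C, hC⟩ := hg.2
  exact Measure.integrableOn_of_bounded (M := C) (volume_rect_lt_top h _ _ _ _).ne
    hg.1.aestronglyMeasurable (Eventually.of_forall hC)

lemma IsTest.integrable_fderiv {φ : Pt → ℝ} (hφ : IsTest φ) (w : Pt) {u : Pt → Target}
    {S : Set Pt} (hu : IntegrableOn u S) : IntegrableOn (fun x => fderiv ℝ φ x w • u x) S := by
  have hd : Continuous fun x => fderiv ℝ φ x w :=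
    (hφ.smooth.continuous_fderiv (by simp)).clm_apply continuous_const
  have hdc : HasCompactSupport fun x => fderiv ℝ φ x w := hφ.compact.fderiv_apply ℝ _
  obtain ⟨K, hK⟩ := hdc.exists_bound_of_continuous hd
  exact hu.bdd_smul K hd.aestronglyMeasurable (Eventually.of_forall hK)

lemma IsTest.integrable_smul {φ : Pt → ℝ} (hφ : IsTest φ) {u : Pt → Target}
    {S : Set Pt} (hu : IntegrableOn u S) : IntegrableOn (fun x => φ x • u x) S := by
  obtain ⟨K, hK⟩ := hφ.compact.exists_bound_of_continuous hφ.smooth.continuous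
  exact hu.bdd_smul K hφ.smooth.continuous.aestronglyMeasurable (Eventually.of_forall hK)

/-- The Gauss-Green formula in the direction `ν₁`: Fubini, and the fundamental theorem of calculus
on almost every line. -/
lemma integral_frame_direction (h : Orthonormal ℝ ![ν₁, ν₂]) (hp : p₀ ≤ p₁) {C : ℝ}
    (hv : Measurable fun y : ℝ × ℝ => v y.1 y.2) (hb : ∀ p q, ‖v p q‖ ≤ C)
    (hl : HasLineDerivAE p₀ p₁ q₀ q₁ v vp)
    (hvp : IntegrableOn (fun y : ℝ × ℝ => vp y.1 y.2) (Ioo p₀ p₁ ×ˢ Ioo q₀ q₁))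
    {φ : Pt → ℝ} (hφ : IsTest φ) :
    ∫ x in rect ν₁ ν₂ p₀ p₁ q₀ q₁,
        (fderiv ℝ φ x (ν₁, 0) • planar ν₁ ν₂ v x + φ x • planar ν₁ ν₂ vp x) =
      faceIntegral ν₁ ν₂ p₁ q₀ q₁ (fun x => φ x • planar ν₁ ν₂ v x) -
        faceIntegral ν₁ ν₂ p₀ q₀ q₁ (fun x => φ x • planar ν₁ ν₂ v x) := by
  have hvb : IsBddBorel (planar ν₁ ν₂ v) := planar_isBddBorel hv hb
  obtain ⟨H, hH⟩ : ∃ H : Pt → Target, H = fun x =>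
      fderiv ℝ φ x (ν₁, 0) • planar ν₁ ν₂ v x + φ x • planar ν₁ ν₂ vp x := ⟨_, rfl⟩
  have hHi : IntegrableOn H (rect ν₁ ν₂ p₀ p₁ q₀ q₁) := by
    rw [hH]
    exact (hφ.integrable_fderiv _ (hvb.integrableOn_rect h)).add
      (hφ.integrable_smul (integrableOn_planar h hvp))
  have hmp := (measurePreserving_frameCoord h).symm
  have hemb := (frameCoord h).symm.measurableEmbedding
  have hpre : (frameCoord h).symm ⁻¹' (rect ν₁ ν₂ p₀ p₁ q₀ q₁) =
      Ioo p₀ p₁ ×ˢ (Ioo q₀ q₁ ×ˢ thickness) := by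
    rw [rect_eq_preimage h, ← preimage_comp]; simp
  rw [← hH, ← hmp.setIntegral_preimage_emb hemb, hpre]
  rw [← hmp.integrableOn_comp_preimage hemb, hpre, IntegrableOn, Measure.volume_eq_prod,
    ← Measure.prod_restrict] at hHi
  rw [Measure.volume_eq_prod, ← Measure.prod_restrict,
    integral_prod_symm (fun y => H ((frameCoord h).symm y)) hHi]
  have hae : ∀ᵐ y ∂((volume : Measure (ℝ × ℝ)).restrict (Ioo q₀ q₁ ×ˢ thickness)),
      ∫ p, H ((frameCoord h).symm (p, y)) ∂(volume.restrict (Ioo p₀ p₁)) =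
        φ (p₁ • ν₁ + y.1 • ν₂, y.2) • planar ν₁ ν₂ v (p₁ • ν₁ + y.1 • ν₂, y.2) -
          φ (p₀ • ν₁ + y.1 • ν₂, y.2) • planar ν₁ ν₂ v (p₀ • ν₁ + y.1 • ν₂, y.2) := by
    have hl' : ∀ᵐ y : ℝ × ℝ, y.1 ∈ Ioo q₀ q₁ → ContinuousOn (fun p => v p y.1) (Icc p₀ p₁) ∧
        ∀ p ∈ Ioo p₀ p₁, HasDerivAt (fun p => v p y.1) (vp p y.1) p :=
      Measure.quasiMeasurePreserving_fst.ae hl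
    filter_upwards [hHi.prod_left_ae, ae_restrict_of_ae hl',
      ae_restrict_mem (measurableSet_Ioo.prod measurableSet_thickness)] with y hyi hy hmem
    obtain ⟨hc, hd⟩ := hy hmem.1
    have hline : ∀ p : ℝ, HasDerivAt (fun p : ℝ => ((p • ν₁ + y.1 • ν₂, y.2) : Pt)) (ν₁, 0) p :=
      fun p => by
        have h1 : HasDerivAt (fun p : ℝ => p • ν₁ + y.1 • ν₂) ν₁ p := by
          simpa using ((hasDerivAt_id p).smul_const ν₁).add_const (y.1 • ν₂)
        exact h1.prodMk (hasDerivAt_const p y.2)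
    have hφd : ∀ p : ℝ, HasDerivAt (fun p : ℝ => φ (p • ν₁ + y.1 • ν₂, y.2))
        (fderiv ℝ φ (p • ν₁ + y.1 • ν₂, y.2) (ν₁, 0)) p := fun p =>
      ((hφ.smooth.differentiable (by simp)) _).hasFDerivAt.comp_hasDerivAt p (hline p)
    have hval : ∀ p, H ((frameCoord h).symm (p, y)) =
        φ (p • ν₁ + y.1 • ν₂, y.2) • vp p y.1 +
          fderiv ℝ φ (p • ν₁ + y.1 • ν₂, y.2) (ν₁, 0) • v p y.1 := fun p => by
      rw [hH, frameCoord_symm_apply]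
      simp only [planar_frame h]
      rw [add_comm]
    simp only [planar_frame h]
    rw [← intervalIntegral.integral_eq_sub_of_hasDerivAt_of_le
      (f := fun p => φ (p • ν₁ + y.1 • ν₂, y.2) • v p y.1)
      (f' := fun p => H ((frameCoord h).symm (p, y))) hp,
      intervalIntegral.integral_of_le hp, integral_Ioc_eq_integral_Ioo]
    · exact ContinuousOn.smul (f := fun p : ℝ => φ (p • ν₁ + y.1 • ν₂, y.2))
        (continuous_iff_continuousAt.2 fun p => (hφd p).continuousAt).continuousOn hc
    · intro p hpm
      rw [hval]
      exact (hφd p).smul (hd p hpm)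
    · rw [intervalIntegrable_iff_integrableOn_Ioo_of_le hp]
      exact hyi
  rw [integral_congr_ae hae, integral_sub]
  · rfl
  · exact (hφ.isBddBorel_smul hvb).integrableOn_face ν₁ ν₂ p₁ q₀ q₁
  · exact (hφ.isBddBorel_smul hvb).integrableOn_face ν₁ ν₂ p₀ q₀ q₁

lemma integral_transversal_direction (h : Orthonormal ℝ ![ν₁, ν₂]) {C : ℝ}
    (hv : Measurable fun y : ℝ × ℝ => v y.1 y.2) (hb : ∀ p q, ‖v p q‖ ≤ C)
    {φ : Pt → ℝ} (hφ : IsTest φ) :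
    ∫ x in rect ν₁ ν₂ p₀ p₁ q₀ q₁, fderiv ℝ φ x (0, 1) • planar ν₁ ν₂ v x = 0 := by
  have hvb : IsBddBorel (planar ν₁ ν₂ v) := planar_isBddBorel hv hb
  have hi := hφ.integrable_fderiv (0, 1) (hvb.integrableOn_rect h (p₀ := p₀) (p₁ := p₁) (q₀ := q₀)
    (q₁ := q₁))
  rw [rect] at hi ⊢
  rw [IntegrableOn, Measure.volume_eq_prod, ← Measure.prod_restrict] at hi
  rw [Measure.volume_eq_prod, ← Measure.prod_restrict, integral_prod _ hi]
  refine integral_eq_zero_of_ae (Eventually.of_forall fun x => ?_)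
  change ∫ z, fderiv ℝ φ (x, z) (0, 1) • v ⟪x, ν₁⟫ ⟪x, ν₂⟫ ∂_ = 0
  rw [integral_smul_const]
  have hφd : ∀ z : ℝ, HasDerivAt (fun z : ℝ => φ (x, z)) (fderiv ℝ φ (x, z) (0, 1)) z := fun z =>
    ((hφ.smooth.differentiable (by simp)) _).hasFDerivAt.comp_hasDerivAt z
      ((hasDerivAt_const z x).prodMk (hasDerivAt_id z))
  have hz : ∀ z : ℝ, z ∉ thickness → φ (x, z) = 0 := fun z hz =>
    image_eq_zero_of_notMem_tsupport fun hm => hz (hφ.supp hm).2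
  have hcont : Continuous fun z : ℝ => fderiv ℝ φ (x, z) (0, 1) :=
    ((hφ.smooth.continuous_fderiv (by simp)).clm_apply continuous_const).comp (by fun_prop)
  have := intervalIntegral.integral_eq_sub_of_hasDerivAt (a := -(1 / 2)) (b := 1 / 2)
    (fun z _ => hφd z) (hcont.intervalIntegrable _ _)
  rw [hz (1 / 2) (by simp [thickness]), hz (-(1 / 2)) (by simp [thickness]), sub_zero,
    intervalIntegral.integral_of_le (by norm_num), integral_Ioc_eq_integral_Ioo] at this
  rw [thickness, this, zero_smul]

/-- The matrix `y ⊗ (w, 0)`. -/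
def tens (w : Plane) (y : Target) : Mat33 := WithLp.toLp 2 fun ij => comp3 w ij.2 * y ij.1

lemma matCol_tens (w : Plane) (y : Target) (j : Fin 3) : matCol (tens w y) j = comp3 w j • y := by
  ext i; simp [matCol, tens]

lemma matCol_add (ξ η : Mat33) (j : Fin 3) : matCol (ξ + η) j = matCol ξ j + matCol η j :=
  (matColL j).map_add ξ η

lemma norm_tens (w : Plane) (y : Target) : ‖tens w y‖ = ‖w‖ * ‖y‖ := by
  rw [EuclideanSpace.norm_eq, EuclideanSpace.norm_eq, EuclideanSpace.norm_eq,
    ← Real.sqrt_mul (Finset.sum_nonneg fun i _ => sq_nonneg _)]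
  congr 1
  simp only [Fintype.sum_prod_type, Fin.sum_univ_three, Fin.sum_univ_two, tens, comp3,
    Real.norm_eq_abs, sq_abs]
  simp
  ring

lemma continuous_tens (w : Plane) : Continuous (tens w) := by
  unfold tens
  fun_prop

lemma integrable_tens {α : Type*} [MeasurableSpace α] {μ : Measure α} {y : α → Target}
    (hy : Integrable y μ) (w : Plane) : Integrable (fun x => tens w (y x)) μ :=
  (hy.norm.const_mul ‖w‖).mono' ((continuous_tens w).comp_aestronglyMeasurable hy.1)
    (Eventually.of_forall fun x => (norm_tens w (y x)).le)

lemma partialDeriv_eq_frame (h : Orthonormal ℝ ![ν₁, ν₂]) (φ : Pt → ℝ) (x : Pt) {j : Fin 3}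
    (hj : j ≠ 2) : partialDeriv φ j x =
      comp3 ν₁ j * fderiv ℝ φ x (ν₁, 0) + comp3 ν₂ j * fderiv ℝ φ x (ν₂, 0) := by
  have hb : basisVec j = comp3 ν₁ j • ((ν₁, 0) : Pt) + comp3 ν₂ j • ((ν₂, 0) : Pt) := by
    have key : ∀ i : Fin 2, (EuclideanSpace.single i 1 : Plane) = ν₁ i • ν₁ + ν₂ i • ν₂ := by
      intro i
      conv_lhs => rw [← frame_expansion h (EuclideanSpace.single i 1)]
      simp [EuclideanSpace.inner_single_left]
    fin_cases j
    · simp [basisVec, comp3, key 0]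
    · simp [basisVec, comp3, key 1]
    · exact absurd rfl hj
  rw [partialDeriv, hb, map_add, map_smul, map_smul, smul_eq_mul, smul_eq_mul]

/-- Planar functions that are differentiable on almost every line parallel to the axes, with
integrable derivatives, are Sobolev maps, and are their own traces. -/
lemma rectAdm_planar (h : Orthonormal ℝ ![ν₁, ν₂]) (hp : p₀ ≤ p₁) (hq : q₀ ≤ q₁) {C : ℝ}
    (hv : Measurable fun y : ℝ × ℝ => v y.1 y.2) (hb : ∀ p q, ‖v p q‖ ≤ C)
    (hM : ∀ p q, v p q ∈ M)
    (hl₁ : HasLineDerivAE p₀ p₁ q₀ q₁ v vp)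
    (hl₂ : HasLineDerivAE q₀ q₁ p₀ p₁ (fun q p => v p q) fun q p => vq p q)
    (hvp : IntegrableOn (fun y : ℝ × ℝ => vp y.1 y.2) (Ioo p₀ p₁ ×ˢ Ioo q₀ q₁))
    (hvq : IntegrableOn (fun y : ℝ × ℝ => vq y.1 y.2) (Ioo p₀ p₁ ×ˢ Ioo q₀ q₁)) :
    RectAdm M ν₁ ν₂ p₀ p₁ q₀ q₁ (planar ν₁ ν₂ v) (planar ν₁ ν₂ v)
      (planar ν₁ ν₂ fun p q => tens ν₁ (vp p q) + tens ν₂ (vq p q)) := by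
  have hvb : IsBddBorel (planar ν₁ ν₂ v) := planar_isBddBorel hv hb
  have hvi := hvb.integrableOn_rect h (p₀ := p₀) (p₁ := p₁) (q₀ := q₀) (q₁ := q₁)
  have hG : IntegrableOn (planar ν₁ ν₂ fun p q => tens ν₁ (vp p q) + tens ν₂ (vq p q))
      (rect ν₁ ν₂ p₀ p₁ q₀ q₁) :=
    integrableOn_planar h ((integrable_tens hvp ν₁).add (integrable_tens hvq ν₂))
  refine ⟨hvi, hG, Eventually.of_forall fun x => hM _ _, fun φ hφ j => ?_⟩
  by_cases hj : j = 2
  · subst hj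
    have h0 : ∀ w : Plane, comp3 w 2 = 0 := fun w => by simp [comp3]
    simp only [rectFlux, h0, planar, matCol_add, matCol_tens, zero_smul, add_zero, smul_zero]
    exact integral_transversal_direction h hv hb hφ
  have e1 := integral_frame_direction h hp hv hb hl₁ hvp hφ
  have hvq' : IntegrableOn (fun y : ℝ × ℝ => vq y.2 y.1) (Ioo q₀ q₁ ×ˢ Ioo p₀ p₁) := hvq.swap
  have e2 := integral_frame_direction h.frame_swap hq (v := fun q p => v p q)
    (vp := fun q p => vq p q) (hv.comp measurable_swap) (fun q p => hb p q) hl₂ hvq' hφ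
  rw [← rect_swap] at e2
  change ∫ x in rect ν₁ ν₂ p₀ p₁ q₀ q₁,
        (fderiv ℝ φ x (ν₂, 0) • planar ν₁ ν₂ v x + φ x • planar ν₁ ν₂ vq x) =
      faceIntegral ν₂ ν₁ q₁ p₀ p₁ (fun x => φ x • planar ν₁ ν₂ v x) -
        faceIntegral ν₂ ν₁ q₀ p₀ p₁ (fun x => φ x • planar ν₁ ν₂ v x) at e2
  have hi : ∀ {u : Pt → Target}, IntegrableOn u (rect ν₁ ν₂ p₀ p₁ q₀ q₁) → ∀ w : Plane,
      Integrable (fun x => fderiv ℝ φ x (w, 0) • planar ν₁ ν₂ v x + φ x • u x)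
        (volume.restrict (rect ν₁ ν₂ p₀ p₁ q₀ q₁)) := fun hu w =>
    (hφ.integrable_fderiv (w, 0) hvi).add (hφ.integrable_smul hu)
  rw [rectFlux, ← e1, ← e2, ← integral_smul, ← integral_smul, ← integral_add]
  · refine integral_congr_ae (Eventually.of_forall fun x => ?_)
    simp only [planar, matCol_add, matCol_tens, partialDeriv_eq_frame h φ x hj]
    module
  · exact (hi (integrableOn_planar h hvp) ν₁).smul (comp3 ν₁ j)
  · exact (hi (integrableOn_planar h hvq) ν₂).smul (comp3 ν₂ j)

end

/-! ### Transitions between two points -/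

noncomputable section

variable {ν₁ ν₂ : Plane} {M : Set Target} {F : Pt → Mat33 → ℝ} {p₀ p₁ q₀ q₁ β : ℝ}
  {v vp vq : ℝ → ℝ → Target} {a b : Target} {γ : ℝ → Target} {c δ : ℝ → ℝ}

lemma rectEnergy_planar_le (h : Orthonormal ℝ ![ν₁, ν₂]) (hβ : 0 ≤ β)
    (hF : ∀ᵐ x, ∀ ξ, F x ξ ≤ β * ‖ξ‖) (hp : p₀ ≤ p₁) (hq : q₀ ≤ q₁) {C : ℝ}
    (hv : Measurable fun y : ℝ × ℝ => v y.1 y.2) (hb : ∀ p q, ‖v p q‖ ≤ C)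
    (hM : ∀ p q, v p q ∈ M)
    (hl₁ : HasLineDerivAE p₀ p₁ q₀ q₁ v vp)
    (hl₂ : HasLineDerivAE q₀ q₁ p₀ p₁ (fun q p => v p q) fun q p => vq p q)
    (hvp : Measurable fun y : ℝ × ℝ => vp y.1 y.2) (hvq : Measurable fun y : ℝ × ℝ => vq y.1 y.2)
    (hfin : ∫⁻ y in Ioo p₀ p₁ ×ˢ Ioo q₀ q₁, (‖vp y.1 y.2‖ₑ + ‖vq y.1 y.2‖ₑ) < ⊤) :
    rectEnergy F M ν₁ ν₂ p₀ p₁ q₀ q₁ (planar ν₁ ν₂ v) ≤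
      ENNReal.ofReal β * ∫⁻ y in Ioo p₀ p₁ ×ˢ Ioo q₀ q₁, (‖vp y.1 y.2‖ₑ + ‖vq y.1 y.2‖ₑ) := by
  have hm : Measurable fun y : ℝ × ℝ => ‖vp y.1 y.2‖ₑ + ‖vq y.1 y.2‖ₑ := hvp.enorm.add hvq.enorm
  have h1 : IntegrableOn (fun y : ℝ × ℝ => vp y.1 y.2) (Ioo p₀ p₁ ×ˢ Ioo q₀ q₁) :=
    ⟨hvp.aestronglyMeasurable, lt_of_le_of_lt (lintegral_mono fun y => le_self_add) hfin⟩
  have h2 : IntegrableOn (fun y : ℝ × ℝ => vq y.1 y.2) (Ioo p₀ p₁ ×ˢ Ioo q₀ q₁) :=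
    ⟨hvq.aestronglyMeasurable, lt_of_le_of_lt (lintegral_mono fun y => le_add_self) hfin⟩
  refine (rectEnergy_le (rectAdm_planar h hp hq hv hb hM hl₁ hl₂ h1 h2)).trans ?_
  rw [← lintegral_planar h (w := fun p q => ‖vp p q‖ₑ + ‖vq p q‖ₑ) hm,
    ← lintegral_const_mul' _ _ ENNReal.ofReal_ne_top]
  refine lintegral_mono_ae (ae_restrict_of_ae (hF.mono fun x hx => ?_))
  have hn1 : ‖ν₁‖ = 1 := h.1 0
  have hn2 : ‖ν₂‖ = 1 := h.1 1
  simp only [planar]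
  obtain ⟨y1, hy1⟩ : ∃ y, y = vp ⟪x.1, ν₁⟫ ⟪x.1, ν₂⟫ := ⟨_, rfl⟩
  obtain ⟨y2, hy2⟩ : ∃ y, y = vq ⟪x.1, ν₁⟫ ⟪x.1, ν₂⟫ := ⟨_, rfl⟩
  rw [← hy1, ← hy2, ← ofReal_norm, ← ofReal_norm,
    ← ENNReal.ofReal_add (norm_nonneg _) (norm_nonneg _), ← ENNReal.ofReal_mul hβ]
  refine ENNReal.ofReal_le_ofReal ((hx _).trans (mul_le_mul_of_nonneg_left ?_ hβ))
  refine (norm_add_le _ _).trans_eq ?_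
  rw [norm_tens, norm_tens, hn1, hn2, one_mul, one_mul]

/-- A map that takes a single value on the lateral boundary extends with zero energy. -/
lemma rectEnergy_const (h : Orthonormal ℝ ![ν₁, ν₂]) (hβ : 0 ≤ β)
    (hF : ∀ᵐ x, ∀ ξ, F x ξ ≤ β * ‖ξ‖) (hp : p₀ ≤ p₁) (hq : q₀ ≤ q₁) {g : Pt → Target}
    (ha : a ∈ M) (hg : EqOnFaces ν₁ ν₂ p₀ p₁ q₀ q₁ g fun _ => a) :
    rectEnergy F M ν₁ ν₂ p₀ p₁ q₀ q₁ g = 0 := by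
  rw [rectEnergy_congr hg, ← nonpos_iff_eq_zero]
  have hl : ∀ r₀ r₁ s₀ s₁ : ℝ, HasLineDerivAE r₀ r₁ s₀ s₁ (fun _ _ => a) fun _ _ => 0 :=
    fun _ _ _ _ => Eventually.of_forall fun q _ =>
      ⟨continuousOn_const, fun p _ => hasDerivAt_const p a⟩
  have := rectEnergy_planar_le (v := fun _ _ => a) (vp := fun _ _ => 0) (vq := fun _ _ => 0) h hβ hF
    hp hq measurable_const (fun _ _ => le_rfl) (fun _ _ => ha) (hl _ _ _ _) (hl _ _ _ _)
    measurable_const measurable_const (by simp)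
  exact this.trans (by simp)

open Classical in
/-- The transition from `b` to `a` with profile `γ`, centred at `c q` and with width `δ q` on the
line of level `q`; a jump where the width vanishes. -/
def transition (γ : ℝ → Target) (a b : Target) (c δ : ℝ → ℝ) (p q : ℝ) : Target :=
  if 0 < δ q then γ ((p - c q) / δ q) else if c q < p then a else b

lemma transition_of_pos {q : ℝ} (hq : 0 < δ q) (p : ℝ) :
    transition γ a b c δ p q = γ ((p - c q) / δ q) := if_pos hq

lemma transition_of_le (hγ : γ ∈ geodesicProfiles M a b) {p q : ℝ} (hpq : c q < p)
    (h2 : δ q ≤ 2 * (p - c q)) : transition γ a b c δ p q = a := by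
  by_cases hd : 0 < δ q
  · rw [transition_of_pos hd]
    refine hγ.2.2.1 _ ?_
    rw [le_div_iff₀ hd]; linarith
  · rw [transition, if_neg hd, if_pos hpq]

lemma transition_of_ge (hγ : γ ∈ geodesicProfiles M a b) {p q : ℝ} (hpq : p ≤ c q)
    (h2 : δ q ≤ 2 * (c q - p)) : transition γ a b c δ p q = b := by
  by_cases hd : 0 < δ q
  · rw [transition_of_pos hd]
    refine hγ.2.2.2.1 _ ?_
    rw [div_le_iff₀ hd]; linarith
  · rw [transition, if_neg hd, if_neg (not_lt.2 hpq)]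

lemma transition_mem (hγ : γ ∈ geodesicProfiles M a b) (p q : ℝ) :
    transition γ a b c δ p q ∈ M := by
  have ha : a ∈ M := by rw [← hγ.2.2.1 (1 / 2) le_rfl]; exact hγ.2.1 _
  have hb : b ∈ M := by rw [← hγ.2.2.2.1 (-(1 / 2)) le_rfl]; exact hγ.2.1 _
  unfold transition
  split_ifs
  exacts [hγ.2.1 _, ha, hb]

lemma measurable_transition (hγ : γ ∈ geodesicProfiles M a b) (hc : Measurable c)
    (hδ : Measurable δ) : Measurable fun y : ℝ × ℝ => transition γ a b c δ y.1 y.2 := by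
  unfold transition
  refine Measurable.ite (measurableSet_lt measurable_const (hδ.comp measurable_snd)) ?_
    (Measurable.ite (measurableSet_lt (hc.comp measurable_snd) measurable_fst) measurable_const
      measurable_const)
  exact hγ.1.continuous.measurable.comp
    ((measurable_fst.sub (hc.comp measurable_snd)).div (hδ.comp measurable_snd))

lemma deriv_profile_eq_zero (hγ : γ ∈ geodesicProfiles M a b) {s : ℝ} (hs : 1 < |s|) :
    deriv γ s = 0 := by
  rcases lt_abs.1 hs with h | h
  · have : γ =ᶠ[𝓝 s] fun _ => a := by
      filter_upwards [Ioi_mem_nhds h] with t ht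
      exact hγ.2.2.1 t (by have := mem_Ioi.1 ht; linarith)
    rw [this.deriv_eq, deriv_const]
  · have : γ =ᶠ[𝓝 s] fun _ => b := by
      filter_upwards [Iio_mem_nhds (show s < -1 by linarith)] with t ht
      exact hγ.2.2.2.1 t (by have := mem_Iio.1 ht; linarith)
    rw [this.deriv_eq, deriv_const]

/-- Profiles are constant where `|s| > 1`. This bounds the derivative of a transition with respect
to its width. -/
lemma norm_smul_deriv_profile_le (hγ : γ ∈ geodesicProfiles M a b) (s : ℝ) :
    |s| * ‖deriv γ s‖ ≤ ‖deriv γ s‖ := by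
  by_cases hs : 1 < |s|
  · simp [deriv_profile_eq_zero hγ hs]
  · exact mul_le_of_le_one_left (norm_nonneg _) (not_lt.1 hs)

/-- The length of a profile does not depend on its centre and width. -/
lemma lintegral_profile_rescale (hγ : γ ∈ geodesicProfiles M a b) (c₀ : ℝ) {d : ℝ} (hd : 0 < d) :
    ∫⁻ p, ‖d⁻¹ • deriv γ ((p - c₀) / d)‖ₑ = geodesicDist M a b := by
  have hm : Measurable fun s => ‖deriv γ s‖ₑ :=
    (hγ.1.continuous_deriv (by simp)).measurable.enorm
  rw [lintegral_sub_right_eq_self (fun p => ‖d⁻¹ • deriv γ (p / d)‖ₑ) c₀, ← hγ.2.2.2.2]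
  simp only [enorm_smul]
  rw [lintegral_const_mul' _ _ enorm_ne_top]
  have h1 : ∫⁻ p, ‖deriv γ (p / d)‖ₑ =
      ∫⁻ s, ‖deriv γ s‖ₑ ∂(Measure.map (fun p => d⁻¹ * p) volume) := by
    rw [lintegral_map hm (by fun_prop)]
    simp only [div_eq_inv_mul]
  rw [h1, Real.map_volume_mul_left (inv_ne_zero hd.ne'), lintegral_smul_measure, inv_inv,
    ← ofReal_norm, Real.norm_eq_abs, smul_eq_mul, ← mul_assoc,
    ← ENNReal.ofReal_mul (abs_nonneg _), ← abs_mul, inv_mul_cancel₀ hd.ne']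
  simp

/-- Transitions with affine centre and width have energy controlled by the geodesic distance, also
when the width vanishes at an end point. -/
lemma rectEnergy_transition_le (h : Orthonormal ℝ ![ν₁, ν₂]) (hβ : 0 ≤ β)
    (hF : ∀ᵐ x, ∀ ξ, F x ξ ≤ β * ‖ξ‖) (hp : p₀ ≤ p₁) (hq : q₀ ≤ q₁) (hMc : IsCompact M)
    (hγ : γ ∈ geodesicProfiles M a b) (hD : geodesicDist M a b < ⊤) (hcm : Measurable c)
    (hδm : Measurable δ)
    {c₀ c₁ d₀ d₁ : ℝ} (hc : ∀ q ∈ Icc q₀ q₁, c q = c₀ + c₁ * q)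
    (hd : ∀ q ∈ Icc q₀ q₁, δ q = d₀ + d₁ * q) (hd0 : ∀ q ∈ Icc q₀ q₁, 0 ≤ δ q)
    (hdpos : ∀ q ∈ Ioo q₀ q₁, 0 < δ q) :
    rectEnergy F M ν₁ ν₂ p₀ p₁ q₀ q₁ (planar ν₁ ν₂ (transition γ a b c δ)) ≤
      ENNReal.ofReal (β * (1 + |c₁| + |d₁|) * (q₁ - q₀)) * geodesicDist M a b := by
  obtain ⟨C, hC⟩ := hMc.isBounded.exists_norm_le
  have hγd : ∀ s, HasDerivAt γ (deriv γ s) s := fun s =>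
    (hγ.1.differentiable (by simp) s).hasDerivAt
  have hγm : Measurable (deriv γ) := (hγ.1.continuous_deriv (by simp)).measurable
  have hsm : Measurable fun y : ℝ × ℝ => (y.1 - c y.2) / δ y.2 :=
    (measurable_fst.sub (hcm.comp measurable_snd)).div (hδm.comp measurable_snd)
  obtain ⟨vp, hvp⟩ : ∃ vp : ℝ → ℝ → Target, vp = fun p q =>
    (δ q)⁻¹ • deriv γ ((p - c q) / δ q) := ⟨_, rfl⟩
  obtain ⟨vq, hvq⟩ : ∃ vq : ℝ → ℝ → Target, vq = fun p q =>
    (-(c₁ + ((p - c q) / δ q) * d₁)) • ((δ q)⁻¹ • deriv γ ((p - c q) / δ q)) := ⟨_, rfl⟩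
  have hvpm : Measurable fun y : ℝ × ℝ => vp y.1 y.2 := by
    rw [hvp]
    exact ((hδm.comp measurable_snd).inv).smul (hγm.comp hsm)
  have hvqm : Measurable fun y : ℝ × ℝ => vq y.1 y.2 := by
    rw [hvq]
    exact ((hsm.mul_const d₁).const_add c₁).neg.smul
      (((hδm.comp measurable_snd).inv).smul (hγm.comp hsm))
  have hcc : ContinuousOn c (Icc q₀ q₁) :=
    (by fun_prop : Continuous fun q => c₀ + c₁ * q).continuousOn.congr hc
  have hdc : ContinuousOn δ (Icc q₀ q₁) :=
    (by fun_prop : Continuous fun q => d₀ + d₁ * q).continuousOn.congr hd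
  have hl₁ : HasLineDerivAE p₀ p₁ q₀ q₁ (transition γ a b c δ) vp := by
    refine Eventually.of_forall fun q hq => ?_
    have hpos := hdpos q hq
    simp only [transition_of_pos hpos]
    have hder : ∀ p, HasDerivAt (fun p => γ ((p - c q) / δ q)) (vp p q) p := fun p => by
      have h1 : HasDerivAt (fun p => (p - c q) / δ q) (1 / δ q) p :=
        ((hasDerivAt_id p).sub_const _).div_const _
      have := (hγd ((p - c q) / δ q)).scomp p h1
      rw [one_div] at this
      rw [hvp]; exact this
    exact ⟨fun p _ => (hder p).continuousAt.continuousWithinAt, fun p _ => hder p⟩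
  have hl₂ : HasLineDerivAE q₀ q₁ p₀ p₁ (fun q p => transition γ a b c δ p q)
      fun q p => vq p q := by
    have hn : ∀ r : ℝ, ∀ᵐ p : ℝ, p ≠ r := fun r => by simp [ae_iff]
    filter_upwards [hn (c q₀), hn (c q₁)] with p hp0 hp1 _
    constructor
    · intro q hq'
      rcases (hd0 q hq').eq_or_lt with h0 | hpos
      · -- the width vanishes, so `q` is an end point, and `p` is off the jump
        have hpc : p ≠ c q := by
          by_cases hqq : q ∈ Ioo q₀ q₁
          · exact absurd h0 (hdpos q hqq).ne
          · rcases eq_endpoints_or_mem_Ioo_of_mem_Icc hq' with rfl | rfl | h3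
            exacts [hp0, hp1, absurd h3 hqq]
        rcases lt_or_gt_of_ne hpc with hlt | hgt
        · have hev : ∀ᶠ q' in 𝓝[Icc q₀ q₁] q, 0 < 2 * (c q' - p) - δ q' := by
            have hcont : ContinuousWithinAt (fun q' => 2 * (c q' - p) - δ q') (Icc q₀ q₁) q :=
              (continuousWithinAt_const.mul ((hcc q hq').sub continuousWithinAt_const)).sub
                (hdc q hq')
            exact hcont.eventually (lt_mem_nhds (by
              change 0 < 2 * (c q - p) - δ q
              rw [← h0]; linarith))
          have hev2 : (fun q' => transition γ a b c δ p q') =ᶠ[𝓝[Icc q₀ q₁] q] fun _ => b := by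
            filter_upwards [hev, self_mem_nhdsWithin] with q' h1 h2
            have := hd0 q' h2
            exact transition_of_ge hγ (by linarith) (by linarith)
          exact continuousWithinAt_const.congr_of_eventuallyEq hev2
            (transition_of_ge hγ hlt.le (by rw [← h0]; linarith))
        · have hev : ∀ᶠ q' in 𝓝[Icc q₀ q₁] q, 0 < 2 * (p - c q') - δ q' := by
            have hcont : ContinuousWithinAt (fun q' => 2 * (p - c q') - δ q') (Icc q₀ q₁) q :=
              (continuousWithinAt_const.mul (continuousWithinAt_const.sub (hcc q hq'))).sub
                (hdc q hq')
            exact hcont.eventually (lt_mem_nhds (by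
              change 0 < 2 * (p - c q) - δ q
              rw [← h0]; linarith))
          have hev2 : (fun q' => transition γ a b c δ p q') =ᶠ[𝓝[Icc q₀ q₁] q] fun _ => a := by
            filter_upwards [hev, self_mem_nhdsWithin] with q' h1 h2
            have := hd0 q' h2
            exact transition_of_le hγ (by linarith) (by linarith)
          exact continuousWithinAt_const.congr_of_eventuallyEq hev2
            (transition_of_le hγ hgt (by rw [← h0]; linarith))
      · have hev : ∀ᶠ q' in 𝓝[Icc q₀ q₁] q, 0 < δ q' := (hdc q hq').eventually (lt_mem_nhds hpos)
        have hev2 : (fun q' => transition γ a b c δ p q') =ᶠ[𝓝[Icc q₀ q₁] q]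
            fun q' => γ ((p - c q') / δ q') := by
          filter_upwards [hev] with q' h1 using transition_of_pos h1 p
        refine ContinuousWithinAt.congr_of_eventuallyEq ?_ hev2 (transition_of_pos hpos p)
        exact hγ.1.continuous.continuousAt.comp_continuousWithinAt
          ((continuousWithinAt_const.sub (hcc q hq')).div (hdc q hq') hpos.ne')
    · intro q hq'
      have hpos := hdpos q hq'
      have hev : (fun q' => transition γ a b c δ p q') =ᶠ[𝓝 q]
          fun q' => γ ((p - (c₀ + c₁ * q')) / (d₀ + d₁ * q')) := by
        filter_upwards [Ioo_mem_nhds hq'.1 hq'.2] with q' h1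
        have h2 := Ioo_subset_Icc_self h1
        change transition γ a b c δ p q' = _
        rw [transition_of_pos (hdpos q' h1), hc q' h2, hd q' h2]
      refine HasDerivAt.congr_of_eventuallyEq ?_ hev
      have hcq := hc q (Ioo_subset_Icc_self hq')
      have hdq := hd q (Ioo_subset_Icc_self hq')
      have hne : d₀ + d₁ * q ≠ 0 := by rw [← hdq]; exact hpos.ne'
      have h1 : HasDerivAt (fun q' => (p - (c₀ + c₁ * q')) / (d₀ + d₁ * q'))
          ((-(c₁ + ((p - c q) / δ q) * d₁)) * (δ q)⁻¹) q := by
        have ha : HasDerivAt (fun q' => p - (c₀ + c₁ * q')) (-c₁) q := by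
          simpa using (((hasDerivAt_id q).const_mul c₁).const_add c₀).const_sub p
        have hb : HasDerivAt (fun q' => d₀ + d₁ * q') d₁ q := by
          simpa using ((hasDerivAt_id q).const_mul d₁).const_add d₀
        refine (ha.div hb hne).congr_deriv ?_
        rw [hcq, hdq]
        field_simp
        ring
      have := (hγd ((p - (c₀ + c₁ * q)) / (d₀ + d₁ * q))).scomp q h1
      rw [hvq]
      simp only
      rw [smul_smul]
      rw [← hcq, ← hdq] at this
      exact this
  have hI : ∫⁻ y in Ioo p₀ p₁ ×ˢ Ioo q₀ q₁, (‖vp y.1 y.2‖ₑ + ‖vq y.1 y.2‖ₑ) ≤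
      ENNReal.ofReal ((1 + |c₁| + |d₁|) * (q₁ - q₀)) * geodesicDist M a b := by
    have hK : 0 ≤ 1 + |c₁| + |d₁| := by positivity
    rw [Measure.volume_eq_prod, ← Measure.prod_restrict,
      lintegral_prod_symm (fun y : ℝ × ℝ => ‖vp y.1 y.2‖ₑ + ‖vq y.1 y.2‖ₑ)
        (hvpm.enorm.add hvqm.enorm).aemeasurable]
    calc ∫⁻ q in Ioo q₀ q₁, ∫⁻ p in Ioo p₀ p₁, (‖vp p q‖ₑ + ‖vq p q‖ₑ)
        ≤ ∫⁻ _ in Ioo q₀ q₁, ENNReal.ofReal (1 + |c₁| + |d₁|) * geodesicDist M a b := by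
          refine setLIntegral_mono measurable_const fun q hq' => ?_
          have hpos := hdpos q hq'
          rw [← lintegral_profile_rescale hγ (c q) hpos,
            ← lintegral_const_mul' _ _ ENNReal.ofReal_ne_top]
          refine (setLIntegral_le_lintegral _ _).trans (lintegral_mono fun p => ?_)
          have hs := norm_smul_deriv_profile_le hγ ((p - c q) / δ q)
          rw [hvq, hvp]
          simp only
          obtain ⟨s, hsdef⟩ : ∃ s, s = (p - c q) / δ q := ⟨_, rfl⟩
          rw [← hsdef] at hs ⊢
          have hi : 0 ≤ (δ q)⁻¹ := (inv_pos.2 hpos).le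
          rw [← ofReal_norm, ← ofReal_norm, ← ENNReal.ofReal_add (norm_nonneg _) (norm_nonneg _),
            ← ENNReal.ofReal_mul hK]
          refine ENNReal.ofReal_le_ofReal ?_
          rw [norm_smul (-(c₁ + s * d₁)), norm_smul (δ q)⁻¹, Real.norm_of_nonneg hi, norm_neg,
            Real.norm_eq_abs]
          have h1 : |c₁ + s * d₁| ≤ |c₁| + |s| * |d₁| := by
            rw [← abs_mul]; exact abs_add_le _ _
          have h2 : |c₁ + s * d₁| * ‖deriv γ s‖ ≤ (|c₁| + |d₁|) * ‖deriv γ s‖ := by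
            calc |c₁ + s * d₁| * ‖deriv γ s‖ ≤ (|c₁| + |s| * |d₁|) * ‖deriv γ s‖ := by gcongr
              _ = |c₁| * ‖deriv γ s‖ + |d₁| * (|s| * ‖deriv γ s‖) := by ring
              _ ≤ |c₁| * ‖deriv γ s‖ + |d₁| * ‖deriv γ s‖ := by gcongr
              _ = _ := by ring
          calc (δ q)⁻¹ * ‖deriv γ s‖ + |c₁ + s * d₁| * ((δ q)⁻¹ * ‖deriv γ s‖)
              = (δ q)⁻¹ * (‖deriv γ s‖ + |c₁ + s * d₁| * ‖deriv γ s‖) := by ring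
            _ ≤ (δ q)⁻¹ * (‖deriv γ s‖ + (|c₁| + |d₁|) * ‖deriv γ s‖) := by gcongr
            _ = _ := by ring
      _ = _ := by
          rw [setLIntegral_const, Real.volume_Ioo, ENNReal.ofReal_mul hK]
          ring
  refine (rectEnergy_planar_le h hβ hF hp hq (measurable_transition hγ hcm hδm)
    (fun p q => hC _ (transition_mem hγ p q)) (transition_mem hγ) hl₁ hl₂ hvpm hvqm
    (hI.trans_lt (ENNReal.mul_lt_top ENNReal.ofReal_lt_top hD))).trans ?_
  refine (mul_le_mul_right hI _).trans_eq ?_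
  rw [← mul_assoc, ← ENNReal.ofReal_mul hβ, mul_assoc β]

end

/-! ### Dilations of the in-plane variable -/

noncomputable section

variable {ν₁ ν₂ : Plane} {M : Set Target} {F : Pt → Mat33 → ℝ} {p₀ p₁ q₀ q₁ β s : ℝ}
  {a b : Target} {γ : ℝ → Target} {g u : Pt → Target} {G : Pt → Mat33}

/-- The dilation of the in-plane variable by `s`. -/
def dilation (s : ℝ) (x : Pt) : Pt := (s • x.1, x.2)

lemma measurableEmbedding_dilation (hs : 0 < s) : MeasurableEmbedding (dilation s) :=
  ((MeasurableEquiv.smul₀ s hs.ne').prodCongr (MeasurableEquiv.refl ℝ)).measurableEmbedding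

lemma dilation_inv_dilation (hs : 0 < s) (x : Pt) : dilation s⁻¹ (dilation s x) = x := by
  simp [dilation, smul_smul, inv_mul_cancel₀ hs.ne']

lemma map_dilation (hs : 0 < s) :
    Measure.map (dilation s) volume = ENNReal.ofReal (s⁻¹ ^ 2) • (volume : Measure Pt) := by
  have h1 : Measure.map (fun x : Plane => s • x) volume =
      ENNReal.ofReal (s⁻¹ ^ 2) • (volume : Measure Plane) := by
    rw [Measure.map_addHaar_smul _ hs.ne', finrank_euclideanSpace, Fintype.card_fin,
      abs_of_pos (by positivity), inv_pow]
  have h2 : Measure.map (dilation s) volume =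
      (Measure.map (fun x : Plane => s • x) volume).prod (Measure.map id (volume : Measure ℝ)) := by
    rw [Measure.map_prod_map _ _ (by fun_prop) measurable_id]
    rfl
  rw [h2, h1, Measure.map_id, Measure.prod_smul_left]
  rfl

lemma dilation_preimage_rect (hs : 0 < s) :
    dilation s ⁻¹' rect ν₁ ν₂ (s * p₀) (s * p₁) (s * q₀) (s * q₁) = rect ν₁ ν₂ p₀ p₁ q₀ q₁ := by
  ext x
  simp only [mem_preimage, mem_rect, dilation, real_inner_smul_left, mem_Ioo,
    mul_lt_mul_iff_right₀ hs]

lemma map_restrict_dilation (hs : 0 < s) :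
    Measure.map (dilation s) (volume.restrict (rect ν₁ ν₂ p₀ p₁ q₀ q₁)) =
      ENNReal.ofReal (s⁻¹ ^ 2) •
        volume.restrict (rect ν₁ ν₂ (s * p₀) (s * p₁) (s * q₀) (s * q₁)) := by
  rw [← dilation_preimage_rect hs, ← (measurableEmbedding_dilation hs).restrict_map,
    map_dilation hs, Measure.restrict_smul]

lemma faceIntegral_dilation (hs : 0 < s) (w w' : Plane) (r r₀ r₁ : ℝ) (Q : Pt → Target) :
    faceIntegral w w' r r₀ r₁ (fun x => Q (dilation s x)) =
      s⁻¹ • faceIntegral w w' (s * r) (s * r₀) (s * r₁) Q := by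
  have hemb : MeasurableEmbedding (Prod.map (fun r : ℝ => s * r) (id : ℝ → ℝ)) :=
    ((MeasurableEquiv.mulLeft₀ s hs.ne').prodCongr (MeasurableEquiv.refl ℝ)).measurableEmbedding
  have hmap : Measure.map (Prod.map (fun r : ℝ => s * r) (id : ℝ → ℝ)) volume =
      ENNReal.ofReal s⁻¹ • (volume : Measure (ℝ × ℝ)) := by
    rw [Measure.volume_eq_prod, ← Measure.map_prod_map _ _ (by fun_prop) measurable_id,
      Real.map_volume_mul_left hs.ne', Measure.map_id, Measure.prod_smul_left,
      abs_of_pos (inv_pos.2 hs)]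
  have hpre : Prod.map (fun r : ℝ => s * r) (id : ℝ → ℝ) ⁻¹'
      (Ioo (s * r₀) (s * r₁) ×ˢ thickness) = Ioo r₀ r₁ ×ˢ thickness := by
    ext y; simp [mul_lt_mul_iff_right₀ hs]
  have h1 := hemb.setIntegral_map (μ := volume)
    (fun y : ℝ × ℝ => Q ((s * r) • w + y.1 • w', y.2)) (Ioo (s * r₀) (s * r₁) ×ˢ thickness)
  rw [hmap, hpre, Measure.restrict_smul, integral_smul_measure,
    ENNReal.toReal_ofReal (inv_pos.2 hs).le] at h1
  rw [faceIntegral, faceIntegral, h1]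
  simp [dilation, smul_smul]

/-- `rescaleGrad` as a continuous linear map. -/
def rescaleGradL (s : ℝ) : Mat33 →L[ℝ] Mat33 :=
  LinearMap.toContinuousLinearMap
    { toFun := fun ξ => rescaleGrad s ξ
      map_add' := fun ξ η => by
        ext i; simp only [rescaleGrad, PiLp.add_apply]; split_ifs <;> ring
      map_smul' := fun c ξ => by
        ext i; simp only [rescaleGrad, PiLp.smul_apply, smul_eq_mul, RingHom.id_apply]
        split_ifs <;> ring }

lemma rescaleGrad_rescaleGrad_inv (hs : 0 < s) (ξ : Mat33) :
    rescaleGrad s (s⁻¹ • rescaleGrad s⁻¹ ξ) = s⁻¹ • ξ := by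
  ext i
  simp only [rescaleGrad, PiLp.smul_apply, smul_eq_mul]
  split_ifs
  · field_simp
  · rfl

lemma matCol_smul_rescaleGrad (hs : 0 < s) (ξ : Mat33) (j : Fin 3) :
    matCol (s • rescaleGrad s ξ) j = (if j = 2 then (1 : ℝ) else s) • matCol ξ j := by
  ext i
  simp only [matCol, rescaleGrad, PiLp.smul_apply, smul_eq_mul]
  split_ifs
  · field_simp
  · rfl

lemma partialDeriv_dilation (hs : 0 < s) {ψ : Pt → ℝ} (hψ : Differentiable ℝ ψ) (j : Fin 3)
    (x : Pt) : partialDeriv ψ j x =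
      (if j = 2 then (1 : ℝ) else s) *
        partialDeriv (fun y => ψ (dilation s⁻¹ y)) j (dilation s x) := by
  let T : Pt →L[ℝ] Pt := (s⁻¹ • ContinuousLinearMap.fst ℝ Plane ℝ).prod
    (ContinuousLinearMap.snd ℝ Plane ℝ)
  have h1 : HasFDerivAt (fun y => ψ (dilation s⁻¹ y)) ((fderiv ℝ ψ x).comp T) (dilation s x) := by
    have h2 : HasFDerivAt (dilation s⁻¹) T (dilation s x) := T.hasFDerivAt
    have h3 : HasFDerivAt ψ (fderiv ℝ ψ x) (dilation s⁻¹ (dilation s x)) := by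
      rw [dilation_inv_dilation hs]; exact (hψ x).hasFDerivAt
    exact h3.comp _ h2
  have hT : T (basisVec j) = (if j = 2 then (1 : ℝ) else s⁻¹) • basisVec j := by
    fin_cases j <;> simp [T, basisVec]
  rw [partialDeriv, partialDeriv, h1.fderiv, ContinuousLinearMap.comp_apply, hT, map_smul,
    smul_eq_mul, ← mul_assoc]
  split_ifs
  · simp
  · rw [mul_inv_cancel₀ hs.ne', one_mul]

/-- Dilations preserve Sobolev maps and traces. The factor `s` on the in-plane derivatives is the
one by which `s • rescaleGrad s` multiplies the first two columns. -/
lemma RectAdm.dilate (hs : 0 < s)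
    (h : RectAdm M ν₁ ν₂ (s * p₀) (s * p₁) (s * q₀) (s * q₁) g u G) :
    RectAdm M ν₁ ν₂ p₀ p₁ q₀ q₁ (fun x => g (dilation s x)) (fun x => u (dilation s x))
      (fun x => s • rescaleGrad s (G (dilation s x))) := by
  have hemb := measurableEmbedding_dilation hs
  have hmap := map_restrict_dilation (ν₁ := ν₁) (ν₂ := ν₂) (p₀ := p₀) (p₁ := p₁) (q₀ := q₀)
    (q₁ := q₁) hs
  have hint : ∀ {E : Type} [NormedAddCommGroup E] {v : Pt → E},
      IntegrableOn v (rect ν₁ ν₂ (s * p₀) (s * p₁) (s * q₀) (s * q₁)) →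
      IntegrableOn (fun x => v (dilation s x)) (rect ν₁ ν₂ p₀ p₁ q₀ q₁) := fun {E _ v} hv => by
    have := Integrable.smul_measure hv (ENNReal.ofReal_ne_top (r := s⁻¹ ^ 2))
    rw [← hmap, hemb.integrable_map_iff] at this
    exact this
  refine ⟨hint h.integrable, ((rescaleGradL s).integrable_comp (hint h.integrable_grad)).smul s, ?_,
    fun ψ hψ j => ?_⟩
  · rw [← hemb.ae_map_iff (p := fun x => u x ∈ M), hmap]
    exact Measure.ae_smul_measure h.mem _
  have hφ : IsTest fun y => ψ (dilation s⁻¹ y) := by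
    have hd : ContDiff ℝ ∞ (dilation s⁻¹) := by unfold dilation; fun_prop
    refine ⟨hψ.smooth.comp hd, ?_, ?_⟩
    · exact hψ.compact.comp_homeomorph
        ((Homeomorph.smulOfNeZero s⁻¹ (inv_pos.2 hs).ne').prodCongr (Homeomorph.refl ℝ))
    · intro x hx
      have := hψ.supp (tsupport_comp_subset_preimage ψ hd.continuous hx)
      exact ⟨mem_univ _, this.2⟩
  have ht := h.trace _ hφ j
  obtain ⟨κ, hκ⟩ : ∃ κ : ℝ, κ = if j = 2 then (1 : ℝ) else s := ⟨_, rfl⟩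
  have e1 : ∀ x, partialDeriv ψ j x • u (dilation s x) +
      ψ x • matCol (s • rescaleGrad s (G (dilation s x))) j =
      κ • (partialDeriv (fun y => ψ (dilation s⁻¹ y)) j (dilation s x) • u (dilation s x) +
        ψ (dilation s⁻¹ (dilation s x)) • matCol (G (dilation s x)) j) := fun x => by
    rw [partialDeriv_dilation hs (hψ.smooth.differentiable (by simp)), matCol_smul_rescaleGrad hs,
      dilation_inv_dilation hs, ← hκ]
    module
  simp only [e1]
  rw [integral_smul, ← hemb.integral_map (fun x => partialDeriv (fun y => ψ (dilation s⁻¹ y)) j x •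
    u x + ψ (dilation s⁻¹ x) • matCol (G x) j), hmap, integral_smul_measure, ht,
    ENNReal.toReal_ofReal (by positivity)]
  have e2 : ∀ x, ψ x • g (dilation s x) =
      (fun x => ψ (dilation s⁻¹ x) • g x) (dilation s x) := fun x => by
    simp only [dilation_inv_dilation hs]
  simp only [rectFlux, e2]
  simp only [faceIntegral_dilation hs _ _ _ _ _ (fun x => ψ (dilation s⁻¹ x) • g x)]
  by_cases hj : j = 2
  · subst hj
    simp [comp3]
  · rw [if_neg hj] at hκ
    rw [hκ, smul_smul]
    have : s * s⁻¹ ^ 2 = s⁻¹ := by field_simp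
    rw [this]
    module

lemma lintegral_dilation (hs : 0 < s) (H : Pt → ℝ≥0∞) :
    ∫⁻ x in rect ν₁ ν₂ p₀ p₁ q₀ q₁, H (dilation s x) = ENNReal.ofReal (s⁻¹ ^ 2) *
      ∫⁻ x in rect ν₁ ν₂ (s * p₀) (s * p₁) (s * q₀) (s * q₁), H x := by
  rw [← (measurableEmbedding_dilation hs).lintegral_map, map_restrict_dilation hs,
    lintegral_smul_measure, smul_eq_mul]

end

/-! ### Squares, the two minimization problems and the recession function -/

noncomputable section

variable {ν₁ ν₂ : Plane} {M : Set Target} {F : Pt → Mat33 → ℝ} {f : Pt → Mat33 → ℝ} {t h : ℝ}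
  {a b : Target} {γ : ℝ → Target} {g u : Pt → Target} {G : Pt → Mat33}

/-- The minimal energy on the cylinder over `t Q_ν` with lateral boundary values `g`. -/
def squareEnergy (F : Pt → Mat33 → ℝ) (M : Set Target) (ν₁ ν₂ : Plane) (t : ℝ)
    (g : Pt → Target) : ℝ≥0∞ :=
  rectEnergy F M ν₁ ν₂ (-(t / 2)) (t / 2) (-(t / 2)) (t / 2) g

lemma cylinder_eq_rect (t : ℝ) :
    cylinder ν₁ ν₂ t = rect ν₁ ν₂ (-(t / 2)) (t / 2) (-(t / 2)) (t / 2) := rfl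

lemma lateralFlux_eq_rectFlux {Q : Pt → Target} (hQ : IsBddBorel Q) (t : ℝ) (j : Fin 3) :
    lateralFlux ν₁ ν₂ t j Q = rectFlux ν₁ ν₂ (-(t / 2)) (t / 2) (-(t / 2)) (t / 2) j Q := by
  have hi := fun w w' r => hQ.integrableOn_face w w' r (-(t / 2)) (t / 2)
  rw [rectFlux, faceIntegral, faceIntegral, faceIntegral, faceIntegral,
    ← integral_sub (hi _ _ _) (hi _ _ _), ← integral_sub (hi _ _ _) (hi _ _ _),
    ← integral_smul, ← integral_smul, ← integral_add]
  · rw [lateralFlux]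
    refine integral_congr_ae (Eventually.of_forall fun y => ?_)
    simp only [comp3]
    rw [add_comm ((t / 2) • ν₂), add_comm (-(t / 2) • ν₂)]
  · exact ((hi _ _ _).sub (hi _ _ _)).smul (comp3 ν₁ j)
  · exact ((hi _ _ _).sub (hi _ _ _)).smul (comp3 ν₂ j)

/-- The Gauss-Green formula with lateral trace contains the definition of the weak gradient. -/
lemma rectAdm_iff (h : Orthonormal ℝ ![ν₁, ν₂]) (hg : IsBddBorel g) :
    RectAdm M ν₁ ν₂ (-(t / 2)) (t / 2) (-(t / 2)) (t / 2) g u G ↔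
      IsSobolevMap M (cylinder ν₁ ν₂ t) u G ∧ HasLateralTrace ν₁ ν₂ t u G g := by
  obtain ⟨h11, h22, h12, h21⟩ := inner_frame h
  constructor
  · intro hA
    refine ⟨⟨hA.integrable, hA.integrable_grad, hA.mem, fun φ h1 h2 h3 j => ?_⟩,
      fun φ h1 h2 h3 j => ?_⟩
    · have hφ : IsTest φ := ⟨h1, h2, h3.trans (prod_mono (subset_univ _) subset_rfl)⟩
      have hz : ∀ x : Pt, x ∉ cylinder ν₁ ν₂ t → φ x • g x = 0 := fun x hx => by
        rw [image_eq_zero_of_notMem_tsupport fun hm => hx (h3 hm), zero_smul]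
      have hf1 : ∀ r : ℝ, r ∉ Ioo (-(t / 2)) (t / 2) →
          faceIntegral ν₁ ν₂ r (-(t / 2)) (t / 2) (fun x => φ x • g x) = 0 := fun r hr => by
        refine integral_eq_zero_of_ae (Eventually.of_forall fun y => hz _ fun hm => hr ?_)
        simpa [inner_add_left, real_inner_smul_left, h11, h12, h21, h22,
          -inner_self_eq_norm_sq_to_K] using hm.1.1
      have hf2 : ∀ r : ℝ, r ∉ Ioo (-(t / 2)) (t / 2) →
          faceIntegral ν₂ ν₁ r (-(t / 2)) (t / 2) (fun x => φ x • g x) = 0 := fun r hr => by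
        refine integral_eq_zero_of_ae (Eventually.of_forall fun y => hz _ fun hm => hr ?_)
        simpa [inner_add_left, real_inner_smul_left, h11, h12, h21, h22,
          -inner_self_eq_norm_sq_to_K] using hm.1.2
      have ht := hA.trace φ hφ j
      have hi := hφ.integrableOn hA.integrable hA.integrable_grad j
      rw [integral_add hi.1 hi.2, rectFlux, hf1 _ right_notMem_Ioo, hf1 _ left_notMem_Ioo,
        hf2 _ right_notMem_Ioo, hf2 _ left_notMem_Ioo] at ht
      simp only [sub_zero, smul_zero, add_zero] at ht
      exact eq_neg_of_add_eq_zero_left ht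
    · have hφ : IsTest φ := ⟨h1, h2, h3⟩
      rw [lateralFlux_eq_rectFlux (hφ.isBddBorel_smul hg)]
      exact hA.trace φ hφ j
  · rintro ⟨hS, hT⟩
    refine ⟨hS.integrable, hS.integrable_grad, hS.mem, fun φ hφ j => ?_⟩
    rw [← lateralFlux_eq_rectFlux (hφ.isBddBorel_smul hg)]
    exact hT φ hφ.smooth hφ.compact hφ.supp j

lemma isBddBorel_jumpProfile (a b : Target) (ν₁ : Plane) : IsBddBorel (jumpProfile a b ν₁) := by
  classical
  refine ⟨?_, max ‖a‖ ‖b‖, fun x => ?_⟩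
  · unfold jumpProfile
    exact Measurable.ite (measurableSet_lt measurable_const (by fun_prop)) measurable_const
      measurable_const
  · unfold jumpProfile
    split_ifs
    exacts [le_max_left _ _, le_max_right _ _]

lemma isBddBorel_profile (hMc : IsCompact M) (hγ : γ ∈ geodesicProfiles M a b) (r : ℝ) :
    IsBddBorel fun x : Pt => γ (⟪x.1, ν₁⟫ / r) := by
  obtain ⟨C, hC⟩ := hMc.isBounded.exists_norm_le
  exact ⟨hγ.1.continuous.measurable.comp (by fun_prop), C, fun x => hC _ (hγ.2.1 _)⟩

lemma minEnergyA_eq (hν : Orthonormal ℝ ![ν₁, ν₂]) (ht : 0 < t) :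
    minEnergyA f M a b ν₁ ν₂ t = ENNReal.ofReal (1 / t) *
      squareEnergy (recession f) M ν₁ ν₂ t (jumpProfile a b ν₁) := by
  have h0 : ENNReal.ofReal (1 / t) ≠ 0 := by
    rw [Ne, ENNReal.ofReal_eq_zero, not_le]; positivity
  rw [minEnergyA, squareEnergy, rectEnergy, ENNReal.mul_iInf_of_ne h0 ENNReal.ofReal_ne_top]
  refine iInf_congr fun p => ?_
  rw [ENNReal.mul_iInf_of_ne h0 ENNReal.ofReal_ne_top]
  exact iInf_congr_Prop (rectAdm_iff hν (isBddBorel_jumpProfile a b ν₁)).symm fun _ => rfl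

/-- The dilation `x_α ↦ x_α / h` turns the competitors for `minEnergyB` into maps on a square of
side `1 / h`. -/
lemma le_minEnergyB (hν : Orthonormal ℝ ![ν₁, ν₂]) (hMc : IsCompact M) (hh : 0 < h)
    (hom : ∀ s > 0, ∀ x ξ, recession f x (s • ξ) = s * recession f x ξ) {m : ℝ≥0∞}
    (hm : ∀ γ ∈ geodesicProfiles M a b, m ≤ ENNReal.ofReal h *
      squareEnergy (recession f) M ν₁ ν₂ h⁻¹ fun x => γ ⟪x.1, ν₁⟫) :
    m ≤ minEnergyB f M a b ν₁ ν₂ h := by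
  refine le_iInf₂ fun p hp => ?_
  obtain ⟨u, G⟩ := p
  obtain ⟨hS, γ, hγ, hT⟩ := hp
  refine (hm γ hγ).trans ?_
  have hA := (rectAdm_iff hν (isBddBorel_profile hMc hγ h)).2 ⟨hS, hT⟩
  have e1 : h * -(h⁻¹ / 2) = -(1 / 2) := by field_simp
  have e2 : h * (h⁻¹ / 2) = 1 / 2 := by field_simp
  rw [← e1, ← e2] at hA
  have hA' := rectEnergy_le (F := recession f) (hA.dilate hh)
  have hg : (fun x : Pt => γ (⟪(dilation h x).1, ν₁⟫ / h)) = fun x => γ ⟪x.1, ν₁⟫ := by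
    funext x
    simp only [dilation, real_inner_smul_left]
    rw [mul_div_cancel_left₀ _ hh.ne']
  rw [hg] at hA'
  rw [squareEnergy]
  refine (mul_le_mul_right hA' _).trans_eq ?_
  obtain ⟨H, hH⟩ : ∃ H : Pt → ℝ≥0∞, H = fun x =>
      ENNReal.ofReal (recession f (h⁻¹ • x.1, x.2) (rescaleGrad h (G x))) := ⟨_, rfl⟩
  have e3 : ∀ y : Pt, ENNReal.ofReal (recession f y (h • rescaleGrad h (G (dilation h y)))) =
      ENNReal.ofReal h * H (dilation h y) := fun y => by
    rw [hom h hh, ENNReal.ofReal_mul hh.le, hH]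
    simp only [dilation, smul_smul, inv_mul_cancel₀ hh.ne', one_smul]
  simp only [e3]
  rw [lintegral_const_mul' _ _ ENNReal.ofReal_ne_top, lintegral_dilation hh, e1, e2,
    ← mul_assoc, ← mul_assoc, ← ENNReal.ofReal_mul hh.le, ← ENNReal.ofReal_mul (by positivity)]
  have e4 : h * h * h⁻¹ ^ 2 = 1 := by field_simp
  rw [e4, ENNReal.ofReal_one, one_mul, hH]
  rfl

lemma minEnergyB_le (hν : Orthonormal ℝ ![ν₁, ν₂]) (hMc : IsCompact M) (hh : 0 < h)
    (hom : ∀ s > 0, ∀ x ξ, recession f x (s • ξ) = s * recession f x ξ)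
    (hγ : γ ∈ geodesicProfiles M a b) :
    minEnergyB f M a b ν₁ ν₂ h ≤ ENNReal.ofReal h *
      squareEnergy (recession f) M ν₁ ν₂ h⁻¹ fun x => γ ⟪x.1, ν₁⟫ := by
  have hi : 0 < h⁻¹ := inv_pos.2 hh
  have h0 : ENNReal.ofReal h ≠ 0 := by rw [Ne, ENNReal.ofReal_eq_zero, not_le]; exact hh
  rw [squareEnergy, rectEnergy, ENNReal.mul_iInf_of_ne h0 ENNReal.ofReal_ne_top]
  refine le_iInf fun p => ?_
  rw [ENNReal.mul_iInf_of_ne h0 ENNReal.ofReal_ne_top]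
  refine le_iInf fun hA => ?_
  obtain ⟨u, G⟩ := p
  have e1 : -(h⁻¹ / 2) = h⁻¹ * -(1 / 2) := by ring
  have e2 : h⁻¹ / 2 = h⁻¹ * (1 / 2) := by ring
  rw [e1, e2] at hA ⊢
  have hA' := hA.dilate hi
  have hg : (fun x : Pt => γ ⟪(dilation h⁻¹ x).1, ν₁⟫) = fun x => γ (⟪x.1, ν₁⟫ / h) := by
    funext x
    simp only [dilation, real_inner_smul_left]
    rw [div_eq_inv_mul]
  rw [hg] at hA'
  obtain ⟨hS, hT⟩ := (rectAdm_iff (t := 1) hν (isBddBorel_profile hMc hγ h)).1 hA'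
  refine (iInf₂_le ((fun x => u (dilation h⁻¹ x),
      fun x => h⁻¹ • rescaleGrad h⁻¹ (G (dilation h⁻¹ x))) :
    (Pt → Target) × (Pt → Mat33)) ⟨hS, γ, hγ, hT⟩).trans_eq ?_
  have e3 : ∀ x : Pt, ENNReal.ofReal (recession f (h⁻¹ • x.1, x.2)
      (rescaleGrad h (h⁻¹ • rescaleGrad h⁻¹ (G (dilation h⁻¹ x))))) = ENNReal.ofReal h⁻¹ *
        (fun y => ENNReal.ofReal (recession f y (G y))) (dilation h⁻¹ x) := fun x => by
    rw [rescaleGrad_rescaleGrad_inv hh, hom _ hi, ENNReal.ofReal_mul hi.le]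
    rfl
  simp only [e3]
  rw [lintegral_const_mul' _ _ ENNReal.ofReal_ne_top, cylinder_eq_rect,
    lintegral_dilation hi (fun y => ENNReal.ofReal (recession f y (G y))), ← mul_assoc,
    ← ENNReal.ofReal_mul hi.le]
  have e4 : h⁻¹ * h⁻¹⁻¹ ^ 2 = h := by field_simp
  rw [e4]

/-- Positive homogeneity; it needs no bounds on `f`, as the set of eventual upper bounds, of which
the limit superior is the infimum, is multiplied by `s`. -/
lemma recession_smul (f : Pt → Mat33 → ℝ) (x : Pt) {s : ℝ} (hs : 0 < s) (ξ : Mat33) :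
    recession f x (s • ξ) = s * recession f x ξ := by
  have hmap : map (fun t : ℝ => t * s) atTop = atTop :=
    (OrderIso.mulRight₀ s hs).map_atTop
  have h1 : recession f x (s • ξ) = limsup (fun t : ℝ => s * (f x (t • ξ) / t)) atTop := by
    conv_rhs => rw [← hmap]
    rw [recession, limsup, limsup, map_map]
    congr 2
    funext t
    simp only [Function.comp, smul_smul]
    field_simp
  rw [h1, recession, limsup_eq, limsup_eq, ← smul_eq_mul, ← Real.sInf_smul_of_nonneg hs.le]
  congr 1
  ext r
  simp only [mem_ofPred_eq, mem_smul_set]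
  constructor
  · intro hr
    refine ⟨s⁻¹ * r, hr.mono fun t ht => ?_, by rw [smul_eq_mul, mul_inv_cancel_left₀ hs.ne']⟩
    rw [inv_mul_eq_div, le_div_iff₀' hs]; exact ht
  · rintro ⟨y, hy, rfl⟩
    exact hy.mono fun t ht => mul_le_mul_of_nonneg_left ht hs.le

lemma recession_le {β : ℝ} {x : Pt} (hx : ∀ ξ, 0 ≤ f x ξ ∧ f x ξ ≤ β * (1 + ‖ξ‖))
    (ξ : Mat33) : recession f x ξ ≤ β * ‖ξ‖ := by
  refine le_of_forall_pos_le_add fun ε hε => ?_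
  refine limsup_le_of_le ?_ ?_
  · refine IsCoboundedUnder.of_frequently_ge (a := 0) (Eventually.frequently ?_)
    filter_upwards [eventually_gt_atTop 0] with t ht
    exact div_nonneg (hx _).1 ht.le
  · filter_upwards [eventually_gt_atTop (0 : ℝ), eventually_ge_atTop (β / ε)] with t ht ht2
    rw [div_le_iff₀ ht]
    refine (hx _).2.trans ?_
    rw [norm_smul, Real.norm_of_nonneg ht.le]
    rw [div_le_iff₀ hε] at ht2
    nlinarith

lemma recession_periodic (H1 : ∀ (x : Pt) (ξ : Mat33) (i : Fin 2),
      f (x.1 + EuclideanSpace.single i 1, x.2) ξ = f x ξ) {z : Plane} (hz : ∀ i, ∃ n : ℤ, z i = n)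
    (x : Pt) (ξ : Mat33) : recession f (x.1 + z, x.2) ξ = recession f x ξ := by
  have key : ∀ η, f (x.1 + z, x.2) η = f x η := fun η => by
    choose n hn using hz
    have hp : ∀ i, Function.Periodic (fun y : Plane => f (y, x.2) η) (EuclideanSpace.single i 1) :=
      fun i y => H1 (y, x.2) η i
    have hz' : z =
        n 0 • EuclideanSpace.single 0 (1 : ℝ) + n 1 • EuclideanSpace.single 1 (1 : ℝ) := by
      ext i; fin_cases i <;> simp [hn]
    rw [hz', ← add_assoc]
    exact (((hp 1).zsmul (n 1)) _).trans (((hp 0).zsmul (n 0)) _)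
  simp only [recession, key]

end

/-! ### Jumps and profiles as boundary values -/

noncomputable section

variable {ν₁ ν₂ : Plane} {M : Set Target} {F : Pt → Mat33 → ℝ} {t β : ℝ}
  {p₀ p₁ q₀ q₁ P Q₀ Q₁ : ℝ} {a b : Target} {γ : ℝ → Target} {c δ : ℝ → ℝ}

lemma eqOnFaces_planar (h : Orthonormal ℝ ![ν₁, ν₂]) {v w : ℝ → ℝ → Target}
    (h₁ : ∀ q ∈ Ioo q₀ q₁, v p₀ q = w p₀ q ∧ v p₁ q = w p₁ q)
    (h₂ : ∀ p ∈ Ioo p₀ p₁, v p q₀ = w p q₀ ∧ v p q₁ = w p q₁) :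
    EqOnFaces ν₁ ν₂ p₀ p₁ q₀ q₁ (planar ν₁ ν₂ v) (planar ν₁ ν₂ w) := by
  refine ⟨fun q hq z p hp => ?_, Eventually.of_forall fun p hp z q hq => ?_⟩
  · rw [planar_frame h, planar_frame h]
    rcases hp with rfl | rfl
    exacts [(h₁ q hq).1, (h₁ q hq).2]
  · rw [planar_frame h, planar_frame h]
    rcases hq with rfl | rfl
    exacts [(h₂ p hp).1, (h₂ p hp).2]

lemma jumpProfile_eq (γ : ℝ → Target) : jumpProfile a b ν₁ =
    planar ν₁ ν₂ (transition γ a b (fun _ => 0) fun _ => 0) := by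
  funext x
  simp [jumpProfile, planar, transition]

lemma profile_eq_planar : (fun x : Pt => γ ⟪x.1, ν₁⟫) = planar ν₁ ν₂ fun p _ => γ p := rfl

lemma transition_eq_profile {p q : ℝ} (hc : c q = 0) (hδ : δ q = 1) :
    transition γ a b c δ p q = γ p := by
  rw [transition_of_pos (by rw [hδ]; exact one_pos), hc, hδ, sub_zero, div_one]

/-- A transition on a large rectangle costs at most its cost on an inner rectangle, beside which it
is constant, plus its cost on the two strips above and below. -/
lemma rectEnergy_transition_frame (h : Orthonormal ℝ ![ν₁, ν₂]) (hβ : 0 ≤ β)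
    (hF : ∀ᵐ x, ∀ ξ, F x ξ ≤ β * ‖ξ‖) (hMc : IsCompact M)
    (hγ : γ ∈ geodesicProfiles M a b) (hcm : Measurable c) (hδm : Measurable δ)
    (hP₀ : -P ≤ p₀) (hp : p₀ ≤ p₁) (hP₁ : p₁ ≤ P) (hQ₀ : Q₀ ≤ q₀) (hq : q₀ ≤ q₁) (hQ₁ : q₁ ≤ Q₁)
    (hb : ∀ q ∈ Icc q₀ q₁, p₀ ≤ c q ∧ δ q ≤ 2 * (c q - p₀))
    (ha : ∀ q ∈ Icc q₀ q₁, c q < p₁ ∧ δ q ≤ 2 * (p₁ - c q)) {E₀ E₁ : ℝ≥0∞}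
    (hE₀ : rectEnergy F M ν₁ ν₂ (-P) P Q₀ q₀ (planar ν₁ ν₂ (transition γ a b c δ)) ≤ E₀)
    (hE₁ : rectEnergy F M ν₁ ν₂ (-P) P q₁ Q₁ (planar ν₁ ν₂ (transition γ a b c δ)) ≤ E₁) :
    rectEnergy F M ν₁ ν₂ (-P) P Q₀ Q₁ (planar ν₁ ν₂ (transition γ a b c δ)) ≤
      rectEnergy F M ν₁ ν₂ p₀ p₁ q₀ q₁ (planar ν₁ ν₂ (transition γ a b c δ)) + (E₀ + E₁) := by
  obtain ⟨C, hC⟩ := hMc.isBounded.exists_norm_le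
  have haM : a ∈ M := by rw [← hγ.2.2.1 (1 / 2) le_rfl]; exact hγ.2.1 _
  have hbM : b ∈ M := by rw [← hγ.2.2.2.1 (-(1 / 2)) le_rfl]; exact hγ.2.1 _
  have hbb : ∀ p ≤ p₀, ∀ q ∈ Icc q₀ q₁, transition γ a b c δ p q = b := fun p hp' q hq' => by
    have := hb q hq'
    exact transition_of_ge hγ (by linarith) (by linarith)
  have haa : ∀ p ≥ p₁, ∀ q ∈ Icc q₀ q₁, transition γ a b c δ p q = a := fun p hp' q hq' => by
    have := ha q hq'
    exact transition_of_le hγ (by linarith) (by linarith)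
  have hg : IsBddBorel (planar ν₁ ν₂ (transition γ a b c δ)) :=
    planar_isBddBorel (measurable_transition hγ hcm hδm) fun p q => hC _ (transition_mem hγ p q)
  have hl : rectEnergy F M ν₁ ν₂ (-P) p₀ q₀ q₁ (planar ν₁ ν₂ (transition γ a b c δ)) = 0 := by
    refine rectEnergy_const h hβ hF hP₀ hq hbM (eqOnFaces_planar (w := fun _ _ => b) h ?_ ?_)
    · exact fun q hq' => ⟨hbb _ hP₀ q (Ioo_subset_Icc_self hq'),
        hbb _ le_rfl q (Ioo_subset_Icc_self hq')⟩
    · exact fun p hp' => ⟨hbb _ hp'.2.le _ (left_mem_Icc.2 hq),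
        hbb _ hp'.2.le _ (right_mem_Icc.2 hq)⟩
  have hr : rectEnergy F M ν₁ ν₂ p₁ P q₀ q₁ (planar ν₁ ν₂ (transition γ a b c δ)) = 0 := by
    refine rectEnergy_const h hβ hF hP₁ hq haM (eqOnFaces_planar (w := fun _ _ => a) h ?_ ?_)
    · exact fun q hq' => ⟨haa _ le_rfl q (Ioo_subset_Icc_self hq'),
        haa _ hP₁ q (Ioo_subset_Icc_self hq')⟩
    · exact fun p hp' => ⟨haa _ hp'.1.le _ (left_mem_Icc.2 hq),
        haa _ hp'.1.le _ (right_mem_Icc.2 hq)⟩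
  have s1 := rectEnergy_split_right (F := F) (M := M) (p₀ := -P) (p₁ := P) h hg hQ₀ (hq.trans hQ₁)
  have s2 := rectEnergy_split_right (F := F) (M := M) (p₀ := -P) (p₁ := P) h hg hq hQ₁
  have s3 := rectEnergy_split_left (F := F) (M := M) (q₀ := q₀) (q₁ := q₁) h hg hP₀ (hp.trans hP₁)
  have s4 := rectEnergy_split_left (F := F) (M := M) (q₀ := q₀) (q₁ := q₁) h hg hp hP₁
  rw [hl, zero_add] at s3
  rw [hr, add_zero] at s4
  refine s1.trans ((add_le_add hE₀ (s2.trans (add_le_add (s3.trans s4) hE₁))).trans_eq ?_)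
  ring

lemma rectEnergy_profile_le (h : Orthonormal ℝ ![ν₁, ν₂]) (hβ : 0 ≤ β)
    (hF : ∀ᵐ x, ∀ ξ, F x ξ ≤ β * ‖ξ‖) (hMc : IsCompact M)
    (hγ : γ ∈ geodesicProfiles M a b) (hD : geodesicDist M a b < ⊤) (hp : p₀ ≤ p₁) (hq : q₀ ≤ q₁) :
    rectEnergy F M ν₁ ν₂ p₀ p₁ q₀ q₁ (fun x => γ ⟪x.1, ν₁⟫) ≤
      ENNReal.ofReal (β * (q₁ - q₀)) * geodesicDist M a b := by
  have e : (fun x : Pt => γ ⟪x.1, ν₁⟫) =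
      planar ν₁ ν₂ (transition γ a b (fun _ => 0) fun _ => 1) := by
    funext x
    simp only [planar]
    rw [transition_eq_profile rfl rfl]
  rw [e]
  refine (rectEnergy_transition_le (c₀ := 0) (c₁ := 0) (d₀ := 1) (d₁ := 0) h hβ hF hp hq hMc hγ hD
    measurable_const measurable_const (by simp) (by simp) (by simp) (by simp)).trans_eq ?_
  simp

/-- From a jump on a square to the profile on a larger one: in the shell between them, the width of
the transition grows linearly from `0` to `1`. -/
lemma squareEnergy_profile_le_jump (h : Orthonormal ℝ ![ν₁, ν₂]) (hβ : 0 ≤ β)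
    (hF : ∀ᵐ x, ∀ ξ, F x ξ ≤ β * ‖ξ‖) (hMc : IsCompact M)
    (hγ : γ ∈ geodesicProfiles M a b) (hD : geodesicDist M a b < ⊤) (ht : 1 ≤ t) :
    squareEnergy F M ν₁ ν₂ (t + 2) (fun x => γ ⟪x.1, ν₁⟫) ≤
      squareEnergy F M ν₁ ν₂ t (jumpProfile a b ν₁) +
        ENNReal.ofReal (4 * β) * geodesicDist M a b := by
  obtain ⟨δ, hδ⟩ : ∃ δ : ℝ → ℝ, δ = fun q => max (|q| - t / 2) 0 := ⟨_, rfl⟩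
  have hδm : Measurable δ := by rw [hδ]; fun_prop
  have hlow : ∀ q ∈ Icc (-((t + 2) / 2)) (-(t / 2)), δ q = -(t / 2) + (-1) * q := fun q hq => by
    have := hq.2
    rw [hδ]; simp only
    rw [abs_of_nonpos (by linarith), max_eq_left (by linarith)]; ring
  have hup : ∀ q ∈ Icc (t / 2) ((t + 2) / 2), δ q = -(t / 2) + 1 * q := fun q hq => by
    have := hq.1
    rw [hδ]; simp only
    rw [abs_of_nonneg (by linarith), max_eq_left (by linarith)]; ring
  have hmid : ∀ q ∈ Icc (-(t / 2)) (t / 2), δ q = 0 := fun q hq => by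
    rw [hδ]; exact max_eq_right (by linarith [abs_le.2 hq])
  have hd0 : ∀ q, 0 ≤ δ q := fun q => by rw [hδ]; exact le_max_right _ _
  have hd1 : ∀ q ∈ Icc (-((t + 2) / 2)) ((t + 2) / 2), δ q ≤ 1 := fun q hq => by
    rw [hδ]; exact max_le (by linarith [abs_le.2 hq]) zero_le_one
  have hd2 : ∀ q, |q| = (t + 2) / 2 → δ q = 1 := fun q hq => by
    rw [hδ]; simp only [hq]
    rw [max_eq_left (by linarith)]; ring
  have e1 : squareEnergy F M ν₁ ν₂ (t + 2) (fun x => γ ⟪x.1, ν₁⟫) =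
      rectEnergy F M ν₁ ν₂ (-((t + 2) / 2)) ((t + 2) / 2) (-((t + 2) / 2)) ((t + 2) / 2)
        (planar ν₁ ν₂ (transition γ a b (fun _ => 0) δ)) := by
    refine rectEnergy_congr (profile_eq_planar (ν₂ := ν₂) ▸ eqOnFaces_planar h ?_ ?_)
    · intro q hq
      have := hd1 q (Ioo_subset_Icc_self hq)
      rw [transition_of_ge hγ (by linarith) (by linarith),
        transition_of_le hγ (by linarith) (by linarith), hγ.2.2.1 ((t + 2) / 2) (by linarith),
        hγ.2.2.2.1 (-((t + 2) / 2)) (by linarith)]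
      exact ⟨rfl, rfl⟩
    · intro p _
      rw [transition_eq_profile rfl (hd2 _ (by rw [abs_neg, abs_of_pos (by linarith)])),
        transition_eq_profile rfl (hd2 _ (abs_of_pos (by linarith)))]
      exact ⟨rfl, rfl⟩
  have e2 : squareEnergy F M ν₁ ν₂ t (jumpProfile a b ν₁) =
      rectEnergy F M ν₁ ν₂ (-(t / 2)) (t / 2) (-(t / 2)) (t / 2)
        (planar ν₁ ν₂ (transition γ a b (fun _ => 0) δ)) := by
    have hv : ∀ p, ∀ q ∈ Icc (-(t / 2)) (t / 2),
        transition γ a b (fun _ => 0) (fun _ => 0) p q = transition γ a b (fun _ => 0) δ p q :=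
      fun p q hq => by simp [transition, hmid q hq]
    rw [jumpProfile_eq (ν₂ := ν₂) γ]
    refine rectEnergy_congr (eqOnFaces_planar h ?_ ?_)
    · exact fun q hq => ⟨hv _ q (Ioo_subset_Icc_self hq), hv _ q (Ioo_subset_Icc_self hq)⟩
    · exact fun p _ => ⟨hv _ _ (left_mem_Icc.2 (by linarith)),
        hv _ _ (right_mem_Icc.2 (by linarith))⟩
  rw [e1, e2]
  have b0 := rectEnergy_transition_le (p₀ := -((t + 2) / 2)) (p₁ := (t + 2) / 2) (c₀ := 0) (c₁ := 0)
    (c := fun _ => 0) h hβ hF (by linarith) (by linarith) hMc hγ hD measurable_const hδm (by simp)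
    hlow (fun q _ => hd0 q) fun q hq => by
      rw [hlow q (Ioo_subset_Icc_self hq)]; linarith [hq.2]
  have b1 := rectEnergy_transition_le (p₀ := -((t + 2) / 2)) (p₁ := (t + 2) / 2) (c₀ := 0) (c₁ := 0)
    (c := fun _ => 0) h hβ hF (by linarith) (by linarith) hMc hγ hD measurable_const hδm (by simp)
    hup (fun q _ => hd0 q) fun q hq => by
      rw [hup q (Ioo_subset_Icc_self hq)]; linarith [hq.1]
  refine (rectEnergy_transition_frame (p₀ := -(t / 2)) (p₁ := t / 2) h hβ hF hMc hγ
    measurable_const hδm (by linarith)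
    (by linarith) (by linarith) (by linarith) (by linarith) (by linarith) ?_ ?_ b0 b1).trans_eq ?_
  · intro q hq; rw [hmid q hq]; constructor <;> linarith
  · intro q hq; rw [hmid q hq]; constructor <;> linarith
  · congr 1
    rw [← add_mul, ← ENNReal.ofReal_add]
    · congr 2
      simp; ring
    · simp only [abs_zero, abs_neg, abs_one]; ring_nf; positivity
    · simp only [abs_zero, abs_one]; ring_nf; positivity

/-- From the profile on a square to a jump on a larger one: in the shell between them, the width of
the transition decreases linearly from `1` to `0`. -/
lemma squareEnergy_jump_le_profile (h : Orthonormal ℝ ![ν₁, ν₂]) (hβ : 0 ≤ β)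
    (hF : ∀ᵐ x, ∀ ξ, F x ξ ≤ β * ‖ξ‖) (hMc : IsCompact M)
    (hγ : γ ∈ geodesicProfiles M a b) (hD : geodesicDist M a b < ⊤) (ht : 1 ≤ t) :
    squareEnergy F M ν₁ ν₂ (t + 2) (jumpProfile a b ν₁) ≤
      squareEnergy F M ν₁ ν₂ t (fun x => γ ⟪x.1, ν₁⟫) +
        ENNReal.ofReal (4 * β) * geodesicDist M a b := by
  obtain ⟨δ, hδ⟩ : ∃ δ : ℝ → ℝ, δ = fun q => min 1 (t / 2 + 1 - |q|) := ⟨_, rfl⟩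
  have hδm : Measurable δ := by rw [hδ]; fun_prop
  have hlow : ∀ q ∈ Icc (-((t + 2) / 2)) (-(t / 2)), δ q = t / 2 + 1 + 1 * q := fun q hq => by
    have := hq.2
    rw [hδ]; simp only
    rw [abs_of_nonpos (by linarith), min_eq_right (by linarith)]; ring
  have hup : ∀ q ∈ Icc (t / 2) ((t + 2) / 2), δ q = t / 2 + 1 + (-1) * q := fun q hq => by
    have := hq.1
    rw [hδ]; simp only
    rw [abs_of_nonneg (by linarith), min_eq_right (by linarith)]; ring
  have hmid : ∀ q ∈ Icc (-(t / 2)) (t / 2), δ q = 1 := fun q hq => by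
    rw [hδ]; exact min_eq_left (by linarith [abs_le.2 hq])
  have hd1 : ∀ q, δ q ≤ 1 := fun q => by rw [hδ]; exact min_le_left _ _
  have hd2 : ∀ q, |q| = (t + 2) / 2 → δ q = 0 := fun q hq => by
    rw [hδ]; simp only [hq]
    rw [min_eq_right (by linarith)]; ring
  have e1 : squareEnergy F M ν₁ ν₂ (t + 2) (jumpProfile a b ν₁) =
      rectEnergy F M ν₁ ν₂ (-((t + 2) / 2)) ((t + 2) / 2) (-((t + 2) / 2)) ((t + 2) / 2)
        (planar ν₁ ν₂ (transition γ a b (fun _ => 0) δ)) := by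
    rw [jumpProfile_eq (ν₂ := ν₂) γ]
    refine rectEnergy_congr (eqOnFaces_planar h ?_ ?_)
    · intro q _
      have := hd1 q
      constructor
      · rw [transition_of_ge hγ (by linarith) (by linarith),
          transition_of_ge hγ (by linarith) (by linarith)]
      · rw [transition_of_le hγ (by linarith) (by linarith),
          transition_of_le hγ (by linarith) (by linarith)]
    · intro p _
      simp [transition, hd2 (-((t + 2) / 2)) (by rw [abs_neg, abs_of_pos (by linarith)]),
        hd2 ((t + 2) / 2) (abs_of_pos (by linarith))]
  have e2 : squareEnergy F M ν₁ ν₂ t (fun x => γ ⟪x.1, ν₁⟫) =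
      rectEnergy F M ν₁ ν₂ (-(t / 2)) (t / 2) (-(t / 2)) (t / 2)
        (planar ν₁ ν₂ (transition γ a b (fun _ => 0) δ)) := by
    have hv : ∀ p, ∀ q ∈ Icc (-(t / 2)) (t / 2), γ p = transition γ a b (fun _ => 0) δ p q :=
      fun p q hq => (transition_eq_profile rfl (hmid q hq)).symm
    refine rectEnergy_congr (profile_eq_planar (ν₂ := ν₂) ▸ eqOnFaces_planar h ?_ ?_)
    · exact fun q hq => ⟨hv _ q (Ioo_subset_Icc_self hq), hv _ q (Ioo_subset_Icc_self hq)⟩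
    · exact fun p _ => ⟨hv _ _ (left_mem_Icc.2 (by linarith)),
        hv _ _ (right_mem_Icc.2 (by linarith))⟩
  rw [e1, e2]
  have b0 := rectEnergy_transition_le (p₀ := -((t + 2) / 2)) (p₁ := (t + 2) / 2) (c₀ := 0) (c₁ := 0)
    (c := fun _ => 0) h hβ hF (by linarith) (by linarith) hMc hγ hD measurable_const hδm (by simp)
    hlow (fun q hq => by rw [hlow q hq]; linarith [hq.1]) fun q hq => by
      rw [hlow q (Ioo_subset_Icc_self hq)]; linarith [hq.1]
  have b1 := rectEnergy_transition_le (p₀ := -((t + 2) / 2)) (p₁ := (t + 2) / 2) (c₀ := 0) (c₁ := 0)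
    (c := fun _ => 0) h hβ hF (by linarith) (by linarith) hMc hγ hD measurable_const hδm (by simp)
    hup (fun q hq => by rw [hup q hq]; linarith [hq.2]) fun q hq => by
      rw [hup q (Ioo_subset_Icc_self hq)]; linarith [hq.2]
  refine (rectEnergy_transition_frame (p₀ := -(t / 2)) (p₁ := t / 2) h hβ hF hMc hγ
    measurable_const hδm (by linarith)
    (by linarith) (by linarith) (by linarith) (by linarith) (by linarith) ?_ ?_ b0 b1).trans_eq ?_
  · intro q hq; rw [hmid q hq]; constructor <;> linarith
  · intro q hq; rw [hmid q hq]; constructor <;> linarith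
  · congr 1
    rw [← add_mul, ← ENNReal.ofReal_add]
    · congr 2
      simp; ring
    · simp only [abs_zero, abs_one]; ring_nf; positivity
    · simp only [abs_zero, abs_neg, abs_one]; ring_nf; positivity

end

/-! ### Approximate subadditivity -/

noncomputable section

variable {ν₁ ν₂ : Plane} {M : Set Target} {F : Pt → Mat33 → ℝ} {t β P : ℝ}
  {a b : Target} {γ : ℝ → Target}

lemma exists_integer_point (h : Orthonormal ℝ ![ν₁, ν₂]) (r : ℝ) :
    ∃ z : Plane, (∀ i, ∃ n : ℤ, z i = n) ∧ |⟪z, ν₁⟫| ≤ 1 ∧ |⟪z, ν₂⟫ - r| ≤ 1 := by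
  obtain ⟨h11, h22, h12, h21⟩ := inner_frame h
  have hn1 : ‖ν₁‖ = 1 := h.1 0
  have hn2 : ‖ν₂‖ = 1 := h.1 1
  obtain ⟨z, hz⟩ : ∃ z : Plane, z = WithLp.toLp 2 fun i => (round (r * ν₂ i) : ℝ) := ⟨_, rfl⟩
  have hy : ‖z - r • ν₂‖ ≤ 1 := by
    rw [EuclideanSpace.norm_eq, Fin.sum_univ_two]
    refine Real.sqrt_le_one.2 ?_
    have hi : ∀ i, ‖(z - r • ν₂) i‖ ^ 2 ≤ 1 / 4 := fun i => by
      have h1 : |(z - r • ν₂) i| ≤ 1 / 2 := by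
        have h2 := abs_sub_round (r * ν₂ i)
        rw [abs_sub_comm] at h2
        rw [hz]
        exact h2
      rw [Real.norm_eq_abs]
      nlinarith [abs_nonneg ((z - r • ν₂) i)]
    linarith [hi 0, hi 1]
  refine ⟨z, fun i => ⟨round (r * ν₂ i), by rw [hz]⟩, ?_, ?_⟩
  · have := abs_real_inner_le_norm (z - r • ν₂) ν₁
    rw [inner_sub_left, real_inner_smul_left, h21, mul_zero, sub_zero, hn1, mul_one] at this
    exact this.trans hy
  · have := abs_real_inner_le_norm (z - r • ν₂) ν₂
    rw [inner_sub_left, real_inner_smul_left, h22, mul_one, hn2, mul_one] at this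
    exact this.trans hy

/-- A cell of height `t + 4` contains an integer translate `z + t Q_ν` of the square, off the line
`x_α·ν₁ = 0` by at most `1`. The transition is made to follow this translate by moving its centre
linearly from `0` to `z·ν₁` and back, in strips of height at least `1`. -/
lemma rectEnergy_cell_le (h : Orthonormal ℝ ![ν₁, ν₂]) (hβ : 0 ≤ β)
    (hF : ∀ᵐ x, ∀ ξ, F x ξ ≤ β * ‖ξ‖)
    (hper : ∀ z : Plane, (∀ i, ∃ n : ℤ, z i = n) → ∀ x ξ, F (x.1 + z, x.2) ξ = F x ξ)
    (hMc : IsCompact M)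
    (hγ : γ ∈ geodesicProfiles M a b) (hD : geodesicDist M a b < ⊤) (ht : 1 ≤ t)
    (hP : t / 2 + 1 ≤ P) (k : ℝ) :
    rectEnergy F M ν₁ ν₂ (-P) P k (k + (t + 4)) (fun x => γ ⟪x.1, ν₁⟫) ≤
      squareEnergy F M ν₁ ν₂ t (fun x => γ ⟪x.1, ν₁⟫) +
        ENNReal.ofReal (8 * β) * geodesicDist M a b := by
  obtain ⟨z, hz, hs, hzq⟩ := exists_integer_point h (k + (t / 2 + 2))
  obtain ⟨s, hsd⟩ : ∃ s, s = ⟪z, ν₁⟫ := ⟨_, rfl⟩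
  obtain ⟨m, hmd⟩ : ∃ m, m = ⟪z, ν₂⟫ := ⟨_, rfl⟩
  rw [← hsd] at hs
  rw [← hmd] at hzq
  obtain ⟨hs1, hs2⟩ := abs_le.1 hs
  obtain ⟨hm1, hm2⟩ := abs_le.1 hzq
  obtain ⟨A, hA⟩ : ∃ A, A = m - t / 2 - k := ⟨_, rfl⟩
  obtain ⟨B, hB⟩ : ∃ B, B = k + (t + 4) - (m + t / 2) := ⟨_, rfl⟩
  have hA1 : 1 ≤ A := by linarith
  have hB1 : 1 ≤ B := by linarith
  have hA0 : 0 < A := by linarith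
  have hB0 : 0 < B := by linarith
  obtain ⟨c, hc⟩ : ∃ c : ℝ → ℝ, c = fun q =>
      s * min 1 (min ((q - k) / A) ((k + (t + 4) - q) / B)) := ⟨_, rfl⟩
  have hcm : Measurable c := by rw [hc]; fun_prop
  have hlow : ∀ q ∈ Icc k (m - t / 2), c q = -(s * k / A) + s / A * q := fun q hq => by
    have h1 : (q - k) / A ≤ 1 := by rw [div_le_one hA0]; linarith [hq.2]
    have h2 : 1 ≤ (k + (t + 4) - q) / B := by rw [one_le_div hB0]; linarith [hq.2]
    rw [hc]; simp only
    rw [min_eq_left (h1.trans h2), min_eq_right h1]; field_simp; ring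
  have hup : ∀ q ∈ Icc (m + t / 2) (k + (t + 4)),
      c q = s * (k + (t + 4)) / B + -(s / B) * q := fun q hq => by
    have h1 : 1 ≤ (q - k) / A := by rw [one_le_div hA0]; linarith [hq.1]
    have h2 : (k + (t + 4) - q) / B ≤ 1 := by rw [div_le_one hB0]; linarith [hq.1]
    rw [hc]; simp only
    rw [min_eq_right (h2.trans h1), min_eq_right h2]; field_simp; ring
  have hmid : ∀ q ∈ Icc (m - t / 2) (m + t / 2), c q = s := fun q hq => by
    have h1 : 1 ≤ (q - k) / A := by rw [one_le_div hA0]; linarith [hq.1]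
    have h2 : 1 ≤ (k + (t + 4) - q) / B := by rw [one_le_div hB0]; linarith [hq.2]
    rw [hc]; simp only
    rw [min_eq_left (le_min h1 h2), mul_one]
  have hbound : ∀ q ∈ Icc k (k + (t + 4)), |c q| ≤ 1 := fun q hq => by
    have h1 : 0 ≤ (q - k) / A := div_nonneg (by linarith [hq.1]) hA0.le
    have h2 : 0 ≤ (k + (t + 4) - q) / B := div_nonneg (by linarith [hq.2]) hB0.le
    rw [hc]; simp only
    rw [abs_mul, abs_of_nonneg (le_min zero_le_one (le_min h1 h2))]
    exact mul_le_one₀ hs (le_min zero_le_one (le_min h1 h2)) (min_le_left _ _)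
  have hend : c k = 0 ∧ c (k + (t + 4)) = 0 := by
    rw [hlow k ⟨le_rfl, by linarith⟩, hup (k + (t + 4)) ⟨by linarith, le_rfl⟩]
    constructor <;> field_simp <;> ring
  have e1 : rectEnergy F M ν₁ ν₂ (-P) P k (k + (t + 4)) (fun x => γ ⟪x.1, ν₁⟫) =
      rectEnergy F M ν₁ ν₂ (-P) P k (k + (t + 4))
        (planar ν₁ ν₂ (transition γ a b c fun _ => 1)) := by
    refine rectEnergy_congr (profile_eq_planar (ν₂ := ν₂) ▸ eqOnFaces_planar h ?_ ?_)
    · intro q hq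
      obtain ⟨hc1, hc2⟩ := abs_le.1 (hbound q (Ioo_subset_Icc_self hq))
      rw [transition_of_ge hγ (by linarith) (by linarith),
        transition_of_le hγ (by linarith) (by linarith), hγ.2.2.1 P (by linarith),
        hγ.2.2.2.1 (-P) (by linarith)]
      exact ⟨rfl, rfl⟩
    · intro p _
      rw [transition_eq_profile hend.1 rfl, transition_eq_profile hend.2 rfl]
      exact ⟨rfl, rfl⟩
  have e2 : rectEnergy F M ν₁ ν₂ (-(t / 2) + s) (t / 2 + s) (m - t / 2) (m + t / 2)
      (planar ν₁ ν₂ (transition γ a b c fun _ => 1)) ≤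
        squareEnergy F M ν₁ ν₂ t (fun x => γ ⟪x.1, ν₁⟫) := by
    have hsh := rectEnergy_shift_le (M := M) (p₀ := -(t / 2)) (p₁ := t / 2) (q₀ := -(t / 2))
      (q₁ := t / 2) (g := fun x => γ ⟪x.1, ν₁⟫) h (hper z hz)
    have hg : (fun x : Pt => γ ⟪x.1 - z, ν₁⟫) = planar ν₁ ν₂ fun p _ => γ (p - s) := by
      funext x; simp only [planar, inner_sub_left, hsd]
    simp only [hg, ← hsd, ← hmd] at hsh
    have hv : ∀ p, ∀ q ∈ Icc (m - t / 2) (m + t / 2),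
        transition γ a b c (fun _ => 1) p q = γ (p - s) := fun p q hq => by
      rw [transition_of_pos one_pos, hmid q hq, div_one]
    have i1 : -(t / 2) + m = m - t / 2 := by ring
    have i2 : t / 2 + m = m + t / 2 := by ring
    rw [i1, i2] at hsh
    refine (rectEnergy_congr (eqOnFaces_planar h ?_ ?_)).trans_le hsh
    · exact fun q hq => ⟨hv _ q (Ioo_subset_Icc_self hq), hv _ q (Ioo_subset_Icc_self hq)⟩
    · exact fun p _ => ⟨hv _ _ (left_mem_Icc.2 (by linarith)),
        hv _ _ (right_mem_Icc.2 (by linarith))⟩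
  rw [e1]
  have slope : ∀ L : ℝ, 1 ≤ L → |s / L| ≤ 1 := fun L hL => by
    rw [abs_div, abs_of_pos (by linarith : (0 : ℝ) < L)]
    exact (div_le_one (by linarith)).2 (hs.trans hL)
  have b0 : rectEnergy F M ν₁ ν₂ (-P) P k (m - t / 2)
      (planar ν₁ ν₂ (transition γ a b c fun _ => 1)) ≤
      ENNReal.ofReal (β * 2 * A) * geodesicDist M a b := by
    refine (rectEnergy_transition_le (d₀ := 1) (d₁ := 0) h hβ hF (by linarith) (by linarith) hMc hγ
      hD hcm measurable_const hlow (by simp) (by simp) (by simp)).trans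
      (mul_le_mul_left (ENNReal.ofReal_le_ofReal ?_) _)
    rw [abs_zero, ← hA]
    exact mul_le_mul_of_nonneg_right
      (mul_le_mul_of_nonneg_left (by linarith [slope A hA1]) hβ) hA0.le
  have b1 : rectEnergy F M ν₁ ν₂ (-P) P (m + t / 2) (k + (t + 4))
      (planar ν₁ ν₂ (transition γ a b c fun _ => 1)) ≤
      ENNReal.ofReal (β * 2 * B) * geodesicDist M a b := by
    refine (rectEnergy_transition_le (d₀ := 1) (d₁ := 0) h hβ hF (by linarith) (by linarith) hMc hγ
      hD hcm measurable_const hup (by simp) (by simp) (by simp)).trans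
      (mul_le_mul_left (ENNReal.ofReal_le_ofReal ?_) _)
    rw [abs_zero, abs_neg, ← hB]
    exact mul_le_mul_of_nonneg_right
      (mul_le_mul_of_nonneg_left (by linarith [slope B hB1]) hβ) hB0.le
  refine (rectEnergy_transition_frame (p₀ := -(t / 2) + s) (p₁ := t / 2 + s) h hβ hF hMc hγ hcm
    measurable_const (by linarith) (by linarith) (by linarith) (by linarith) (by linarith)
    (by linarith) ?_ ?_ b0 b1).trans ?_
  · intro q hq; rw [hmid q hq]; constructor <;> linarith
  · intro q hq; rw [hmid q hq]; constructor <;> linarith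
  · refine add_le_add e2 (le_of_eq ?_)
    rw [← add_mul, ← ENNReal.ofReal_add (by positivity) (by positivity)]
    congr 2
    rw [hA, hB]; ring

/-- The energy of a column of cells. -/
lemma rectEnergy_stack_le (h : Orthonormal ℝ ![ν₁, ν₂]) (hβ : 0 ≤ β)
    (hF : ∀ᵐ x, ∀ ξ, F x ξ ≤ β * ‖ξ‖)
    (hper : ∀ z : Plane, (∀ i, ∃ n : ℤ, z i = n) → ∀ x ξ, F (x.1 + z, x.2) ξ = F x ξ)
    (hMc : IsCompact M)
    (hγ : γ ∈ geodesicProfiles M a b) (hD : geodesicDist M a b < ⊤) (ht : 1 ≤ t)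
    (hP : t / 2 + 1 ≤ P) (k : ℝ) (n : ℕ) :
    rectEnergy F M ν₁ ν₂ (-P) P k (k + n * (t + 4)) (fun x => γ ⟪x.1, ν₁⟫) ≤
      n * (squareEnergy F M ν₁ ν₂ t (fun x => γ ⟪x.1, ν₁⟫) +
        ENNReal.ofReal (8 * β) * geodesicDist M a b) := by
  have hg : IsBddBorel fun x : Pt => γ ⟪x.1, ν₁⟫ := by
    simpa using isBddBorel_profile (ν₁ := ν₁) hMc hγ 1
  induction n with
  | zero =>
    refine (rectEnergy_profile_le h hβ hF hMc hγ hD (by linarith) (by simp)).trans ?_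
    simp
  | succ n ih =>
    have hn : (0 : ℝ) ≤ n * (t + 4) := by positivity
    have e : k + ((n + 1 : ℕ) : ℝ) * (t + 4) = k + n * (t + 4) + (t + 4) := by push_cast; ring
    rw [e]
    refine (rectEnergy_split_right h hg (q₁ := k + n * (t + 4)) (by linarith)
      (by linarith)).trans ?_
    refine (add_le_add ih (rectEnergy_cell_le h hβ hF hper hMc hγ hD ht hP _)).trans_eq ?_
    push_cast
    ring

/-- Approximate subadditivity of the minimal energy on squares with boundary values given by a
profile. -/
lemma squareEnergy_subadditive (h : Orthonormal ℝ ![ν₁, ν₂]) (hβ : 0 ≤ β)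
    (hF : ∀ᵐ x, ∀ ξ, F x ξ ≤ β * ‖ξ‖)
    (hper : ∀ z : Plane, (∀ i, ∃ n : ℤ, z i = n) → ∀ x ξ, F (x.1 + z, x.2) ξ = F x ξ)
    (hMc : IsCompact M)
    (hγ : γ ∈ geodesicProfiles M a b) (hD : geodesicDist M a b < ⊤) (ht : 1 ≤ t) {T : ℝ}
    (hT : t + 2 ≤ T) :
    squareEnergy F M ν₁ ν₂ T (fun x => γ ⟪x.1, ν₁⟫) ≤ ENNReal.ofReal (T / t) *
      (squareEnergy F M ν₁ ν₂ t (fun x => γ ⟪x.1, ν₁⟫) +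
        ENNReal.ofReal (8 * β) * geodesicDist M a b) +
      ENNReal.ofReal (β * (t + 4)) * geodesicDist M a b := by
  have hg : IsBddBorel fun x : Pt => γ ⟪x.1, ν₁⟫ := by
    simpa using isBddBorel_profile (ν₁ := ν₁) hMc hγ 1
  have hl : (0 : ℝ) < t + 4 := by linarith
  obtain ⟨n, hn⟩ : ∃ n : ℕ, n = ⌊T / (t + 4)⌋₊ := ⟨_, rfl⟩
  have hn1 : (n : ℝ) * (t + 4) ≤ T := by
    rw [← le_div_iff₀ hl, hn]; exact Nat.floor_le (div_nonneg (by linarith) hl.le)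
  have hn2 : T ≤ n * (t + 4) + (t + 4) := by
    have := (Nat.lt_floor_add_one (T / (t + 4))).le
    rw [div_le_iff₀ hl, ← hn] at this
    linarith
  have hn3 : (n : ℝ≥0∞) ≤ ENNReal.ofReal (T / t) := by
    rw [← ENNReal.ofReal_natCast]
    refine ENNReal.ofReal_le_ofReal ?_
    rw [le_div_iff₀ (by linarith)]
    exact (mul_le_mul_of_nonneg_left (by linarith) n.cast_nonneg).trans hn1
  have hn4 : (0 : ℝ) ≤ n * (t + 4) := by positivity
  refine (rectEnergy_split_right h hg (q₁ := -(T / 2) + n * (t + 4)) (by linarith)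
    (by linarith)).trans (add_le_add ?_ ?_)
  · exact (rectEnergy_stack_le h hβ hF hper hMc hγ hD ht (by linarith) _ n).trans
      (mul_le_mul_left hn3 _)
  · refine (rectEnergy_profile_le h hβ hF hMc hγ hD (by linarith) (by linarith)).trans
      (mul_le_mul_left (ENNReal.ofReal_le_ofReal (mul_le_mul_of_nonneg_left ?_ hβ)) _)
    linarith

/-- A Fekete lemma for approximately subadditive functions of a real variable. -/
lemma exists_tendsto_div_of_subadditive {w : ℝ → ℝ} {K : ℝ} (hK : 0 ≤ K) (hw : ∀ t, 0 ≤ w t)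
    {L : ℝ → ℝ}
    (hsub : ∀ t ≥ 1, ∀ T ≥ t + 2, w T ≤ T / t * (w t + K) + L t) :
    ∃ θ : ℝ, 0 ≤ θ ∧ Tendsto (fun T => w T / T) atTop (𝓝 θ) := by
  obtain ⟨S, hS⟩ : ∃ S : Set ℝ, S = (fun t => (w t + K) / t) '' Ici 1 := ⟨_, rfl⟩
  have hne : S.Nonempty := by rw [hS]; exact (nonempty_Ici).image _
  have hS0 : ∀ x ∈ S, 0 ≤ x := by
    rw [hS]
    rintro x ⟨t, ht, rfl⟩
    have ht' : (1 : ℝ) ≤ t := ht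
    have := hw t
    positivity
  have hbdd : BddBelow S := ⟨0, fun x hx => hS0 x hx⟩
  refine ⟨sInf S, le_csInf hne hS0, tendsto_order.2 ⟨fun r hr => ?_, fun r hr => ?_⟩⟩
  · have hlim : Tendsto (fun T : ℝ => sInf S - K / T) atTop (𝓝 (sInf S - 0)) :=
      tendsto_const_nhds.sub (tendsto_const_nhds.div_atTop tendsto_id)
    rw [sub_zero] at hlim
    filter_upwards [hlim.eventually (lt_mem_nhds hr), eventually_ge_atTop 1] with T h1 h2
    have h3 : sInf S ≤ (w T + K) / T := csInf_le hbdd (by rw [hS]; exact ⟨T, h2, rfl⟩)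
    rw [add_div] at h3
    linarith
  · obtain ⟨x, hx, hxr⟩ := exists_lt_of_csInf_lt hne hr
    rw [hS] at hx
    obtain ⟨t, ht, rfl⟩ := hx
    have ht' : (1 : ℝ) ≤ t := ht
    have hlim : Tendsto (fun T : ℝ => (w t + K) / t + L t / T) atTop (𝓝 ((w t + K) / t + 0)) :=
      tendsto_const_nhds.add (tendsto_const_nhds.div_atTop tendsto_id)
    rw [add_zero] at hlim
    filter_upwards [hlim.eventually (gt_mem_nhds hxr), eventually_ge_atTop (t + 2)] with T h1 h2
    have hT : 0 < T := by linarith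
    refine lt_of_le_of_lt ?_ h1
    rw [div_le_iff₀ hT]
    refine (hsub t ht T h2).trans_eq ?_
    field_simp

end

/-! ### The limit -/

noncomputable section

variable {ν₁ ν₂ ν₂' : Plane} {M : Set Target} {F f : Pt → Mat33 → ℝ} {t β θ : ℝ}
  {a b : Target} {γ : ℝ → Target}

lemma squareEnergy_profile_lt_top (h : Orthonormal ℝ ![ν₁, ν₂]) (hβ : 0 ≤ β)
    (hF : ∀ᵐ x, ∀ ξ, F x ξ ≤ β * ‖ξ‖) (hMc : IsCompact M)
    (hγ : γ ∈ geodesicProfiles M a b) (hD : geodesicDist M a b < ⊤) (ht : 0 ≤ t) :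
    squareEnergy F M ν₁ ν₂ t (fun x => γ ⟪x.1, ν₁⟫) < ⊤ :=
  (rectEnergy_profile_le h hβ hF hMc hγ hD (by linarith) (by linarith)).trans_lt
    (ENNReal.mul_lt_top ENNReal.ofReal_lt_top hD)

/-- The minimal energies with boundary values given by a profile grow linearly. -/
lemma exists_tendsto_squareEnergy (h : Orthonormal ℝ ![ν₁, ν₂]) (hβ : 0 ≤ β)
    (hF : ∀ᵐ x, ∀ ξ, F x ξ ≤ β * ‖ξ‖)
    (hper : ∀ z : Plane, (∀ i, ∃ n : ℤ, z i = n) → ∀ x ξ, F (x.1 + z, x.2) ξ = F x ξ)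
    (hMc : IsCompact M) (hγ : γ ∈ geodesicProfiles M a b) (hD : geodesicDist M a b < ⊤) :
    ∃ θ : ℝ, 0 ≤ θ ∧ Tendsto
      (fun T => (squareEnergy F M ν₁ ν₂ T fun x => γ ⟪x.1, ν₁⟫).toReal / T) atTop (𝓝 θ) := by
  refine exists_tendsto_div_of_subadditive
    (K := (ENNReal.ofReal (8 * β) * geodesicDist M a b).toReal)
    (L := fun t => (ENNReal.ofReal (β * (t + 4)) * geodesicDist M a b).toReal)
    ENNReal.toReal_nonneg (fun t => ENNReal.toReal_nonneg) fun t ht T hT => ?_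
  have hfin : ∀ r : ℝ, ENNReal.ofReal r * geodesicDist M a b ≠ ⊤ := fun r =>
    (ENNReal.mul_lt_top ENNReal.ofReal_lt_top hD).ne
  have ht' : (0 : ℝ) ≤ t := by linarith [show (1 : ℝ) ≤ t from ht]
  have hw := (squareEnergy_profile_lt_top h hβ hF hMc hγ hD ht').ne
  have hTt : 0 ≤ T / t := div_nonneg (by linarith [show t + 2 ≤ T from hT]) ht'
  have hsub := squareEnergy_subadditive h hβ hF hper hMc hγ hD ht hT
  have hR := ENNReal.mul_ne_top (ENNReal.ofReal_ne_top (r := T / t))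
    (ENNReal.add_ne_top.2 ⟨hw, hfin (8 * β)⟩)
  have := ENNReal.toReal_mono (ENNReal.add_ne_top.2 ⟨hR, hfin (β * (t + 4))⟩) hsub
  rwa [ENNReal.toReal_add hR (hfin _), ENNReal.toReal_mul, ENNReal.toReal_ofReal hTt,
    ENNReal.toReal_add hw (hfin _)] at this

/-- A bounded change of the size of the squares and a bounded error do not matter in the limit. -/
lemma tendsto_shift_div {w : ℝ → ℝ} (hw : Tendsto (fun T => w T / T) atTop (𝓝 θ)) (r K : ℝ) :
    Tendsto (fun t => (w (t + r) + K) / t) atTop (𝓝 θ) := by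
  have h1 : Tendsto (fun t : ℝ => w (t + r) / (t + r)) atTop (𝓝 θ) :=
    hw.comp (tendsto_atTop_add_const_right _ r tendsto_id)
  have h2 : Tendsto (fun t : ℝ => 1 + r / t) atTop (𝓝 (1 + 0)) :=
    tendsto_const_nhds.add (tendsto_const_nhds.div_atTop tendsto_id)
  have h3 : Tendsto (fun t : ℝ => K / t) atTop (𝓝 0) := tendsto_const_nhds.div_atTop tendsto_id
  have := (h1.mul h2).add h3
  rw [add_zero, add_zero, mul_one] at this
  refine this.congr' ?_
  filter_upwards [eventually_gt_atTop 0, eventually_gt_atTop (-r)] with t ht htr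
  have : t + r ≠ 0 := by linarith
  field_simp

/-- The two minimization problems have the same limit as the one with a fixed profile as boundary
values. -/
lemma tendsto_minEnergy (h : Orthonormal ℝ ![ν₁, ν₂]) (hβ : 0 ≤ β)
    (hF : ∀ᵐ x, ∀ ξ, recession f x ξ ≤ β * ‖ξ‖)
    (hMc : IsCompact M) (hγ : γ ∈ geodesicProfiles M a b) (hD : geodesicDist M a b < ⊤)
    (hw : Tendsto (fun T => (squareEnergy (recession f) M ν₁ ν₂ T
      fun x => γ ⟪x.1, ν₁⟫).toReal / T) atTop (𝓝 θ)) :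
    Tendsto (fun t : ℝ => minEnergyA f M a b ν₁ ν₂ t) atTop (𝓝 (ENNReal.ofReal θ)) ∧
      Tendsto (fun h : ℝ => minEnergyB f M a b ν₁ ν₂ h) (𝓝[>] 0) (𝓝 (ENNReal.ofReal θ)) := by
  obtain ⟨w, hwd⟩ : ∃ w : ℝ → ℝ, w = fun T => (squareEnergy (recession f) M ν₁ ν₂ T
      fun x => γ ⟪x.1, ν₁⟫).toReal := ⟨_, rfl⟩
  obtain ⟨K, hK⟩ : ∃ K : ℝ, K = (ENNReal.ofReal (4 * β) * geodesicDist M a b).toReal := ⟨_, rfl⟩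
  have hK0 : 0 ≤ K := by rw [hK]; exact ENNReal.toReal_nonneg
  have hKe : ENNReal.ofReal (4 * β) * geodesicDist M a b = ENNReal.ofReal K := by
    rw [hK, ENNReal.ofReal_toReal (ENNReal.mul_lt_top ENNReal.ofReal_lt_top hD).ne]
  have hw' : Tendsto (fun T => w T / T) atTop (𝓝 θ) := by rw [hwd]; exact hw
  have hw0 : ∀ T, 0 ≤ w T := fun T => by rw [hwd]; exact ENNReal.toReal_nonneg
  have hwe : ∀ T, 0 ≤ T → squareEnergy (recession f) M ν₁ ν₂ T (fun x => γ ⟪x.1, ν₁⟫) =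
      ENNReal.ofReal (w T) := fun T hT => by
    rw [hwd]
    exact (ENNReal.ofReal_toReal (squareEnergy_profile_lt_top h hβ hF hMc hγ hD hT).ne).symm
  have up : ∀ t, 3 ≤ t → squareEnergy (recession f) M ν₁ ν₂ t (jumpProfile a b ν₁) ≤
      ENNReal.ofReal (w (t + -2) + K) := fun t ht => by
    have := squareEnergy_jump_le_profile (t := t + -2) h hβ hF hMc hγ hD (by linarith)
    rwa [neg_add_cancel_right, hwe _ (by linarith), hKe,
      ← ENNReal.ofReal_add (hw0 _) hK0] at this
  have low : ∀ t, 1 ≤ t → ENNReal.ofReal (w (t + 2) + -K) ≤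
      squareEnergy (recession f) M ν₁ ν₂ t (jumpProfile a b ν₁) := fun t ht => by
    have := squareEnergy_profile_le_jump (t := t) h hβ hF hMc hγ hD ht
    rw [hwe _ (by linarith), hKe] at this
    rw [← sub_eq_add_neg, ENNReal.ofReal_sub _ hK0]
    exact tsub_le_iff_right.2 this
  constructor
  · refine tendsto_of_tendsto_of_tendsto_of_le_of_le'
      (ENNReal.tendsto_ofReal (tendsto_shift_div hw' 2 (-K)))
      (ENNReal.tendsto_ofReal (tendsto_shift_div hw' (-2) K)) ?_ ?_
    · filter_upwards [eventually_ge_atTop 1] with t ht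
      rw [minEnergyA_eq h (by linarith), div_eq_inv_mul, ← one_div,
        ENNReal.ofReal_mul (by positivity)]
      exact mul_le_mul_right (low t ht) _
    · filter_upwards [eventually_ge_atTop 3] with t ht
      rw [minEnergyA_eq h (by linarith), div_eq_inv_mul (_ + K), ← one_div,
        ENNReal.ofReal_mul (by positivity)]
      exact mul_le_mul_right (up t ht) _
  · have hom : ∀ s > 0, ∀ x ξ, recession f x (s • ξ) = s * recession f x ξ :=
      fun s hs x ξ => recession_smul f x hs ξ
    refine tendsto_of_tendsto_of_tendsto_of_le_of_le'
      (ENNReal.tendsto_ofReal ((tendsto_shift_div hw' 4 (-(2 * K))).comp tendsto_inv_nhdsGT_zero))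
      (ENNReal.tendsto_ofReal (hw'.comp tendsto_inv_nhdsGT_zero)) ?_ ?_
    · have hev : ∀ᶠ r : ℝ in 𝓝[>] 0, 1 ≤ r⁻¹ :=
        tendsto_inv_nhdsGT_zero.eventually (eventually_ge_atTop 1)
      filter_upwards [hev, self_mem_nhdsWithin] with r hr hr0
      have hr0' : (0 : ℝ) < r := hr0
      refine le_minEnergyB h hMc hr0' hom fun γ' hγ' => ?_
      simp only [Function.comp]
      rw [div_eq_inv_mul, inv_inv, ENNReal.ofReal_mul hr0'.le]
      refine mul_le_mul_right ?_ _
      -- compare the boundary values `γ'` and `γ` through the jump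
      have h1 := low (r⁻¹ + 2) (by linarith)
      have h2 := squareEnergy_jump_le_profile (t := r⁻¹) h hβ hF hMc hγ' hD hr
      have e : w (r⁻¹ + 4) + -(2 * K) = w (r⁻¹ + 2 + 2) + -K - K := by
        rw [show r⁻¹ + 2 + 2 = r⁻¹ + 4 by ring]; ring
      rw [e, ENNReal.ofReal_sub _ hK0]
      rw [hKe] at h2
      exact tsub_le_iff_right.2 (h1.trans h2)
    · filter_upwards [self_mem_nhdsWithin] with r hr0
      have hr0' : (0 : ℝ) < r := hr0
      refine (minEnergyB_le h hMc hr0' hom hγ).trans_eq ?_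
      simp only [Function.comp]
      rw [hwe _ (inv_pos.2 hr0').le, div_eq_inv_mul, inv_inv, ENNReal.ofReal_mul hr0'.le]

lemma frame_unique (h : Orthonormal ℝ ![ν₁, ν₂]) (h' : Orthonormal ℝ ![ν₁, ν₂']) :
    ν₂' = ν₂ ∨ ν₂' = -ν₂ := by
  obtain ⟨-, h22', -, h21'⟩ := inner_frame h'
  obtain ⟨-, h22, -, -⟩ := inner_frame h
  have e := frame_expansion h ν₂'
  rw [h21', zero_smul, zero_add] at e
  have hsq : ⟪ν₂', ν₂⟫ * ⟪ν₂', ν₂⟫ = 1 := by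
    rw [← e, real_inner_smul_left, real_inner_smul_right, h22, mul_one] at h22'
    exact h22'
  rcases mul_self_eq_one_iff.1 hsq with h1 | h1
  · left; rw [← e, h1, one_smul]
  · right; rw [← e, h1, neg_one_smul]

lemma exists_frame (hν₁ : ‖ν₁‖ = 1) : ∃ ν₂ : Plane, Orthonormal ℝ ![ν₁, ν₂] := by
  refine ⟨!₂[-ν₁ 1, ν₁ 0], ?_⟩
  have h0 : ‖(!₂[-ν₁ 1, ν₁ 0] : Plane)‖ = 1 := by
    rw [← hν₁, EuclideanSpace.norm_eq, EuclideanSpace.norm_eq]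
    simp [Fin.sum_univ_two, add_comm]
  rw [orthonormal_vecCons_iff]
  refine ⟨hν₁, fun i => ?_, ?_⟩
  · simp [PiLp.inner_apply, Fin.sum_univ_two]
    ring
  · rw [orthonormal_vecCons_iff]
    exact ⟨h0, fun i => i.elim0, by simp [Orthonormal]⟩

lemma squareEnergy_frame (h : Orthonormal ℝ ![ν₁, ν₂]) (h' : Orthonormal ℝ ![ν₁, ν₂']) (T : ℝ)
    (g : Pt → Target) : squareEnergy F M ν₁ ν₂' T g = squareEnergy F M ν₁ ν₂ T g := by
  rcases frame_unique h h' with rfl | rfl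
  · rfl
  · have := rectEnergy_neg (F := F) (M := M) (ν₁ := ν₁) (ν₂ := ν₂) (p₀ := -(T / 2)) (p₁ := T / 2)
      (q₀ := -(T / 2)) (q₁ := T / 2) (g := g)
    rwa [neg_neg] at this

end

theorem mainTheorem2
    (M : Set Target) (hM : IsSmoothSubmanifold M) (hMc : IsCompact M) (hMconn : IsConnected M)
    (f : Pt → Mat33 → ℝ) (hf : IsCaratheodory f)
    (H1 : ∀ (x : Pt) (ξ : Mat33) (i : Fin 2),
      f (x.1 + EuclideanSpace.single i 1, x.2) ξ = f x ξ)
    (H2 : ∃ α > (0 : ℝ), ∃ β > (0 : ℝ), ∀ᵐ x : Pt, ∀ ξ : Mat33,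
      α * ‖ξ‖ ≤ f x ξ ∧ f x ξ ≤ β * (1 + ‖ξ‖))
    (H3 : ∃ L > (0 : ℝ), ∀ᵐ x : Pt, ∀ ξ η : Mat33, |f x ξ - f x η| ≤ L * ‖ξ - η‖)
    (H4 : ∃ C > (0 : ℝ), ∃ q : ℝ, 0 < q ∧ q < 1 ∧ ∀ᵐ x : Pt, ∀ ξ : Mat33,
      |f x ξ - recession f x ξ| ≤ C * (1 + ‖ξ‖ ^ (1 - q)))
    (a b : Target) (ha : a ∈ M) (hb : b ∈ M) (ν₁ : Plane) (hν₁ : ‖ν₁‖ = 1) :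
    ∃ θ : ℝ, 0 ≤ θ ∧ ∀ ν₂ : Plane, Orthonormal ℝ ![ν₁, ν₂] →
      Tendsto (fun t : ℝ => minEnergyA f M a b ν₁ ν₂ t) atTop (𝓝 (ENNReal.ofReal θ)) ∧
      Tendsto (fun h : ℝ => minEnergyB f M a b ν₁ ν₂ h) (𝓝[>] 0) (𝓝 (ENNReal.ofReal θ)) := by
  obtain ⟨α, hα, β, hβ, hfx⟩ := H2
  have hF : ∀ᵐ x, ∀ ξ, recession f x ξ ≤ β * ‖ξ‖ := hfx.mono fun x hx =>
    recession_le fun ξ => ⟨(mul_nonneg hα.le (norm_nonneg ξ)).trans (hx ξ).1, (hx ξ).2⟩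
  have hper : ∀ z : Plane, (∀ i, ∃ n : ℤ, z i = n) →
      ∀ x ξ, recession f (x.1 + z, x.2) ξ = recession f x ξ :=
    fun z hz x ξ => recession_periodic H1 hz x ξ
  have hD := hM.geodesicDist_lt_top hMconn ha hb
  obtain ⟨γ, hγ⟩ := geodesicProfiles_nonempty hM hMc hMconn ha hb
  obtain ⟨ν, hν⟩ := exists_frame hν₁
  obtain ⟨θ, hθ, hlim⟩ := exists_tendsto_squareEnergy hν hβ.le hF hper hMc hγ hD
  refine ⟨θ, hθ, fun ν₂ hν₂ => tendsto_minEnergy hν₂ hβ.le hF hMc hγ hD ?_⟩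
  simpa only [squareEnergy_frame hν hν₂] using hlim
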